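/- Let $A$ be a subgroup of an abelian group $\tilde A$, let $V$ be a strongly $A$-graded Möbius or conformal vertex algebra with vertex operator map $Y(v,x)=\sum_{n\in\mathbb Z}v_nx^{-n-1}$, let $(W_1,Y_1)$ and $(W_2,Y_2)$ be strongly $\tilde A$-graded generalized $V$-modules (graded by generalized eigenspaces of $L(0)$), and let $z\in\mathbb C^\times$. ("Strongly graded" includes that the homogeneous subspaces of given degree in $A$, resp. $\tilde A$, and given weight are finite-dimensional, and vanish when, for fixed degree, the weight is shifted by a sufficiently negative integer.) For $v\in V$ of weight $h$ and $f\in\mathbb C(t)$ put $$(v\otimes f(t))^o=(-1)^h\sum_{m\ge0}\tfrac1{m!}L(1)^mv\otimes t^{-m-2+2h}f(t^{-1}),$$ extended linearly to $V\otimes\mathbb C(t)$, let $T_z$ be the translation $f(t)\mapsto f(t+z)$, let $\iota_+:\mathbb C(t)\to\mathbb C((t))$ be the expansion in powers of $t$, and put $\tau_{W_i}(v\otimes\sum_na_nt^n)=\sum_na_nv_n$ on $W_i$. For $\xi\in V\otimes\mathbb C[t,t^{-1},(z^{-1}-t)^{-1}]$ and $\lambda\in(W_1\otimes W_2)^*$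 define $$(\tau_{P(z)}(\xi)\lambda)(w_{1}\otimes w_{2})=\lambda\big(\tau_{W_1}(\iota_+T_z(\xi^o))w_{1}\otimes w_{2}\big)+\lambda\big(w_{1}\otimes\tau_{W_2}(\iota_+(\xi^o))w_{2}\big),$$ and $Y'_{P(z)}(v,x)=\sum_{n\in\mathbb Z}\tau_{P(z)}(v\otimes t^n)x^{-n-1}$. If $V$ is Möbius, define, for $j=-1,0,1$, $$(L'_{P(z)}(j)\lambda)(w_{1}\otimes w_{2})=\lambda\Big(w_{1}\otimes L(-j)w_{2}+\sum_{i=0}^{1-j}\tbinom{1-j}{i}z^iL(-j-i)w_{1}\otimes w_{2}\Big);$$ if $V$ is conformal with conformal vector $\omega$, define $L'_{P(z)}(n)$ by $Y'_{P(z)}(\omega,x)=\sum_{n\in\mathbb Z} L'_{P(z)}(n)x^{-n-2}$. Let $\mathrm{COMP}_{P(z)}((W_1\otimes W_2)^*)$ be the set of all $\lambda\in(W_1\otimes W_2)^*$ such that, for all $v\in V$, the series $Y'_{P(z)}(v,x)\lambda$ involves only finitely many negative powers of $x$, and $$\tau_{P(z)}\Big(x_0^{-1}\delta\Big(\frac{x_1^{-1}-z}{x_0}\Big)Y_t(v,x_1)\Big)\lambda=x_0^{-1}\delta\Big(\frac{x_1^{-1}-z}{x_0}\Big)Y'_{P(z)}(v,x_1)\lambda,$$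 where $Y_t(v,x)=\sum_{n\in\mathbb Z}(v\otimes t^n)x^{-n-1}$; that is, for all $n,m\in\mathbb Z$, $$\tau_{P(z)}\big(v\otimes(t^{-1}-z)^nt^m\big)\lambda=\sum_{i\ge0}\tbinom ni(-z)^i\,\tau_{P(z)}(v\otimes t^{m-n+i})\lambda .$$ For $\beta\in\tilde A$ let $((W_1\otimes W_2)^*)^{(\beta)}$ be the space of functionals vanishing on $(W_1\otimes W_2)^{(\gamma)}$ for all $\gamma\neq-\beta$, and for $n\in\mathbb C$ let $((W_1\otimes W_2)^*)^{(\beta)}_{[n]}$, resp. $((W_1\otimes W_2)^*)^{(\beta)}_{(n)}$, be its intersection with the generalized eigenspace, resp. the eigenspace, of $L'_{P(z)}(0)$ with eigenvalue $n$. Let $\mathrm{LGR}_{[\mathbb C];P(z)}((W_1\otimes W_2)^*)$ be the set of all $\lambda$ such that (a) $\lambda\in\coprod_{n,\beta}((W_1\otimes W_2)^*)^{(\beta)}_{[n]}$, and (b) the smallest doubly graded subspace $W_\lambda$ of this space that contains $\lambda$ and is stable under all $\tau_{P(z)}(v\otimes t^m)$ ($v\in V$, $m\in\mathbb Z$) and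 under $L'_{P(z)}(-1),L'_{P(z)}(0),L'_{P(z)}(1)$ satisfies, for all $n\in\mathbb C$ and $\beta\in\tilde A$, $\dim(W_\lambda)^{(\beta)}_{[n]}<\infty$ and $(W_\lambda)^{(\beta)}_{[n+k]}=0$ for $k\in\mathbb Z$ sufficiently negative. Let $\mathrm{LGR}_{(\mathbb C);P(z)}((W_1\otimes W_2)^*)$ be defined in the same way with $(n)$ in place of $[n]$ throughout. A weak $V$-module is a vector space $W$ with a linear map $Y_W:V\otimes W\to W[[x,x^{-1}]]$ satisfying lower truncation, $Y_W(\mathbf 1,x)=1$, the Jacobi identity and $\frac{d}{dx}Y_W(v,x)=Y_W(L(-1)v,x)$ and, in case $V$ is Möbius, also equipped with a representation $L(-1),L(0),L(1)$ of $\mathfrak{sl}(2)$ such that $[L(-1),Y_W(v,x)]=Y_W(L(-1)v,x)$, $[L(0),Y_W(v,x)]=Y_W(L(0)v,x)+xY_W(L(-1)v,x)$ and $[L(1),Y_W(v,x)]=Y_W(L(1)v,x)+2xY_W(L(0)v,x)+x^2Y_W(L(-1)v,x)$. **Theorem.** Each of the three sets $$\mathrm{COMP}_{P(z)}((W_1\otimes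 W_2)^*),\qquad \mathrm{COMP}_{P(z)}((W_1\otimes W_2)^*)\cap\mathrm{LGR}_{[\mathbb C];P(z)}((W_1\otimes W_2)^*),$$ $$\mathrm{COMP}_{P(z)}((W_1\otimes W_2)^*)\cap\mathrm{LGR}_{(\mathbb C);P(z)}((W_1\otimes W_2)^*)$$ is a subspace of $(W_1\otimes W_2)^*$ which, equipped with the vertex operator map $Y'_{P(z)}$ and, in case $V$ is Möbius, also with the operators $L'_{P(z)}(-1)$, $L'_{P(z)}(0)$ and $L'_{P(z)}(1)$, is a weak $V$-module (in particular, it is stable under the components of $Y'_{P(z)}$ and, in the Möbius case, under these operators). -/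

import Mathlib

open scoped TensorProduct

noncomputable section

namespace LogTensor

/-! ### Formal calculus

A series `Y(v,x) = ∑ v_n x^{-n-1}` with `v_n ∈ End W` is encoded by its modes `Y v n = v_n`;
an identity of formal series is stated coefficient by coefficient. -/

/-- Linear maps `V → (End W)[[x,x⁻¹]]`, `v ↦ Y(v,x) = ∑ₙ (Y v n) x^{-n-1}`; equivalently linear
maps `V ⊗ W → W[[x,x⁻¹]]`. -/
abbrev Modes (V W : Type*) [AddCommGroup V] [Module ℂ V] [AddCommGroup W] [Module ℂ W] :=
  V →ₗ[ℂ] ℤ → Module.End ℂ W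

/-- Three operators `L(-1), L(0), L(1)` on a vector space. -/
structure Sl2Ops (W : Type*) [AddCommGroup W] [Module ℂ W] where
  neg : Module.End ℂ W
  zero : Module.End ℂ W
  pos : Module.End ℂ W

section Axioms

variable {V W : Type*} [AddCommGroup V] [Module ℂ V] [AddCommGroup W] [Module ℂ W]

/-- The operators form a representation of `sl(2)`, with basis `L₋₁, L₀, L₁` and brackets
`[L₀,L₋₁] = L₋₁`, `[L₀,L₁] = -L₁`, `[L₋₁,L₁] = -2L₀`. -/
structure Sl2Ops.IsRep (L : Sl2Ops W) : Prop where
  zero_neg : ⁅L.zero, L.neg⁆ = L.neg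
  zero_pos : ⁅L.zero, L.pos⁆ = -L.pos
  neg_pos : ⁅L.neg, L.pos⁆ = -((2 : ℂ) • L.zero)

/-- Lower truncation: `v_n w = 0` for `n` sufficiently large, i.e. `Y(v,x)w ∈ W((x))`. -/
def LowerTruncated (Y : Modes V W) : Prop :=
  ∀ v w, ∃ N : ℤ, ∀ n, N ≤ n → Y v n w = 0

/-- `Y(𝟏,x) = 1`. -/
def VacuumProperty (vac : V) (Y : Modes V W) : Prop :=
  ∀ n : ℤ, Y vac n = if n = -1 then 1 else 0

/-- The Jacobi identity
`x₀⁻¹δ((x₁-x₂)/x₀) Y_W(u,x₁)Y_W(v,x₂) - x₀⁻¹δ((x₂-x₁)/(-x₀)) Y_W(v,x₂)Y_W(u,x₁)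
  = x₂⁻¹δ((x₁-x₀)/x₂) Y_W(Y(u,x₀)v,x₂)`
applied to `w`: equality of the coefficients of `x₀^{-l-1} x₁^{-m-1} x₂^{-k-1}`.
(All sums are finite if `Y` and `Y_W` are lower truncated.) -/
def JacobiIdentity (YV : Modes V V) (YW : Modes V W) : Prop :=
  ∀ (u v : V) (w : W) (l m k : ℤ),
    (∑ᶠ i : ℕ, ((-1 : ℂ) ^ i * (Ring.choose l i : ℤ)) • YW u (m + l - i) (YW v (k + i) w))
      - (∑ᶠ i : ℕ, ((-1 : ℂ) ^ (l + i) * (Ring.choose l i : ℤ)) •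
          YW v (k + l - i) (YW u (m + i) w))
      = ∑ᶠ i : ℕ, ((Ring.choose m i : ℤ) : ℂ) • YW (YV u (l + i) v) (m + k - i) w

/-- The `L(-1)`-derivative property `d/dx Y(v,x) = Y(L(-1)v,x)`: equality of the coefficients
of `x^{-n-1}`. -/
def DerivativeProperty (Lneg : Module.End ℂ V) (Y : Modes V W) : Prop :=
  ∀ (v : V) (n : ℤ), (-(n : ℂ)) • Y v (n - 1) = Y (Lneg v) n

/-- The commutator formulas
`[L(-1),Y(v,x)] = Y(L(-1)v,x)`, `[L(0),Y(v,x)] = Y(L(0)v,x) + xY(L(-1)v,x)`,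
`[L(1),Y(v,x)] = Y(L(1)v,x) + 2xY(L(0)v,x) + x²Y(L(-1)v,x)`,
with `L(j)` acting on `V` by `LV` and on `W` by `LW`. -/
structure Sl2Commutators (LV : Sl2Ops V) (LW : Sl2Ops W) (Y : Modes V W) : Prop where
  neg : ∀ v n, ⁅LW.neg, Y v n⁆ = Y (LV.neg v) n
  zero : ∀ v n, ⁅LW.zero, Y v n⁆ = Y (LV.zero v) n + Y (LV.neg v) (n + 1)
  pos : ∀ v n, ⁅LW.pos, Y v n⁆ =
    Y (LV.pos v) n + (2 : ℂ) • Y (LV.zero v) (n + 1) + Y (LV.neg v) (n + 2)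

/-- With `L(n) = ω_{n+1}`, the operators `L(n)` on `W` satisfy the Virasoro relations with
central charge `c`, and `L` consists of `L(-1), L(0), L(1)`. -/
structure VirasoroRelations (ω : V) (c : ℂ) (L : Sl2Ops W) (Y : Modes V W) : Prop where
  neg_eq : L.neg = Y ω 0
  zero_eq : L.zero = Y ω 1
  pos_eq : L.pos = Y ω 2
  bracket : ∀ m n : ℤ, ⁅Y ω (m + 1), Y ω (n + 1)⁆ =
    ((m : ℂ) - n) • Y ω (m + n + 1) +
      (if m + n = 0 then ((m : ℂ) ^ 3 - m) / 12 * c else 0) • (1 : Module.End ℂ W)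

/-- `M = ∐ᵢ E i`. -/
def IsGrading {ι M : Type*} [AddCommGroup M] [Module ℂ M] (E : ι → Submodule ℂ M) : Prop :=
  iSupIndep E ∧ iSup E = ⊤

end Axioms

/-! ### Strongly graded vertex algebras and generalized modules -/

/-- The data and axioms shared by strongly `A`-graded Möbius vertex algebras and strongly
`A`-graded conformal vertex algebras. The subspace `V_(n)` is the `n`-eigenspace of `L(0)`: since
`V = ∐ₙ V_(n)` with `L(0) = n` on `V_(n)`, there is no other choice. -/
structure VertexAlgebra (A : Type*) [AddCommGroup A] (V : Type*) [AddCommGroup V] [Module ℂ V]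
    where
  Y : Modes V V
  vac : V
  L : Sl2Ops V
  /-- `deg α = V^{(α)}` -/
  deg : A → Submodule ℂ V
  truncation : LowerTruncated Y
  vacuum : VacuumProperty vac Y
  creation : ∀ v, (∀ n : ℤ, 0 ≤ n → Y v n vac = 0) ∧ Y v (-1) vac = v
  jacobi : JacobiIdentity Y Y
  derivative : DerivativeProperty L.neg Y
  sl2 : L.IsRep
  wt_grading : IsGrading fun n : ℤ => L.zero.eigenspace (n : ℂ)
  deg_grading : IsGrading deg
  compat : ∀ α, deg α = ⨆ n : ℤ, L.zero.eigenspace (n : ℂ) ⊓ deg α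
  lower_bound : ∀ α, ∃ N : ℤ, ∀ n : ℤ, n < N → L.zero.eigenspace (n : ℂ) ⊓ deg α = ⊥
  finite_dim : ∀ (α : A) (n : ℤ),
    FiniteDimensional ℂ (L.zero.eigenspace (n : ℂ) ⊓ deg α : Submodule ℂ V)
  vac_mem : vac ∈ L.zero.eigenspace 0 ⊓ deg 0
  mode_deg : ∀ (α β : A), ∀ u ∈ deg α, ∀ v ∈ deg β, ∀ n, Y u n v ∈ deg (α + β)
  L_deg : ∀ (α : A), ∀ v ∈ deg α, L.neg v ∈ deg α ∧ L.zero v ∈ deg α ∧ L.pos v ∈ deg α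

namespace VertexAlgebra

variable {A V : Type*} [AddCommGroup A] [AddCommGroup V] [Module ℂ V]

/-- Strongly graded Möbius vertex algebras. -/
def IsMobius (𝒱 : VertexAlgebra A V) : Prop :=
  Sl2Commutators 𝒱.L 𝒱.L 𝒱.Y

/-- Strongly graded conformal vertex algebras with conformal vector `ω` and central charge `c`. -/
structure IsConformal (𝒱 : VertexAlgebra A V) (ω : V) (c : ℂ) : Prop where
  mem : ω ∈ 𝒱.L.zero.eigenspace 2 ⊓ 𝒱.deg 0
  virasoro : VirasoroRelations ω c 𝒱.L 𝒱.Y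

/-- `L(1)` lowers the weight by one and preserves the `A`-degree. -/
theorem pos_mem (𝒱 : VertexAlgebra A V) {n : ℤ} {α : A} {v : V}
    (hv : v ∈ 𝒱.L.zero.eigenspace (n : ℂ) ⊓ 𝒱.deg α) :
    𝒱.L.pos v ∈ 𝒱.L.zero.eigenspace ((n - 1 : ℤ) : ℂ) ⊓ 𝒱.deg α := by
  refine ⟨?_, (𝒱.L_deg α v hv.2).2.2⟩
  have h0 := Module.End.mem_eigenspace_iff.1 hv.1
  have h := LinearMap.congr_fun 𝒱.sl2.zero_pos v
  rw [Ring.lie_def] at h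
  simp only [LinearMap.sub_apply, Module.End.mul_apply, LinearMap.neg_apply, h0, map_smul] at h
  refine Module.End.mem_eigenspace_iff.2 ?_
  rw [sub_eq_iff_eq_add.1 h]
  push_cast
  module

/-- `L(1)` is locally nilpotent on `V`. -/
theorem pos_locally_nilpotent (𝒱 : VertexAlgebra A V) (v : V) :
    ∃ k : ℕ, ∀ m, k ≤ m → (𝒱.L.pos ^ m) v = 0 := by
  have key : ∀ (m : ℕ) (n : ℤ) (α : A) (v : V),
      v ∈ 𝒱.L.zero.eigenspace (n : ℂ) ⊓ 𝒱.deg α →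
      (𝒱.L.pos ^ m) v ∈ 𝒱.L.zero.eigenspace ((n - m : ℤ) : ℂ) ⊓ 𝒱.deg α := by
    intro m
    induction m with
    | zero => intro n α v hv; simpa using hv
    | succ m ih =>
      intro n α v hv
      have := ih (n - 1) α _ (𝒱.pos_mem hv)
      rw [pow_succ, Module.End.mul_apply]
      convert this using 4
      push_cast
      ring
  have htop : 𝒱.L.pos.maxGenEigenspace 0 = ⊤ := by
    rw [eq_top_iff, ← 𝒱.deg_grading.2]
    refine iSup_le fun α => ?_
    rw [𝒱.compat α]
    refine iSup_le fun n v hv => ?_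
    obtain ⟨N, hN⟩ := 𝒱.lower_bound α
    rw [Module.End.mem_maxGenEigenspace]
    refine ⟨(n - N + 1).toNat, ?_⟩
    have h1 := key (n - N + 1).toNat n α v hv
    rw [hN _ (by omega)] at h1
    simpa using h1
  have hv : v ∈ 𝒱.L.pos.maxGenEigenspace 0 := htop ▸ Submodule.mem_top
  obtain ⟨k, hk⟩ := Module.End.mem_maxGenEigenspace _ _ _ |>.1 hv
  refine ⟨k, fun m hm => ?_⟩
  obtain ⟨d, rfl⟩ := Nat.exists_eq_add_of_le' hm
  rw [pow_add, Module.End.mul_apply]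
  simp only [zero_smul, sub_zero] at hk
  rw [hk, map_zero]

end VertexAlgebra

/-- The data and axioms shared by strongly `G`-graded generalized modules for Möbius and for
conformal vertex algebras, where `A` is a subgroup of `G`. The module is graded by the generalized
eigenspaces `W_[n]` of `L(0)`, `n ∈ ℂ`, and by subspaces `deg β = W^{(β)}`, `β ∈ G`. -/
structure GeneralizedModule {G : Type*} [AddCommGroup G] {A : AddSubgroup G}
    {V : Type*} [AddCommGroup V] [Module ℂ V] (𝒱 : VertexAlgebra A V)
    (W : Type*) [AddCommGroup W] [Module ℂ W] where
  Y : Modes V W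
  L : Sl2Ops W
  deg : G → Submodule ℂ W
  truncation : LowerTruncated Y
  vacuum : VacuumProperty 𝒱.vac Y
  jacobi : JacobiIdentity 𝒱.Y Y
  derivative : DerivativeProperty 𝒱.L.neg Y
  sl2 : L.IsRep
  wt_grading : IsGrading fun n : ℂ => L.zero.maxGenEigenspace n
  deg_grading : IsGrading deg
  compat : ∀ β, deg β = ⨆ n : ℂ, L.zero.maxGenEigenspace n ⊓ deg β
  lower_bound : ∀ (β : G) (n : ℂ), ∃ K : ℤ, ∀ k : ℤ, k < K →
    L.zero.maxGenEigenspace (n + k) ⊓ deg β = ⊥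
  finite_dim : ∀ (β : G) (n : ℂ),
    FiniteDimensional ℂ (L.zero.maxGenEigenspace n ⊓ deg β : Submodule ℂ W)
  mode_deg : ∀ (α : A) (β : G), ∀ v ∈ 𝒱.deg α, ∀ w ∈ deg β, ∀ n, Y v n w ∈ deg (α + β)
  L_deg : ∀ (β : G), ∀ w ∈ deg β, L.neg w ∈ deg β ∧ L.zero w ∈ deg β ∧ L.pos w ∈ deg β

namespace GeneralizedModule

variable {G : Type*} [AddCommGroup G] {A : AddSubgroup G} {V : Type*} [AddCommGroup V]
  [Module ℂ V] {𝒱 : VertexAlgebra A V} {W : Type*} [AddCommGroup W] [Module ℂ W]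

/-- Generalized modules for a Möbius vertex algebra. -/
def IsMobius (M : GeneralizedModule 𝒱 W) : Prop :=
  Sl2Commutators 𝒱.L M.L M.Y

/-- Generalized modules for a conformal vertex algebra with conformal vector `ω` and central
charge `c`. -/
def IsConformal (M : GeneralizedModule 𝒱 W) (ω : V) (c : ℂ) : Prop :=
  VirasoroRelations ω c M.L M.Y

end GeneralizedModule

/-! ### The action `τ_W` of `V ⊗ ℂ((t))` -/

section TauW

variable {V W : Type*} [AddCommGroup V] [Module ℂ V] [AddCommGroup W] [Module ℂ W]

theorem finite_support_modes {Y : Modes V W} (hY : LowerTruncated Y) (v : V)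
    (f : LaurentSeries ℂ) (w : W) :
    (Function.support fun n : ℤ => f.coeff n • Y v n w).Finite := by
  obtain ⟨N, hN⟩ := hY v w
  refine (Set.finite_Icc f.order N).subset fun n hn => ⟨?_, ?_⟩
  · by_contra h
    exact hn (by simp [HahnSeries.coeff_eq_zero_of_lt_order (not_le.1 h)])
  · by_contra h
    exact hn (by simp [hN n (not_le.1 h).le])

/-- `τ_W(v ⊗ ∑ₙ aₙtⁿ) = ∑ₙ aₙvₙ`. -/
def tauW (Y : Modes V W) (hY : LowerTruncated Y) :
    V ⊗[ℂ] LaurentSeries ℂ →ₗ[ℂ] Module.End ℂ W :=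
  TensorProduct.lift <| LinearMap.mk₂ ℂ
    (fun v f =>
      { toFun := fun w => ∑ᶠ n : ℤ, f.coeff n • Y v n w
        map_add' := fun w w' => by
          rw [← finsum_add_distrib (finite_support_modes hY v f w)
            (finite_support_modes hY v f w')]
          simp
        map_smul' := fun a w => by
          rw [RingHom.id_apply, smul_finsum]
          exact finsum_congr fun n => by rw [map_smul, smul_comm] })
    (fun v v' f => LinearMap.ext fun w => by
      simp only [LinearMap.coe_mk, AddHom.coe_mk, LinearMap.add_apply]
      rw [← finsum_add_distrib (finite_support_modes hY v f w)
        (finite_support_modes hY v' f w)]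
      simp)
    (fun a v f => LinearMap.ext fun w => by
      simp only [LinearMap.coe_mk, AddHom.coe_mk, LinearMap.smul_apply]
      rw [smul_finsum]
      exact finsum_congr fun n => by
        rw [map_smul, Pi.smul_apply, LinearMap.smul_apply, smul_comm])
    (fun v f f' => LinearMap.ext fun w => by
      simp only [LinearMap.coe_mk, AddHom.coe_mk, LinearMap.add_apply]
      rw [← finsum_add_distrib (finite_support_modes hY v f w)
        (finite_support_modes hY v f' w)]
      simp [add_smul])
    (fun a v f => LinearMap.ext fun w => by
      simp only [LinearMap.coe_mk, AddHom.coe_mk, LinearMap.smul_apply]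
      rw [smul_finsum]
      exact finsum_congr fun n => by simp [mul_smul])

end TauW

/-! ### Rational functions -/

theorem transcendental_X : Transcendental ℂ (RatFunc.X : RatFunc ℂ) := by
  rw [transcendental_iff_injective]
  have h : (Polynomial.aeval (RatFunc.X : RatFunc ℂ)) =
      IsScalarTower.toAlgHom ℂ (Polynomial ℂ) (RatFunc ℂ) := by
    ext
    simp
  rw [h]
  exact IsFractionRing.injective (Polynomial ℂ) (RatFunc ℂ)

theorem transcendental_X_inv : Transcendental ℂ (RatFunc.X⁻¹ : RatFunc ℂ) := fun h =>
  transcendental_X (by simpa using h.inv)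

theorem transcendental_X_add (a : ℂ) :
    Transcendental ℂ (RatFunc.X + RatFunc.C a : RatFunc ℂ) := fun h =>
  transcendental_X (by
    have h2 : IsAlgebraic ℂ (RatFunc.C a : RatFunc ℂ) := isAlgebraic_algebraMap (A := RatFunc ℂ) a
    simpa using h.sub h2)

/-- The substitution `f(t) ↦ f(g(t))` on `ℂ(t)`, for `g(t)` not constant. -/
def ratSubst (g : RatFunc ℂ) (hg : Transcendental ℂ g) : RatFunc ℂ →ₐ[ℂ] RatFunc ℂ :=
  IsFractionRing.liftAlgHom (transcendental_iff_injective.1 hg)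

/-- `f(t) ↦ f(t⁻¹)` -/
def ratInv : RatFunc ℂ →ₐ[ℂ] RatFunc ℂ := ratSubst RatFunc.X⁻¹ transcendental_X_inv

/-- The translation `T_a : f(t) ↦ f(t + a)`. -/
def ratShift (a : ℂ) : RatFunc ℂ →ₐ[ℂ] RatFunc ℂ :=
  ratSubst (RatFunc.X + RatFunc.C a) (transcendental_X_add a)

theorem polynomial_to_laurent_injective :
    Function.Injective
      ((HahnSeries.ofPowerSeries ℤ ℂ).comp (Polynomial.coeToPowerSeries.ringHom (R := ℂ))) :=
  HahnSeries.ofPowerSeries_injective.comp (Polynomial.coe_injective ℂ)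

/-- The expansion `ι₊ : ℂ(t) → ℂ((t))` in powers of `t`, as a ring homomorphism: the unique
extension of the inclusion `ℂ[t] ⊂ ℂ((t))`. -/
def iotaPlusHom : RatFunc ℂ →+* LaurentSeries ℂ :=
  IsFractionRing.lift polynomial_to_laurent_injective

theorem iotaPlusHom_C (a : ℂ) : iotaPlusHom (RatFunc.C a) = HahnSeries.C a := by
  rw [← RatFunc.algebraMap_C, iotaPlusHom, IsFractionRing.lift_algebraMap]
  simp

/-- The expansion `ι₊ : ℂ(t) → ℂ((t))` as a linear map. -/
def iotaPlus : RatFunc ℂ →ₗ[ℂ] LaurentSeries ℂ where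
  toFun := iotaPlusHom
  map_add' := map_add _
  map_smul' a f := by
    rw [RatFunc.smul_eq_C_mul, map_mul, iotaPlusHom_C, HahnSeries.C_mul_eq_smul]
    rfl

/-! ### The opposite-operator map -/

namespace VertexAlgebra

variable {A V : Type*} [AddCommGroup A] [AddCommGroup V] [Module ℂ V]

theorem wt_bijective (𝒱 : VertexAlgebra A V) :
    Function.Bijective
      (DirectSum.coeLinearMap fun h : ℤ => 𝒱.L.zero.eigenspace (h : ℂ)) :=
  (DirectSum.isInternal_submodule_iff_iSupIndep_and_iSup_eq_top _).2
    ⟨𝒱.wt_grading.1, 𝒱.wt_grading.2⟩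

theorem finite_support_opp (𝒱 : VertexAlgebra A V) {X : Type*} [AddCommGroup X] [Module ℂ X]
    (F : ℕ → V →ₗ[ℂ] X) (v : V) :
    (Function.support fun m : ℕ => F m ((𝒱.L.pos ^ m) v)).Finite := by
  obtain ⟨k, hk⟩ := 𝒱.pos_locally_nilpotent v
  refine (Set.finite_lt_nat k).subset fun m hm => ?_
  by_contra h
  exact hm (by simp [hk m (not_lt.1 h)])

/-- For `v ∈ V_(h)`: `v ↦ v^o = (-1)^h ∑ₘ (1/m!) L(1)^m v ⊗ t^{-m-2+2h}`. -/
def oppHom (𝒱 : VertexAlgebra A V) (h : ℤ) : V →ₗ[ℂ] V ⊗[ℂ] RatFunc ℂ :=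
  let F : ℕ → V →ₗ[ℂ] V ⊗[ℂ] RatFunc ℂ := fun m =>
    ((-1 : ℂ) ^ h * (m.factorial : ℂ)⁻¹) •
      (TensorProduct.mk ℂ V (RatFunc ℂ)).flip (RatFunc.X ^ (-(m : ℤ) - 2 + 2 * h))
  { toFun := fun v => ∑ᶠ m : ℕ, F m ((𝒱.L.pos ^ m) v)
    map_add' := fun v v' => by
      rw [← finsum_add_distrib (𝒱.finite_support_opp F v) (𝒱.finite_support_opp F v')]
      simp only [map_add]
    map_smul' := fun a v => by
      rw [RingHom.id_apply, smul_finsum]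
      simp only [map_smul] }

/-- `v ↦ v^o`, the linear extension of the preceding maps from the `V_(h)` to `V = ∐ V_(h)`. -/
def opp (𝒱 : VertexAlgebra A V) : V →ₗ[ℂ] V ⊗[ℂ] RatFunc ℂ :=
  DirectSum.toModule ℂ ℤ _
      (fun h => 𝒱.oppHom h ∘ₗ (𝒱.L.zero.eigenspace (h : ℂ)).subtype) ∘ₗ
    (LinearEquiv.ofBijective
      (DirectSum.coeLinearMap fun h : ℤ => 𝒱.L.zero.eigenspace (h : ℂ))
      𝒱.wt_bijective).symm.toLinearMap

/-- The opposite-operator map `(v ⊗ f(t))^o = v^o f(t⁻¹)` on `V ⊗ ℂ(t)`. For rational functions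
identified with their expansions in `ℂ((t))` this is `ι₋⁻¹ ∘ o`: the map `o` sends an expansion in
`ℂ((t))` to one in `ℂ((t⁻¹))`. -/
def oppMap (𝒱 : VertexAlgebra A V) : V ⊗[ℂ] RatFunc ℂ →ₗ[ℂ] V ⊗[ℂ] RatFunc ℂ :=
  TensorProduct.lift <|
    (LinearMap.lTensorHom V ∘ₗ LinearMap.mul ℂ (RatFunc ℂ) ∘ₗ ratInv.toLinearMap).flip ∘ₗ 𝒱.opp

end VertexAlgebra

/-! ### The action on `(W₁ ⊗ W₂)^*` -/

section Dual

variable {G : Type*} [AddCommGroup G] {A : AddSubgroup G} {V : Type*} [AddCommGroup V]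
  [Module ℂ V] {𝒱 : VertexAlgebra A V}
  {W₁ : Type*} [AddCommGroup W₁] [Module ℂ W₁] {W₂ : Type*} [AddCommGroup W₂] [Module ℂ W₂]

/-- The full dual space `(W₁ ⊗ W₂)^*`. -/
abbrev TDual (W₁ W₂ : Type*) [AddCommGroup W₁] [Module ℂ W₁] [AddCommGroup W₂] [Module ℂ W₂] :=
  Module.Dual ℂ (W₁ ⊗[ℂ] W₂)

/-- The action `τ_{P(z)}` on `(W₁ ⊗ W₂)^*`:
`(τ_{P(z)}(ξ)λ)(w₁ ⊗ w₂) = λ(τ_{W₁}((ι₊ ∘ T_z ∘ ι₋⁻¹ ∘ o)ξ) w₁ ⊗ w₂)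
  + λ(w₁ ⊗ τ_{W₂}((ι₊ ∘ ι₋⁻¹ ∘ o)ξ) w₂)`.
It is used for `ξ ∈ V ⊗ ι₊ℂ[t, t⁻¹, (z⁻¹ - t)⁻¹]`, but the formula makes sense on all of
`V ⊗ ι₊ℂ(t)`, which is identified with `V ⊗ ℂ(t)`. -/
def tauP (M₁ : GeneralizedModule 𝒱 W₁) (M₂ : GeneralizedModule 𝒱 W₂) (z : ℂ) :
    V ⊗[ℂ] RatFunc ℂ →ₗ[ℂ] Module.End ℂ (TDual W₁ W₂) :=
  Module.Dual.transpose ∘ₗ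
    (LinearMap.rTensorHom W₂ ∘ₗ tauW M₁.Y M₁.truncation ∘ₗ
        LinearMap.lTensor V iotaPlus ∘ₗ
        LinearMap.lTensor V (ratShift z).toLinearMap ∘ₗ 𝒱.oppMap +
      LinearMap.lTensorHom W₁ ∘ₗ tauW M₂.Y M₂.truncation ∘ₗ
        LinearMap.lTensor V iotaPlus ∘ₗ 𝒱.oppMap)

/-- `Y'_{P(z)}(v,x) = τ_{P(z)}(Y_t(v,x)) = ∑ₙ τ_{P(z)}(v ⊗ tⁿ) x^{-n-1}`. -/
def YP (M₁ : GeneralizedModule 𝒱 W₁) (M₂ : GeneralizedModule 𝒱 W₂) (z : ℂ) :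
    Modes V (TDual W₁ W₂) :=
  LinearMap.pi fun n =>
    tauP M₁ M₂ z ∘ₗ (TensorProduct.mk ℂ V (RatFunc ℂ)).flip (RatFunc.X ^ n)

/-- The operators `L'_{P(z)}(j)`, `j = -1, 0, 1`, for a Möbius vertex algebra:
`(L'_{P(z)}(j)λ)(w₁ ⊗ w₂)
  = λ(w₁ ⊗ L(-j)w₂ + (∑_{i=0}^{1-j} (1-j choose i) zⁱ L(-j-i)) w₁ ⊗ w₂)`. -/
def LP (M₁ : GeneralizedModule 𝒱 W₁) (M₂ : GeneralizedModule 𝒱 W₂) (z : ℂ) :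
    Sl2Ops (TDual W₁ W₂) where
  neg := (M₂.L.pos.lTensor W₁ +
    (M₁.L.pos + (2 * z) • M₁.L.zero + z ^ 2 • M₁.L.neg).rTensor W₂).dualMap
  zero := (M₂.L.zero.lTensor W₁ + (M₁.L.zero + z • M₁.L.neg).rTensor W₂).dualMap
  pos := (M₂.L.neg.lTensor W₁ + M₁.L.neg.rTensor W₂).dualMap

/-- The operators `L'_{P(z)}(j)`, `j = -1, 0, 1`, for a conformal vertex algebra:
`Y'_{P(z)}(ω,x) = ∑ₙ L'_{P(z)}(n) x^{-n-2}`. -/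
def LPConformal (M₁ : GeneralizedModule 𝒱 W₁) (M₂ : GeneralizedModule 𝒱 W₂) (z : ℂ) (ω : V) :
    Sl2Ops (TDual W₁ W₂) where
  neg := YP M₁ M₂ z ω 0
  zero := YP M₁ M₂ z ω 1
  pos := YP M₁ M₂ z ω 2

/-- `COMP_{P(z)}((W₁ ⊗ W₂)^*)`: the set of `λ` satisfying the `P(z)`-compatibility condition.
The second clause says
`τ_{P(z)}(x₀⁻¹δ((x₁⁻¹-z)/x₀) Y_t(v,x₁)) λ = x₀⁻¹δ((x₁⁻¹-z)/x₀) Y'_{P(z)}(v,x₁) λ`: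
the coefficients of `x₀^{-n-1} x₁^{-m-1}` agree, that on the left being
`τ_{P(z)}(v ⊗ (t⁻¹-z)ⁿ tᵐ) λ`. -/
def compP (M₁ : GeneralizedModule 𝒱 W₁) (M₂ : GeneralizedModule 𝒱 W₂) (z : ℂ) :
    Set (TDual W₁ W₂) :=
  {lam | (∀ v : V, ∃ N : ℤ, ∀ n, N ≤ n → YP M₁ M₂ z v n lam = 0) ∧
    ∀ (v : V) (n m : ℤ),
      tauP M₁ M₂ z
          (v ⊗ₜ ((RatFunc.X⁻¹ - RatFunc.C z) ^ n * RatFunc.X ^ m)) lam =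
        ∑ᶠ i : ℕ, ((Ring.choose n i : ℤ) * (-z) ^ i : ℂ) • YP M₁ M₂ z v (m - n + i) lam}

/-- `(W₁ ⊗ W₂)^{(γ)}` for the tensor product grading. -/
def tensorDeg (M₁ : GeneralizedModule 𝒱 W₁) (M₂ : GeneralizedModule 𝒱 W₂) (γ : G) :
    Submodule ℂ (W₁ ⊗[ℂ] W₂) :=
  ⨆ p : {p : G × G // p.1 + p.2 = γ},
    Submodule.map₂ (TensorProduct.mk ℂ W₁ W₂) (M₁.deg p.1.1) (M₂.deg p.1.2)

/-- `((W₁ ⊗ W₂)^*)^{(β)}`: the functionals that vanish on `(W₁ ⊗ W₂)^{(γ)}` for `γ ≠ -β`. -/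
def dualDeg (M₁ : GeneralizedModule 𝒱 W₁) (M₂ : GeneralizedModule 𝒱 W₂) (β : G) :
    Submodule ℂ (TDual W₁ W₂) :=
  ⨅ (γ : G) (_ : γ ≠ -β), (tensorDeg M₁ M₂ γ).dualAnnihilator

/-- `((W₁ ⊗ W₂)^*)_{[n]}^{(β)}`, where `L` is the triple of operators `L'_{P(z)}(j)`. -/
def genPiece (M₁ : GeneralizedModule 𝒱 W₁) (M₂ : GeneralizedModule 𝒱 W₂)
    (L : Sl2Ops (TDual W₁ W₂)) (n : ℂ) (β : G) : Submodule ℂ (TDual W₁ W₂) :=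
  L.zero.maxGenEigenspace n ⊓ dualDeg M₁ M₂ β

/-- `((W₁ ⊗ W₂)^*)_{(n)}^{(β)}`, where `L` is the triple of operators `L'_{P(z)}(j)`. -/
def semisimplePiece (M₁ : GeneralizedModule 𝒱 W₁) (M₂ : GeneralizedModule 𝒱 W₂)
    (L : Sl2Ops (TDual W₁ W₂)) (n : ℂ) (β : G) : Submodule ℂ (TDual W₁ W₂) :=
  L.zero.eigenspace n ⊓ dualDeg M₁ M₂ β

end Dual

/-! ### Local grading restriction -/

section LGR

variable {G V D : Type*} [AddCommGroup V] [Module ℂ V] [AddCommGroup D] [Module ℂ D]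

/-- `S` is stable under all components of the vertex operators and under `L(-1), L(0), L(1)`. -/
structure IsStable (Y : Modes V D) (L : Sl2Ops D) (S : Submodule ℂ D) : Prop where
  mode : ∀ v n, ∀ x ∈ S, Y v n x ∈ S
  neg : ∀ x ∈ S, L.neg x ∈ S
  zero : ∀ x ∈ S, L.zero x ∈ S
  pos : ∀ x ∈ S, L.pos x ∈ S

/-- `S` is a doubly graded subspace of `∐_{n,β} E n β`. -/
def IsDoublyGraded (E : ℂ → G → Submodule ℂ D) (S : Submodule ℂ D) : Prop :=
  S = ⨆ (n : ℂ) (β : G), E n β ⊓ S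

/-- `W_λ`: the smallest doubly graded stable subspace of `∐_{n,β} E n β` that contains `λ`. -/
def generated (Y : Modes V D) (L : Sl2Ops D) (E : ℂ → G → Submodule ℂ D) (lam : D) :
    Submodule ℂ D :=
  sInf {S | lam ∈ S ∧ IsDoublyGraded E S ∧ IsStable Y L S}

/-- The set of all `λ` that satisfy the local grading restriction condition with respect to the
doubly graded space `∐_{n,β} E n β`: (a) `λ` lies in that space; (b) the homogeneous subspaces of
`W_λ` are finite-dimensional, and `(W_λ)_{n+k}^{(β)} = 0` for `k ∈ ℤ` sufficiently negative. -/
def localGradingRestriction (Y : Modes V D) (L : Sl2Ops D) (E : ℂ → G → Submodule ℂ D) : Set D :=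
  {lam | lam ∈ (⨆ (n : ℂ) (β : G), E n β) ∧
    ∀ (n : ℂ) (β : G),
      FiniteDimensional ℂ (E n β ⊓ generated Y L E lam : Submodule ℂ D) ∧
      ∃ K : ℤ, ∀ k : ℤ, k < K → E (n + k) β ⊓ generated Y L E lam = ⊥}

end LGR

section

variable {G : Type*} [AddCommGroup G] {A : AddSubgroup G} {V : Type*} [AddCommGroup V]
  [Module ℂ V] {𝒱 : VertexAlgebra A V}
  {W₁ : Type*} [AddCommGroup W₁] [Module ℂ W₁] {W₂ : Type*} [AddCommGroup W₂] [Module ℂ W₂]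

/-- `LGR_{[ℂ];P(z)}((W₁ ⊗ W₂)^*)` -/
def lgrGen (M₁ : GeneralizedModule 𝒱 W₁) (M₂ : GeneralizedModule 𝒱 W₂) (z : ℂ)
    (L : Sl2Ops (TDual W₁ W₂)) : Set (TDual W₁ W₂) :=
  localGradingRestriction (YP M₁ M₂ z) L (genPiece M₁ M₂ L)

/-- `LGR_{(ℂ);P(z)}((W₁ ⊗ W₂)^*)` -/
def lgrSemisimple (M₁ : GeneralizedModule 𝒱 W₁) (M₂ : GeneralizedModule 𝒱 W₂) (z : ℂ)
    (L : Sl2Ops (TDual W₁ W₂)) : Set (TDual W₁ W₂) :=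
  localGradingRestriction (YP M₁ M₂ z) L (semisimplePiece M₁ M₂ L)

end

/-! ### Weak modules -/

section Weak

variable {A V : Type*} [AddCommGroup A] [AddCommGroup V] [Module ℂ V]
  {W : Type*} [AddCommGroup W] [Module ℂ W]

/-- `(W, Y)` is a weak module for a conformal vertex algebra. -/
structure IsWeakModule (𝒱 : VertexAlgebra A V) (Y : Modes V W) : Prop where
  truncation : LowerTruncated Y
  vacuum : VacuumProperty 𝒱.vac Y
  jacobi : JacobiIdentity 𝒱.Y Y
  derivative : DerivativeProperty 𝒱.L.neg Y

/-- `(W, Y, L)` is a weak module for a Möbius vertex algebra. -/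
structure IsWeakMobiusModule (𝒱 : VertexAlgebra A V) (Y : Modes V W) (L : Sl2Ops W) : Prop
    extends IsWeakModule 𝒱 Y where
  sl2 : L.IsRep
  commutators : Sl2Commutators 𝒱.L L Y

/-- The restriction of `Y` to a subspace stable under all modes. -/
def Modes.restrict (Y : Modes V W) (S : Submodule ℂ W) (h : ∀ v n, ∀ w ∈ S, Y v n w ∈ S) :
    Modes V S where
  toFun v n := (Y v n).restrict (h v n)
  map_add' _ _ := by ext; simp
  map_smul' _ _ := by ext; simp

/-- The restriction of `L(-1), L(0), L(1)` to a stable subspace. -/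
def Sl2Ops.restrict (L : Sl2Ops W) (S : Submodule ℂ W) (hneg : ∀ w ∈ S, L.neg w ∈ S)
    (hzero : ∀ w ∈ S, L.zero w ∈ S) (hpos : ∀ w ∈ S, L.pos w ∈ S) : Sl2Ops S where
  neg := L.neg.restrict hneg
  zero := L.zero.restrict hzero
  pos := L.pos.restrict hpos

/-- The set `P` is a subspace, and equipped with (the restriction of) `Y` it is a weak module for
the conformal vertex algebra `𝒱`. -/
def IsWeakModuleOn (𝒱 : VertexAlgebra A V) (Y : Modes V W) (P : Set W) : Prop :=
  ∃ S : Submodule ℂ W, (S : Set W) = P ∧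
    ∃ h : ∀ v n, ∀ w ∈ S, Y v n w ∈ S, IsWeakModule 𝒱 (Y.restrict S h)

/-- The set `P` is a subspace, and equipped with (the restrictions of) `Y` and `L` it is a weak
module for the Möbius vertex algebra `𝒱`. -/
def IsWeakMobiusModuleOn (𝒱 : VertexAlgebra A V) (Y : Modes V W) (L : Sl2Ops W) (P : Set W) :
    Prop :=
  ∃ S : Submodule ℂ W, (S : Set W) = P ∧
    ∃ (h : ∀ v n, ∀ w ∈ S, Y v n w ∈ S) (hneg : ∀ w ∈ S, L.neg w ∈ S)
      (hzero : ∀ w ∈ S, L.zero w ∈ S) (hpos : ∀ w ∈ S, L.pos w ∈ S),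
      IsWeakMobiusModule 𝒱 (Y.restrict S h) (L.restrict S hneg hzero hpos)

end Weak

end LogTensor

end

noncomputable section

namespace LogTensor

/-! ### Laurent series and rational functions -/

/-! Put `oppMode M a` $= \tau_W\circ\iota_+\circ T_a\circ o$. Then $\tau_{P(z)}(\xi)$ is the
transpose of `oppMode M₁ z ξ` on the first factor plus `oppMode M₂ 0 ξ` on the second
(`tauP_eq_dualSum`). Operators on different factors commute, so brackets on the dual reduce to
brackets on one module, with rational functions expanded about a point $a$. This gives the
$\mathfrak{sl}(2)$ formulas (`LP_isRep`, `YP_sl2Commutators`) and locality,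
$(t_1-t_2)^L[\cdot,\cdot]=0$ (`exists_isLocal_tauP`), on the whole dual space.

Compatibility of $\lambda$ is equivalent to a uniform truncation: for each $v$ there is one $N$ such
that $\tau_{P(z)}(v\otimes(1-zt)^nt^a)\lambda=0$ for all integers $n$ and all $a\ge N$
(`coe_compSubmodule`). In this form the condition is linear in $\lambda$, is preserved by the
$L'_{P(z)}(j)$, and is preserved by the modes of $Y'_{P(z)}$ because of locality
(`YP_mem_compSubmodule`).

For the Jacobi identity, evaluate the difference of its two sides on $w_1\otimes w_2$
(`jacobiator_YP`). The terms with all operators on $w_2$ cancel, since opposite operators satisfy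
the Jacobi identity in reversed order, as for contragredient modules (`oppMode_jacobi`). In every
other term the first operator to act on $w_1$ is expanded about $z$. Multiplying its rational
function by a high power of $1-zt$ produces, after $t\mapsto t^{-1}$, a high power of $t-z$, which
kills $w_1$ (`exists_shiftOp_pow_oppMode_eq_zero`). So the difference, as a function of the
exponents $(m,k)$, is annihilated by $(1-zs_1)^P(1-zs_2)^P$ with $s_i$ the shifts. Stability and
lower truncation make it vanish for large $m$ at fixed $k$ and for large $k$ at fixed $m$; such a
function is zero (`eq_zero_of_biShift_eq_zero`). The derivative property follows from the vacuum
property and the Jacobi identity.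

For the grading restriction, $\lambda$ qualifies exactly when it lies in some doubly graded, stable
subspace with restricted grading (`mem_localGradingRestriction_iff`), and sums of two such subspaces
are again such. This uses that $L'_{P(z)}(j)$ and the modes of homogeneous vectors shift weight and
degree by constants. The conformal case reduces to the Möbius case because both definitions of
$L'_{P(z)}(j)$ agree (`LPConformal_eq_LP`). -/

theorem coeff_mul_eq_zero_of_lt {F H : LaurentSeries ℂ} {a b : ℤ} (hF : ∀ n < a, F.coeff n = 0)
    (hH : ∀ n < b, H.coeff n = 0) : ∀ n < a + b, (F * H).coeff n = 0 := by
  intro n hn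
  rw [HahnSeries.coeff_mul]
  refine Finset.sum_eq_zero fun p hp => ?_
  have hp' := (Finset.mem_antidiagonal.1 hp).2.2
  rcases lt_or_ge p.1 a with h | h
  · rw [hF _ h, zero_mul]
  · rw [hH p.2 (by omega), mul_zero]

theorem coeff_ofPowerSeries_of_neg (f : PowerSeries ℂ) :
    ∀ n < (0 : ℤ), (HahnSeries.ofPowerSeries ℤ ℂ f).coeff n = 0 := fun n hn => by
  rw [PowerSeries.coeff_coe, if_pos hn]

theorem ratSubst_X (g : RatFunc ℂ) (hg : Transcendental ℂ g) : ratSubst g hg RatFunc.X = g := by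
  have := IsFractionRing.liftAlgHom_apply (K := RatFunc ℂ) (transcendental_iff_injective.1 hg)
    (x := RatFunc.X)
  rw [ratSubst, this, ← RatFunc.algebraMap_X, IsFractionRing.lift_algebraMap]
  simp

theorem ratInv_X : ratInv RatFunc.X = RatFunc.X⁻¹ := ratSubst_X _ _

theorem ratShift_X (a : ℂ) : ratShift a RatFunc.X = RatFunc.X + RatFunc.C a := ratSubst_X _ _

theorem ratSubst_self (h : Transcendental ℂ (RatFunc.X : RatFunc ℂ)) :
    ratSubst RatFunc.X h = AlgHom.id ℂ (RatFunc ℂ) := by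
  ext f
  have key : ∀ p : Polynomial ℂ, ratSubst RatFunc.X h (algebraMap _ _ p) = algebraMap _ _ p := by
    intro p
    rw [ratSubst, IsFractionRing.liftAlgHom_apply, IsFractionRing.lift_algebraMap]
    refine Polynomial.induction_on' p (fun p q hp hq => by simp_all) fun n c => ?_
    simp [← Polynomial.C_mul_X_pow_eq_monomial]
  rw [← RatFunc.num_div_denom f, map_div₀, key, key, AlgHom.id_apply]

/-- Allows the $W_2$-term of $\tau_{P(z)}$ to be treated as the case $a=0$ of the construction that
gives the $W_1$-term at $a=z$. -/
theorem ratShift_zero : ratShift 0 = AlgHom.id ℂ (RatFunc ℂ) := by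
  rw [← ratSubst_self transcendental_X]
  unfold ratShift
  congr 1
  simp

/-- The expansion of rational functions in powers of `t - a`, as a ring homomorphism. -/
def expansion (a : ℂ) : RatFunc ℂ →+* LaurentSeries ℂ :=
  iotaPlusHom.comp (ratShift a).toRingHom

/-- The expansion of rational functions in powers of `t - a`, as a linear map. -/
def expansionLin (a : ℂ) : RatFunc ℂ →ₗ[ℂ] LaurentSeries ℂ :=
  iotaPlus ∘ₗ (ratShift a).toLinearMap

theorem expansionLin_apply (a : ℂ) (f : RatFunc ℂ) : expansionLin a f = expansion a f := rfl

theorem expansion_X (a : ℂ) :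
    expansion a RatFunc.X = HahnSeries.single 1 1 + HahnSeries.C a := by
  change iotaPlusHom (ratShift a RatFunc.X) = _
  rw [ratShift_X, map_add, iotaPlusHom_C, iotaPlusHom, ← RatFunc.algebraMap_X,
    IsFractionRing.lift_algebraMap]
  simp

theorem expansion_zero_X_zpow (n : ℤ) :
    expansion 0 (RatFunc.X ^ n) = HahnSeries.single n 1 := by
  rw [map_zpow₀, expansion_X, map_zero, add_zero, ← RatFunc.single_zpow]

/-- For $a\ne0$ the series $t+a$ is a unit of $\mathbb C[[t]]$, so all its integer powers are power
series. -/
theorem expansion_X_zpow_coeff {a : ℂ} (ha : a ≠ 0) (k : ℤ) :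
    ∀ n < 0, (expansion a (RatFunc.X ^ k)).coeff n = 0 := by
  have hu : IsUnit (PowerSeries.X + PowerSeries.C a : PowerSeries ℂ) := by
    rw [PowerSeries.isUnit_iff_constantCoeff]
    simpa using ha
  obtain ⟨u, hu⟩ := hu
  have h : expansion a (RatFunc.X ^ k) =
      HahnSeries.ofPowerSeries ℤ ℂ ((u ^ k : (PowerSeries ℂ)ˣ) : PowerSeries ℂ) := by
    have h1 : expansion a RatFunc.X = ((Units.map (HahnSeries.ofPowerSeries ℤ ℂ).toMonoidHom u :
        (LaurentSeries ℂ)ˣ) : LaurentSeries ℂ) := by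
      rw [expansion_X]
      simp [hu]
    rw [map_zpow₀, h1, ← Units.val_zpow_eq_zpow_val, ← map_zpow]
    rfl
  rw [h]
  exact coeff_ofPowerSeries_of_neg _

/-! ### The action of Laurent series -/

theorem finsum_eq_sum_range {X : Type*} [AddCommMonoid X] {f : ℕ → X} {B : ℕ}
    (h : ∀ i, B ≤ i → f i = 0) : ∑ᶠ i, f i = ∑ i ∈ Finset.range B, f i :=
  finsum_eq_sum_of_support_subset _ fun i hi => by
    by_contra hB
    exact hi (h i (by simpa using hB))

section TauW

variable {V W : Type*} [AddCommGroup V] [Module ℂ V] [AddCommGroup W] [Module ℂ W]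
  {Y : Modes V W}

theorem tauW_tmul (hY : LowerTruncated Y) (v : V) (F : LaurentSeries ℂ) (w : W) :
    tauW Y hY (v ⊗ₜ F) w = ∑ᶠ n : ℤ, F.coeff n • Y v n w := rfl

theorem tauW_single (hY : LowerTruncated Y) (v : V) (n : ℤ) (c : ℂ) :
    tauW Y hY (v ⊗ₜ HahnSeries.single n c) = c • Y v n := by
  ext w
  rw [tauW_tmul, finsum_eq_single _ n fun m hm => by
    rw [HahnSeries.coeff_single_of_ne hm, zero_smul], HahnSeries.coeff_single_same]
  rfl

theorem tauW_eq_zero (hY : LowerTruncated Y) {v : V} {w : W} {N : ℤ}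
    (hN : ∀ n, N ≤ n → Y v n w = 0) {F : LaurentSeries ℂ} (hF : ∀ n < N, F.coeff n = 0) :
    tauW Y hY (v ⊗ₜ F) w = 0 := by
  rw [tauW_tmul]
  refine finsum_eq_zero_of_forall_eq_zero fun n => ?_
  rcases lt_or_ge n N with h | h
  · rw [hF n h, zero_smul]
  · rw [hN n h, smul_zero]

/-- A linear map on Laurent series that vanishes on monomials and on all series of large order
vanishes. -/
theorem laurent_hom_eq_zero {X : Type*} [AddCommGroup X] [Module ℂ X]
    (φ : LaurentSeries ℂ →ₗ[ℂ] X) (h1 : ∀ n, φ (HahnSeries.single n 1) = 0) {N : ℤ}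
    (h2 : ∀ F : LaurentSeries ℂ, (∀ n < N, F.coeff n = 0) → φ F = 0) : φ = 0 := by
  ext F
  -- Removing the finitely many terms of order below $N$ leaves a series of order at least $N$.
  have h := h2 (F - ∑ n ∈ Finset.Ico F.order N, F.coeff n • HahnSeries.single n 1) fun n hn => by
    rw [HahnSeries.coeff_sub, HahnSeries.coeff_sum]
    simp only [HahnSeries.coeff_smul, HahnSeries.coeff_single, smul_eq_mul, mul_ite, mul_one,
      mul_zero]
    rw [Finset.sum_ite_eq]
    split_ifs with h
    · exact sub_self _
    · rw [HahnSeries.coeff_eq_zero_of_lt_order (by simp at h; omega), sub_zero]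
  simpa [h1] using sub_eq_zero.1 ((map_sub φ _ _).symm.trans h)

end TauW

/-! ### The opposite-operator map on homogeneous vectors -/

namespace VertexAlgebra

variable {A V : Type*} [AddCommGroup A] [AddCommGroup V] [Module ℂ V] (𝒱 : VertexAlgebra A V)

theorem wt_induction {p : V → Prop}
    (mem : ∀ (h : ℤ), ∀ v ∈ 𝒱.L.zero.eigenspace (h : ℂ), p v) (add : ∀ v w, p v → p w → p (v + w))
    (v : V) : p v := by
  have hv : v ∈ ⨆ h : ℤ, 𝒱.L.zero.eigenspace (h : ℂ) := 𝒱.wt_grading.2 ▸ Submodule.mem_top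
  exact Submodule.iSup_induction _ (motive := p) hv mem (mem 0 0 (zero_mem _)) add

theorem opp_of_mem {h : ℤ} {v : V} (hv : v ∈ 𝒱.L.zero.eigenspace (h : ℂ)) :
    𝒱.opp v = 𝒱.oppHom h v := by
  have : (LinearEquiv.ofBijective
      (DirectSum.coeLinearMap fun h : ℤ => 𝒱.L.zero.eigenspace (h : ℂ))
      𝒱.wt_bijective).symm v =
        DirectSum.lof ℂ ℤ (fun h : ℤ => 𝒱.L.zero.eigenspace (h : ℂ)) h ⟨v, hv⟩ := by
    rw [LinearEquiv.symm_apply_eq]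
    simp
  rw [opp, LinearMap.comp_apply, LinearEquiv.coe_coe, this, DirectSum.toModule_lof]
  rfl

/-- `L(1)^p v / p!` -/
def divPow (p : ℕ) : Module.End ℂ V := (p.factorial : ℂ)⁻¹ • 𝒱.L.pos ^ p

theorem divPow_zero : 𝒱.divPow 0 = 1 := by simp [divPow]

theorem pos_divPow (p : ℕ) (v : V) :
    𝒱.L.pos (𝒱.divPow p v) = ((p : ℂ) + 1) • 𝒱.divPow (p + 1) v := by
  simp only [divPow, LinearMap.smul_apply, map_smul, smul_smul, pow_succ', Module.End.mul_apply]
  congr 1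
  have : (p : ℂ) + 1 ≠ 0 := by exact_mod_cast p.succ_ne_zero
  rw [Nat.factorial_succ]
  push_cast
  field_simp

theorem divPow_pos (p : ℕ) (v : V) :
    𝒱.divPow p (𝒱.L.pos v) = ((p : ℂ) + 1) • 𝒱.divPow (p + 1) v := by
  rw [← pos_divPow]
  simp only [divPow, LinearMap.smul_apply, map_smul]
  rw [← Module.End.mul_apply, ← Module.End.mul_apply, ← pow_succ, ← pow_succ']

theorem exists_divPow_eq_zero (v : V) : ∃ k : ℕ, ∀ m, k ≤ m → 𝒱.divPow m v = 0 := by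
  obtain ⟨k, hk⟩ := 𝒱.pos_locally_nilpotent v
  exact ⟨k, fun m hm => by rw [divPow, LinearMap.smul_apply, hk m hm, smul_zero]⟩

theorem zero_pos_apply {c : ℂ} {v : V} (hv : 𝒱.L.zero v = c • v) :
    𝒱.L.zero (𝒱.L.pos v) = (c - 1) • 𝒱.L.pos v := by
  have h := LinearMap.congr_fun 𝒱.sl2.zero_pos v
  rw [Ring.lie_def] at h
  simp only [LinearMap.sub_apply, Module.End.mul_apply, LinearMap.neg_apply, hv, map_smul] at h
  rw [sub_eq_iff_eq_add.1 h]
  module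

theorem zero_neg_apply {c : ℂ} {v : V} (hv : 𝒱.L.zero v = c • v) :
    𝒱.L.zero (𝒱.L.neg v) = (c + 1) • 𝒱.L.neg v := by
  have h := LinearMap.congr_fun 𝒱.sl2.zero_neg v
  rw [Ring.lie_def] at h
  simp only [LinearMap.sub_apply, Module.End.mul_apply, hv, map_smul] at h
  rw [sub_eq_iff_eq_add.1 h]
  module

theorem zero_divPow {c : ℂ} {v : V} (hv : 𝒱.L.zero v = c • v) (p : ℕ) :
    𝒱.L.zero (𝒱.divPow p v) = (c - p) • 𝒱.divPow p v := by
  have h : ∀ p : ℕ, 𝒱.L.zero ((𝒱.L.pos ^ p) v) = (c - p) • (𝒱.L.pos ^ p) v := by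
    intro p
    induction p with
    | zero => simpa using hv
    | succ p ih =>
      rw [pow_succ', Module.End.mul_apply, 𝒱.zero_pos_apply ih]
      push_cast
      module
  rw [divPow, LinearMap.smul_apply, map_smul, h, smul_comm]

/-- Any $K$ beyond the nilpotency order of $L(1)$ on $v$ is allowed, so that several vectors can
share one range of summation. -/
theorem oppMap_of_mem {h : ℤ} {v : V} (hv : v ∈ 𝒱.L.zero.eigenspace (h : ℂ)) {K : ℕ}
    (hK : ∀ m, K ≤ m → 𝒱.divPow m v = 0) (f : RatFunc ℂ) :
    𝒱.oppMap (v ⊗ₜ f) = ∑ p ∈ Finset.range K, ((-1 : ℂ) ^ h) •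
      (𝒱.divPow p v ⊗ₜ[ℂ] (RatFunc.X ^ (-(p : ℤ) - 2 + 2 * h) * ratInv f)) := by
  have h1 : 𝒱.opp v = ∑ p ∈ Finset.range K, ((-1 : ℂ) ^ h) •
      (𝒱.divPow p v ⊗ₜ[ℂ] (RatFunc.X ^ (-(p : ℤ) - 2 + 2 * h) : RatFunc ℂ)) := by
    rw [𝒱.opp_of_mem hv]
    change ∑ᶠ m : ℕ, (((-1 : ℂ) ^ h * (m.factorial : ℂ)⁻¹) •
      (TensorProduct.mk ℂ V (RatFunc ℂ)).flip (RatFunc.X ^ (-(m : ℤ) - 2 + 2 * h)))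
        ((𝒱.L.pos ^ m) v) = _
    have h2 : ∀ m : ℕ, (((-1 : ℂ) ^ h * (m.factorial : ℂ)⁻¹) •
      (TensorProduct.mk ℂ V (RatFunc ℂ)).flip (RatFunc.X ^ (-(m : ℤ) - 2 + 2 * h)))
        ((𝒱.L.pos ^ m) v) = ((-1 : ℂ) ^ h) •
      (𝒱.divPow m v ⊗ₜ[ℂ] (RatFunc.X ^ (-(m : ℤ) - 2 + 2 * h) : RatFunc ℂ)) := fun m => by
      simp [divPow, mul_smul, TensorProduct.smul_tmul']
    rw [finsum_congr h2]
    exact finsum_eq_sum_range fun i hi => by rw [hK i hi, TensorProduct.zero_tmul, smul_zero]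
  rw [oppMap, TensorProduct.lift.tmul, LinearMap.comp_apply, h1, LinearMap.flip_apply]
  simp [mul_comm]

end VertexAlgebra

/-! ### Opposite vertex operators on a module -/

section OppMode

variable {G : Type*} [AddCommGroup G] {A : AddSubgroup G} {V : Type*} [AddCommGroup V]
  [Module ℂ V] {𝒱 : VertexAlgebra A V} {W : Type*} [AddCommGroup W] [Module ℂ W]
  {W₁ : Type*} [AddCommGroup W₁] [Module ℂ W₁] {W₂ : Type*} [AddCommGroup W₂] [Module ℂ W₂]

/-- `τ_W ∘ ι₊ ∘ T_a ∘ o` -/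
def oppMode (M : GeneralizedModule 𝒱 W) (a : ℂ) : V ⊗[ℂ] RatFunc ℂ →ₗ[ℂ] Module.End ℂ W :=
  tauW M.Y M.truncation ∘ₗ LinearMap.lTensor V (expansionLin a) ∘ₗ 𝒱.oppMap

theorem oppMode_of_mem (M : GeneralizedModule 𝒱 W) (a : ℂ) {h : ℤ} {v : V}
    (hv : v ∈ 𝒱.L.zero.eigenspace (h : ℂ)) {K : ℕ}
    (hK : ∀ m, K ≤ m → 𝒱.divPow m v = 0) (f : RatFunc ℂ) :
    oppMode M a (v ⊗ₜ f) = ∑ p ∈ Finset.range K, ((-1 : ℂ) ^ h) •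
      tauW M.Y M.truncation (𝒱.divPow p v ⊗ₜ[ℂ]
        (expansion a (RatFunc.X ^ (-(p : ℤ) - 2 + 2 * h) * ratInv f))) := by
  rw [oppMode, LinearMap.comp_apply, LinearMap.comp_apply, 𝒱.oppMap_of_mem hv hK]
  simp only [map_sum, map_smul, LinearMap.lTensor_tmul, expansionLin_apply]

theorem tauP_eq (M₁ : GeneralizedModule 𝒱 W₁) (M₂ : GeneralizedModule 𝒱 W₂) (z : ℂ)
    (ξ : V ⊗[ℂ] RatFunc ℂ) : tauP M₁ M₂ z ξ =
      Module.Dual.transpose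
        ((oppMode M₁ z ξ).rTensor W₂ + (oppMode M₂ 0 ξ).lTensor W₁) := by
  have h1 : ∀ a, oppMode M₁ a ξ = tauW M₁.Y M₁.truncation (LinearMap.lTensor V iotaPlus
      (LinearMap.lTensor V (ratShift a).toLinearMap (𝒱.oppMap ξ))) := fun a => by
    rw [oppMode, LinearMap.comp_apply, LinearMap.comp_apply, expansionLin,
      LinearMap.lTensor_comp_apply]
  have h2 : oppMode M₂ 0 ξ = tauW M₂.Y M₂.truncation (LinearMap.lTensor V iotaPlus
      (𝒱.oppMap ξ)) := by
    have : expansionLin 0 = iotaPlus := by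
      ext f : 1
      simp [expansionLin, ratShift_zero]
    rw [oppMode, LinearMap.comp_apply, LinearMap.comp_apply, this]
  rw [h1, h2]
  rfl

theorem tauP_apply (M₁ : GeneralizedModule 𝒱 W₁) (M₂ : GeneralizedModule 𝒱 W₂) (z : ℂ)
    (ξ : V ⊗[ℂ] RatFunc ℂ) (lam : TDual W₁ W₂) (w₁ : W₁) (w₂ : W₂) :
    tauP M₁ M₂ z ξ lam (w₁ ⊗ₜ w₂) =
      lam (oppMode M₁ z ξ w₁ ⊗ₜ w₂) + lam (w₁ ⊗ₜ oppMode M₂ 0 ξ w₂) := by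
  rw [tauP_eq]
  simp [Module.Dual.transpose_apply]

theorem YP_apply (M₁ : GeneralizedModule 𝒱 W₁) (M₂ : GeneralizedModule 𝒱 W₂) (z : ℂ)
    (v : V) (n : ℤ) : YP M₁ M₂ z v n = tauP M₁ M₂ z (v ⊗ₜ[ℂ] (RatFunc.X ^ n : RatFunc ℂ)) := rfl

end OppMode

/-! ### The opposite-operator map and `sl(2)` -/

section TensorOp

variable {V : Type*} [AddCommGroup V] [Module ℂ V]

/-- The operator `v ⊗ f ↦ Bv ⊗ gf`. -/
def tensorOp (B : Module.End ℂ V) (g : RatFunc ℂ) : Module.End ℂ (V ⊗[ℂ] RatFunc ℂ) :=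
  TensorProduct.map B (LinearMap.mulLeft ℂ g)

@[simp] theorem tensorOp_tmul (B : Module.End ℂ V) (g : RatFunc ℂ) (v : V) (f : RatFunc ℂ) :
    tensorOp B g (v ⊗ₜ f) = B v ⊗ₜ (g * f) := rfl

theorem tensorOp_tensorOp (B C : Module.End ℂ V) (g g' : RatFunc ℂ) (ξ : V ⊗[ℂ] RatFunc ℂ) :
    tensorOp B g (tensorOp C g' ξ) = tensorOp (B * C) (g * g') ξ := by
  induction ξ using TensorProduct.induction_on with
  | zero => simp only [map_zero]
  | tmul v f => simp [mul_assoc]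
  | add ξ η h1 h2 => simp only [map_add, h1, h2]

end TensorOp

namespace VertexAlgebra

variable {A V : Type*} [AddCommGroup A] [AddCommGroup V] [Module ℂ V] (𝒱 : VertexAlgebra A V)

theorem pos_neg_apply (v : V) :
    𝒱.L.pos (𝒱.L.neg v) = 𝒱.L.neg (𝒱.L.pos v) + (2 : ℂ) • 𝒱.L.zero v := by
  have h := LinearMap.congr_fun 𝒱.sl2.neg_pos v
  rw [Ring.lie_def] at h
  simp only [LinearMap.sub_apply, Module.End.mul_apply, LinearMap.neg_apply,
    LinearMap.smul_apply] at h
  rw [← sub_eq_iff_eq_add', ← neg_sub, h, neg_neg]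

/-- Induction on $p$: apply $L(1)$ to both sides, use $[L(1),L(-1)]=2L(0)$, and cancel the nonzero
integer that the divided powers produce. -/
theorem divPow_succ_neg {c : ℂ} {v : V} (hv : 𝒱.L.zero v = c • v) (p : ℕ) :
    𝒱.divPow (p + 1) (𝒱.L.neg v) =
      𝒱.L.neg (𝒱.divPow (p + 1) v) + (2 * c - p) • 𝒱.divPow p v := by
  induction p with
  | zero =>
    have h := 𝒱.pos_divPow 0 (𝒱.L.neg v)
    have h' := 𝒱.pos_divPow 0 v
    simp only [divPow_zero, Module.End.one_apply, Nat.cast_zero, zero_add, one_smul] at h h' ⊢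
    rw [← h, ← h', 𝒱.pos_neg_apply, hv, smul_smul, sub_zero]
  | succ p ih =>
    have hp : ((p + 1 : ℕ) : ℂ) + 1 ≠ 0 := by exact_mod_cast (p + 1).succ_ne_zero
    refine smul_right_injective V hp ?_
    change (((p + 1 : ℕ) : ℂ) + 1) • _ = (((p + 1 : ℕ) : ℂ) + 1) • _
    rw [← 𝒱.pos_divPow, ih, map_add, 𝒱.pos_neg_apply, 𝒱.pos_divPow, 𝒱.zero_divPow hv, map_smul,
      map_smul, 𝒱.pos_divPow]
    push_cast
    module

/-- The two boundary terms vanish, at $p=0$ because of the coefficient and at $p=K$ by assumption.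
-/
theorem sum_range_shift {X : Type*} [AddCommGroup X] [Module ℂ X] (T : ℕ → X) {K : ℕ}
    (hT : T K = 0) : ∑ p ∈ Finset.range K, ((p : ℂ) + 1) • T (p + 1) =
      ∑ p ∈ Finset.range K, (p : ℂ) • T p := by
  have h1 := Finset.sum_range_succ (fun p : ℕ => (p : ℂ) • T p) K
  rw [Finset.sum_range_succ'] at h1
  simpa [hT] using h1

/-- The $p$-th term of $v^o$ has weight $h-p$, and $h=(h-p)+p$. The part with $p$ is $L(1)$ applied
to the preceding term, corrected by $t^{-1}$. -/
theorem oppMap_zero_tmul (v : V) (f : RatFunc ℂ) : 𝒱.oppMap (𝒱.L.zero v ⊗ₜ f) =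
    tensorOp 𝒱.L.zero 1 (𝒱.oppMap (v ⊗ₜ f)) +
      tensorOp 𝒱.L.pos RatFunc.X⁻¹ (𝒱.oppMap (v ⊗ₜ f)) := by
  induction v using 𝒱.wt_induction with
  | add v w h1 h2 => simp only [map_add, TensorProduct.add_tmul, h1, h2]; abel
  | mem h v hv =>
    have hv' := Module.End.mem_eigenspace_iff.1 hv
    obtain ⟨K, hK⟩ := 𝒱.exists_divPow_eq_zero v
    have hX := RatFunc.X_ne_zero (K := ℂ)
    have hs := sum_range_shift (fun p : ℕ => 𝒱.divPow p v ⊗ₜ[ℂ]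
      (RatFunc.X ^ (-(p : ℤ) - 2 + 2 * h) * ratInv f)) (K := K)
      (by simp only [hK K le_rfl, TensorProduct.zero_tmul])
    rw [hv', ← TensorProduct.smul_tmul', map_smul, 𝒱.oppMap_of_mem hv hK, ← Finset.smul_sum]
    simp only [map_smul, map_sum, tensorOp_tmul, 𝒱.zero_divPow hv', 𝒱.pos_divPow, one_mul]
    rw [smul_comm, ← smul_add]
    congr 1
    have h2 : ∀ p : ℕ, (((p : ℂ) + 1) • 𝒱.divPow (p + 1) v) ⊗ₜ[ℂ]
        (RatFunc.X⁻¹ * (RatFunc.X ^ (-(p : ℤ) - 2 + 2 * h) * ratInv f)) =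
        ((p : ℂ) + 1) • (𝒱.divPow (p + 1) v ⊗ₜ[ℂ]
        (RatFunc.X ^ (-((p + 1 : ℕ) : ℤ) - 2 + 2 * h) * ratInv f)) := fun p => by
      rw [← TensorProduct.smul_tmul', ← mul_assoc, ← zpow_neg_one, ← zpow_add₀ hX]
      congr 4
      push_cast
      ring
    rw [Finset.sum_congr rfl fun p _ => h2 p, hs, Finset.smul_sum, ← Finset.sum_add_distrib]
    refine Finset.sum_congr rfl fun p _ => ?_
    rw [← TensorProduct.smul_tmul']
    module

/-- $L(1)$ commutes with its divided powers and lowers the weight by one; the weight accounts for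
the sign $(-1)^{h-1}$ and the factor $t^{-2}$. -/
theorem oppMap_pos_tmul (v : V) (f : RatFunc ℂ) : 𝒱.oppMap (𝒱.L.pos v ⊗ₜ f) =
    -tensorOp 𝒱.L.pos (RatFunc.X ^ (-2 : ℤ)) (𝒱.oppMap (v ⊗ₜ f)) := by
  induction v using 𝒱.wt_induction with
  | add v w h1 h2 => simp only [map_add, TensorProduct.add_tmul, h1, h2]; abel
  | mem h v hv =>
    have hv' := Module.End.mem_eigenspace_iff.1 hv
    have hv2 : 𝒱.L.pos v ∈ 𝒱.L.zero.eigenspace ((h - 1 : ℤ) : ℂ) := by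
      rw [Module.End.mem_eigenspace_iff, 𝒱.zero_pos_apply hv']
      push_cast
      rfl
    obtain ⟨K, hK⟩ := 𝒱.exists_divPow_eq_zero v
    have hX := RatFunc.X_ne_zero (K := ℂ)
    have hK' : ∀ m, K ≤ m → 𝒱.divPow m (𝒱.L.pos v) = 0 := fun m hm => by
      rw [𝒱.divPow_pos, hK _ (by omega), smul_zero]
    rw [𝒱.oppMap_of_mem hv hK, 𝒱.oppMap_of_mem hv2 hK', map_sum, ← Finset.sum_neg_distrib]
    refine Finset.sum_congr rfl fun p _ => ?_
    rw [map_smul, tensorOp_tmul, 𝒱.pos_divPow, 𝒱.divPow_pos, ← mul_assoc, ← zpow_add₀ hX,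
      zpow_sub_one₀ (by norm_num : (-1 : ℂ) ≠ 0), ← neg_smul]
    congr 1
    · norm_num
    · congr 3
      ring

/-- Expand the left side by `divPow_succ_neg`. The terms without $L(-1)$ have coefficient
$2h-p=p+2(h-p)$, where $p$ comes from the $L(1)$-term and $2(h-p)$ from the $L(0)$-term. -/
theorem oppMap_neg_tmul (v : V) (f : RatFunc ℂ) : 𝒱.oppMap (𝒱.L.neg v ⊗ₜ f) =
    -(tensorOp 𝒱.L.pos 1 (𝒱.oppMap (v ⊗ₜ f)) +
      (2 : ℂ) • tensorOp 𝒱.L.zero RatFunc.X (𝒱.oppMap (v ⊗ₜ f)) +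
      tensorOp 𝒱.L.neg (RatFunc.X ^ 2) (𝒱.oppMap (v ⊗ₜ f))) := by
  induction v using 𝒱.wt_induction with
  | add v w h1 h2 => simp only [map_add, TensorProduct.add_tmul, h1, h2, smul_add]; abel
  | mem h v hv =>
    have hv' := Module.End.mem_eigenspace_iff.1 hv
    have hv2 : 𝒱.L.neg v ∈ 𝒱.L.zero.eigenspace ((h + 1 : ℤ) : ℂ) := by
      rw [Module.End.mem_eigenspace_iff, 𝒱.zero_neg_apply hv']
      push_cast
      rfl
    obtain ⟨K, hK⟩ := 𝒱.exists_divPow_eq_zero v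
    have hX := RatFunc.X_ne_zero (K := ℂ)
    -- One more power of $L(1)$ may be needed to kill $L(-1)v$ than to kill $v$.
    have hK' : ∀ m, K + 1 ≤ m → 𝒱.divPow m (𝒱.L.neg v) = 0 := fun m hm => by
      obtain ⟨m, rfl⟩ := Nat.exists_eq_add_of_le' (Nat.le_of_add_left_le hm)
      rw [𝒱.divPow_succ_neg hv', hK _ (by omega), hK _ (by omega), map_zero, smul_zero, add_zero]
    obtain ⟨g, hg⟩ : ∃ g, ratInv f = g := ⟨_, rfl⟩
    let S : ℕ → V ⊗[ℂ] RatFunc ℂ := fun p =>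
      𝒱.divPow p v ⊗ₜ[ℂ] (RatFunc.X ^ (-(p : ℤ) - 1 + 2 * h) * g)
    let N : ℕ → V ⊗[ℂ] RatFunc ℂ := fun p =>
      𝒱.L.neg (𝒱.divPow p v) ⊗ₜ[ℂ] (RatFunc.X ^ (-(p : ℤ) + 2 * h) * g)
    have hs := sum_range_shift S (K := K) (by simp only [S, hK K le_rfl, TensorProduct.zero_tmul])
    have hN : N K = 0 := by simp only [N, hK K le_rfl, map_zero, TensorProduct.zero_tmul]
    have hl : 𝒱.oppMap (𝒱.L.neg v ⊗ₜ f) = -((-1 : ℂ) ^ h • (∑ p ∈ Finset.range K, N p +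
        ∑ p ∈ Finset.range K, (2 * (h : ℂ) - p) • S p)) := by
      rw [𝒱.oppMap_of_mem hv2 hK', hg, ← Finset.smul_sum, zpow_add_one₀ (by norm_num), mul_neg_one,
        neg_smul]
      congr 2
      have hsum : ∑ p ∈ Finset.range K, N p = ∑ p ∈ Finset.range (K + 1), N p := by
        rw [Finset.sum_range_succ, hN, add_zero]
      rw [hsum, Finset.sum_range_succ', Finset.sum_range_succ', add_right_comm,
        ← Finset.sum_add_distrib]
      congr 1
      · refine Finset.sum_congr rfl fun p _ => ?_
        have e1 : -((p + 1 : ℕ) : ℤ) - 2 + 2 * (h + 1) = -(p : ℤ) - 1 + 2 * h := by push_cast; ring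
        have e2 : -((p + 1 : ℕ) : ℤ) + 2 * h = -(p : ℤ) - 1 + 2 * h := by push_cast; ring
        rw [𝒱.divPow_succ_neg hv', TensorProduct.add_tmul, ← TensorProduct.smul_tmul']
        simp only [N, S, e1, e2]
      · simp only [N, divPow_zero, Module.End.one_apply]
        congr 3
        push_cast
        ring
    rw [hl, 𝒱.oppMap_of_mem hv hK, ← Finset.smul_sum]
    simp only [map_smul, map_sum, tensorOp_tmul, hg]
    rw [smul_comm (2 : ℂ), ← smul_add, ← smul_add]
    congr 2
    have e1 : ∀ p : ℕ, 𝒱.L.pos (𝒱.divPow p v) ⊗ₜ[ℂ]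
        (1 * (RatFunc.X ^ (-(p : ℤ) - 2 + 2 * h) * g)) = ((p : ℂ) + 1) • S (p + 1) := fun p => by
      rw [𝒱.pos_divPow, one_mul, ← TensorProduct.smul_tmul']
      congr 4
      push_cast
      ring
    have e2 : ∀ p : ℕ, 𝒱.L.zero (𝒱.divPow p v) ⊗ₜ[ℂ]
        (RatFunc.X * (RatFunc.X ^ (-(p : ℤ) - 2 + 2 * h) * g)) = ((h : ℂ) - p) • S p := fun p => by
      rw [𝒱.zero_divPow hv', ← TensorProduct.smul_tmul', ← mul_assoc, ← zpow_one_add₀ hX]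
      congr 4
      ring
    have e3 : ∀ p : ℕ, 𝒱.L.neg (𝒱.divPow p v) ⊗ₜ[ℂ]
        (RatFunc.X ^ 2 * (RatFunc.X ^ (-(p : ℤ) - 2 + 2 * h) * g)) = N p := fun p => by
      rw [← mul_assoc, ← zpow_natCast, ← zpow_add₀ hX]
      simp only [N]
      congr 3
      push_cast
      ring
    simp only [e1, e2, e3]
    rw [hs, Finset.smul_sum, ← Finset.sum_add_distrib, ← Finset.sum_add_distrib,
      ← Finset.sum_add_distrib]
    refine Finset.sum_congr rfl fun p _ => ?_
    module

theorem oppMap_mul (v : V) (g f : RatFunc ℂ) :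
    𝒱.oppMap (v ⊗ₜ (g * f)) = tensorOp 1 (ratInv g) (𝒱.oppMap (v ⊗ₜ f)) := by
  induction v using 𝒱.wt_induction with
  | add v w h1 h2 => simp only [map_add, TensorProduct.add_tmul, h1, h2]
  | mem h v hv =>
    obtain ⟨K, hK⟩ := 𝒱.exists_divPow_eq_zero v
    rw [𝒱.oppMap_of_mem hv hK, 𝒱.oppMap_of_mem hv hK, map_sum]
    refine Finset.sum_congr rfl fun p _ => ?_
    rw [map_smul, tensorOp_tmul, map_mul, mul_left_comm]
    rfl

/-- The left side has the shape of the formula for $[L(0),Y(v,x)]$. The $L(1)$-contributions cancel.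
-/
theorem oppMap_zero_add_neg (v : V) (f : RatFunc ℂ) :
    𝒱.oppMap (𝒱.L.zero v ⊗ₜ f) + 𝒱.oppMap (𝒱.L.neg v ⊗ₜ (RatFunc.X * f)) =
      -(tensorOp 𝒱.L.zero 1 (𝒱.oppMap (v ⊗ₜ f)) +
        tensorOp 𝒱.L.neg RatFunc.X (𝒱.oppMap (v ⊗ₜ f))) := by
  have hX := RatFunc.X_ne_zero (K := ℂ)
  rw [oppMap_mul, oppMap_zero_tmul, oppMap_neg_tmul, ratInv_X]
  simp only [map_neg, map_add, map_smul, tensorOp_tensorOp, one_mul, mul_one,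
    inv_mul_cancel₀ hX, show (RatFunc.X⁻¹ * RatFunc.X ^ 2 : RatFunc ℂ) = RatFunc.X by field_simp]
  module

/-- The left side has the shape of the formula for $[L(1),Y(v,x)]$. The contributions of $L(1)$ and
of $L(0)$ cancel. -/
theorem oppMap_pos_add (v : V) (f : RatFunc ℂ) :
    𝒱.oppMap (𝒱.L.pos v ⊗ₜ f) + (2 : ℂ) • 𝒱.oppMap (𝒱.L.zero v ⊗ₜ (RatFunc.X * f)) +
      𝒱.oppMap (𝒱.L.neg v ⊗ₜ (RatFunc.X ^ 2 * f)) =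
      -tensorOp 𝒱.L.neg 1 (𝒱.oppMap (v ⊗ₜ f)) := by
  have hX := RatFunc.X_ne_zero (K := ℂ)
  rw [oppMap_mul, oppMap_mul, oppMap_zero_tmul, oppMap_neg_tmul, oppMap_pos_tmul, map_pow,
    ratInv_X]
  simp only [map_neg, map_add, map_smul, tensorOp_tensorOp, one_mul, mul_one]
  rw [show (RatFunc.X⁻¹ ^ 2 : RatFunc ℂ) = RatFunc.X ^ (-2 : ℤ) by
      rw [inv_pow, zpow_neg]; rfl,
    show (RatFunc.X⁻¹ * RatFunc.X⁻¹ : RatFunc ℂ) = RatFunc.X ^ (-2 : ℤ) by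
      rw [zpow_neg, ← mul_inv, ← sq]; rfl,
    show (RatFunc.X ^ (-2 : ℤ) * RatFunc.X : RatFunc ℂ) = RatFunc.X⁻¹ by
      rw [← zpow_add_one₀ hX]; norm_num,
    show (RatFunc.X ^ (-2 : ℤ) * RatFunc.X ^ 2 : RatFunc ℂ) = 1 by
      rw [← zpow_natCast, ← zpow_add₀ hX]; norm_num]
  module

end VertexAlgebra

/-! ### Commutators with `L(-1), L(0), L(1)` -/

section Commutator

variable {R : Type*} [Ring R] (a b c : R)

theorem commutator_add : ⁅a, b + c⁆ = ⁅a, b⁆ + ⁅a, c⁆ := by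
  simp only [Ring.lie_def]; noncomm_ring

theorem add_commutator : ⁅a + b, c⁆ = ⁅a, c⁆ + ⁅b, c⁆ := by
  simp only [Ring.lie_def]; noncomm_ring

theorem smul_commutator [Algebra ℂ R] (s : ℂ) (a b : R) : ⁅s • a, b⁆ = s • ⁅a, b⁆ := by
  simp only [Ring.lie_def, smul_mul_assoc, mul_smul_comm, smul_sub]

theorem commutator_smul [Algebra ℂ R] (s : ℂ) (a b : R) : ⁅a, s • b⁆ = s • ⁅a, b⁆ := by
  simp only [Ring.lie_def, smul_mul_assoc, mul_smul_comm, smul_sub]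

theorem commutator_self : ⁅a, a⁆ = 0 := by
  simp only [Ring.lie_def, sub_self]

theorem commutator_zero : ⁅a, (0 : R)⁆ = 0 := by
  simp only [Ring.lie_def, mul_zero, zero_mul, sub_self]

theorem commutator_skew : -⁅b, a⁆ = ⁅a, b⁆ := by
  simp only [Ring.lie_def, neg_sub]

end Commutator

/-! ### Brackets with the action of Laurent series on a module. -/

section TauW

variable {V W : Type*} [AddCommGroup V] [Module ℂ V] [AddCommGroup W] [Module ℂ W]
  {Y : Modes V W}

/-- The series of order at least `N` are killed by `F ↦ τ_W(v ⊗ F)w` for large `N`. -/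
theorem exists_tauW_eq_zero (hY : LowerTruncated Y) (v : V) (w : W) :
    ∃ N : ℤ, ∀ F : LaurentSeries ℂ, (∀ n < N, F.coeff n = 0) → tauW Y hY (v ⊗ₜ F) w = 0 := by
  obtain ⟨N, hN⟩ := hY v w
  exact ⟨N, fun F hF => tauW_eq_zero hY hN hF⟩

/-- `F ↦ τ_W(v ⊗ F)` -/
def tauWHom (hY : LowerTruncated Y) (v : V) : LaurentSeries ℂ →ₗ[ℂ] Module.End ℂ W :=
  tauW Y hY ∘ₗ TensorProduct.mk ℂ V (LaurentSeries ℂ) v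

theorem tauWHom_apply (hY : LowerTruncated Y) (v : V) (F : LaurentSeries ℂ) :
    tauWHom hY v F = tauW Y hY (v ⊗ₜ F) := rfl

/-- Multiplication by `t` on Laurent series. -/
def mulT : LaurentSeries ℂ →ₗ[ℂ] LaurentSeries ℂ :=
  { toFun := fun F => HahnSeries.single 1 1 * F
    map_add' := mul_add _
    map_smul' := fun c F => by
      rw [RingHom.id_apply, ← HahnSeries.C_mul_eq_smul, ← HahnSeries.C_mul_eq_smul,
        mul_left_comm] }

theorem mulT_apply (F : LaurentSeries ℂ) : mulT F = HahnSeries.single 1 1 * F := rfl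

theorem mulT_single (n : ℤ) : mulT (HahnSeries.single n 1) = HahnSeries.single (n + 1) 1 := by
  rw [mulT_apply, HahnSeries.single_mul_single, add_comm, one_mul]

theorem mulT_coeff {F : LaurentSeries ℂ} {N : ℤ} (hF : ∀ n < N, F.coeff n = 0) :
    ∀ n < N, (mulT F).coeff n = 0 := by
  intro n hn
  rw [mulT_apply]
  refine coeff_mul_eq_zero_of_lt (a := 1) (b := N) (fun m hm => ?_) hF n (by omega)
  exact HahnSeries.coeff_single_of_ne hm.ne

/-- Both sides are linear in $F$ and agree on monomials by assumption. Applied to a fixed $w$ they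
vanish on series of large order, by lower truncation at $w$ and at $Bw$, so `laurent_hom_eq_zero`
applies. -/
theorem lie_tauW_of_modes (hY : LowerTruncated Y) (B : Module.End ℂ W) (v a b c : V)
    (h : ∀ n, ⁅B, Y v n⁆ = Y a n + Y b (n + 1) + Y c (n + 2)) (F : LaurentSeries ℂ) :
    ⁅B, tauW Y hY (v ⊗ₜ F)⁆ = tauW Y hY (a ⊗ₜ F) + tauW Y hY (b ⊗ₜ mulT F) +
      tauW Y hY (c ⊗ₜ mulT (mulT F)) := by
  ext w
  let ev : Module.End ℂ W →ₗ[ℂ] W := LinearMap.applyₗ w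
  have hφ := laurent_hom_eq_zero
    (B ∘ₗ ev ∘ₗ tauWHom hY v - LinearMap.applyₗ (B w) ∘ₗ tauWHom hY v -
      (ev ∘ₗ tauWHom hY a + ev ∘ₗ tauWHom hY b ∘ₗ mulT + ev ∘ₗ tauWHom hY c ∘ₗ mulT ∘ₗ mulT))
  obtain ⟨N₁, h₁⟩ := exists_tauW_eq_zero hY v w
  obtain ⟨N₂, h₂⟩ := exists_tauW_eq_zero hY v (B w)
  obtain ⟨N₃, h₃⟩ := exists_tauW_eq_zero hY a w
  obtain ⟨N₄, h₄⟩ := exists_tauW_eq_zero hY b w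
  obtain ⟨N₅, h₅⟩ := exists_tauW_eq_zero hY c w
  have hφ := hφ (N := max N₁ (max N₂ (max N₃ (max N₄ N₅)))) (fun n => ?_) (fun F hF => ?_)
  · have := LinearMap.congr_fun hφ F
    simp only [LinearMap.sub_apply, LinearMap.add_apply, LinearMap.comp_apply, tauWHom_apply,
      LinearMap.applyₗ_apply_apply, ev, LinearMap.zero_apply, sub_eq_zero] at this
    simpa [Ring.lie_def] using this
  · have := LinearMap.congr_fun (h n) w
    simp only [Ring.lie_def, LinearMap.sub_apply, LinearMap.add_apply, Module.End.mul_apply] at this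
    simp only [LinearMap.sub_apply, LinearMap.add_apply, LinearMap.comp_apply, tauWHom_apply,
      LinearMap.applyₗ_apply_apply, ev, mulT_single, tauW_single, one_smul, this, add_assoc]
    norm_num
  · simp only [lt_max_iff] at hF
    simp only [LinearMap.sub_apply, LinearMap.add_apply, LinearMap.comp_apply, tauWHom_apply,
      LinearMap.applyₗ_apply_apply, ev]
    rw [h₁ _ fun n hn => hF n (by tauto), h₂ _ fun n hn => hF n (by tauto),
      h₃ _ fun n hn => hF n (by tauto),
      h₄ _ (mulT_coeff fun n hn => hF n (by tauto)),
      h₅ _ (mulT_coeff (mulT_coeff fun n hn => hF n (by tauto)))]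
    simp

end TauW

/-! ### Brackets with opposite operators, and their transposes on the dual space. -/

section OppMode

variable {G : Type*} [AddCommGroup G] {A : AddSubgroup G} {V : Type*} [AddCommGroup V]
  [Module ℂ V] {𝒱 : VertexAlgebra A V} {W : Type*} [AddCommGroup W] [Module ℂ W]
  {W₁ : Type*} [AddCommGroup W₁] [Module ℂ W₁] {W₂ : Type*} [AddCommGroup W₂] [Module ℂ W₂]

/-- `τ_W ∘ ι₊ ∘ T_a` -/
def tauAt (M : GeneralizedModule 𝒱 W) (a : ℂ) : V ⊗[ℂ] RatFunc ℂ →ₗ[ℂ] Module.End ℂ W :=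
  tauW M.Y M.truncation ∘ₗ LinearMap.lTensor V (expansionLin a)

theorem tauAt_tmul (M : GeneralizedModule 𝒱 W) (a : ℂ) (v : V) (f : RatFunc ℂ) :
    tauAt M a (v ⊗ₜ f) = tauW M.Y M.truncation (v ⊗ₜ expansion a f) := rfl

theorem oppMode_apply (M : GeneralizedModule 𝒱 W) (a : ℂ) (ξ : V ⊗[ℂ] RatFunc ℂ) :
    oppMode M a ξ = tauAt M a (𝒱.oppMap ξ) := rfl

/-- The expansion of $t$ about $a$ is $t+a$. The constant $a$ is what turns $L(0)$ into
$L(0)+aL(-1)$ and $L(1)$ into $L(1)+2aL(0)+a^2L(-1)$ below. -/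
theorem tauAt_tensorOp_X (M : GeneralizedModule 𝒱 W) (a : ℂ) (v : V) (f : RatFunc ℂ) :
    tauAt M a (v ⊗ₜ (RatFunc.X * f)) =
      tauW M.Y M.truncation (v ⊗ₜ mulT (expansion a f)) + a • tauAt M a (v ⊗ₜ f) := by
  rw [tauAt_tmul, map_mul, expansion_X, add_mul, TensorProduct.tmul_add, map_add, tauAt_tmul,
    HahnSeries.C_mul_eq_smul, TensorProduct.tmul_smul, map_smul]
  rfl

variable {M : GeneralizedModule 𝒱 W}

theorem lie_neg_tauAt (hM : M.IsMobius) (a : ℂ) (ξ : V ⊗[ℂ] RatFunc ℂ) :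
    ⁅M.L.neg, tauAt M a ξ⁆ = tauAt M a (tensorOp 𝒱.L.neg 1 ξ) := by
  induction ξ using TensorProduct.induction_on with
  | zero => simp [commutator_zero]
  | add ξ η h1 h2 => simp only [map_add, commutator_add, h1, h2]
  | tmul v f =>
    rw [tauAt_tmul, lie_tauW_of_modes _ _ v (𝒱.L.neg v) 0 0 fun n => by
      rw [hM.neg]; simp]
    simp [tauAt_tmul]

theorem lie_zero_tauAt (hM : M.IsMobius) (a : ℂ) (ξ : V ⊗[ℂ] RatFunc ℂ) :
    ⁅M.L.zero + a • M.L.neg, tauAt M a ξ⁆ =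
      tauAt M a (tensorOp 𝒱.L.zero 1 ξ + tensorOp 𝒱.L.neg RatFunc.X ξ) := by
  rw [add_commutator, smul_commutator, lie_neg_tauAt hM]
  induction ξ using TensorProduct.induction_on with
  | zero => simp [commutator_zero]
  | add ξ η h1 h2 =>
    simp only [map_add, commutator_add, smul_add] at h1 h2 ⊢
    rw [add_add_add_comm, h1, h2]
    abel
  | tmul v f =>
    rw [tauAt_tmul, lie_tauW_of_modes _ _ v (𝒱.L.zero v) (𝒱.L.neg v) 0 fun n => by
      rw [hM.zero]; simp]
    simp only [tensorOp_tmul, map_add, one_mul, TensorProduct.zero_tmul, map_zero]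
    rw [tauAt_tensorOp_X]
    simp only [tauAt_tmul]
    abel

theorem lie_pos_tauAt (hM : M.IsMobius) (a : ℂ) (ξ : V ⊗[ℂ] RatFunc ℂ) :
    ⁅M.L.pos + (2 * a) • M.L.zero + a ^ 2 • M.L.neg, tauAt M a ξ⁆ =
      tauAt M a (tensorOp 𝒱.L.pos 1 ξ + (2 : ℂ) • tensorOp 𝒱.L.zero RatFunc.X ξ +
        tensorOp 𝒱.L.neg (RatFunc.X ^ 2) ξ) := by
  -- Regrouping around $L(0)+aL(-1)$ reuses the two preceding brackets.
  have h0 : M.L.pos + (2 * a) • M.L.zero + a ^ 2 • M.L.neg =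
      M.L.pos + (2 * a) • (M.L.zero + a • M.L.neg) - a ^ 2 • M.L.neg := by module
  rw [h0, sub_eq_add_neg, ← neg_smul, add_commutator, add_commutator, smul_commutator,
    smul_commutator, lie_zero_tauAt hM, lie_neg_tauAt hM]
  induction ξ using TensorProduct.induction_on with
  | zero => simp [commutator_zero]
  | add ξ η h1 h2 =>
    simp only [map_add, commutator_add, smul_add] at h1 h2 ⊢
    rw [← sub_eq_zero] at h1 h2 ⊢
    rw [← add_zero (0 : Module.End ℂ W)]
    nth_rw 1 [← h1]
    rw [← h2]
    module
  | tmul v f =>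
    rw [tauAt_tmul, lie_tauW_of_modes _ _ v (𝒱.L.pos v) ((2 : ℂ) • 𝒱.L.zero v) (𝒱.L.neg v)
      fun n => by rw [hM.pos]; simp]
    simp only [tensorOp_tmul, map_add, one_mul, map_smul, sq, mul_assoc]
    rw [tauAt_tensorOp_X, tauAt_tensorOp_X, tauAt_tensorOp_X]
    simp only [map_mul, expansion_X, add_mul, map_add, HahnSeries.C_mul_eq_smul, map_smul,
      TensorProduct.tmul_add, TensorProduct.tmul_smul, tauAt_tmul, mulT_apply, ← mul_assoc,
      ← TensorProduct.smul_tmul']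
    module

theorem lie_neg_oppMode (hM : M.IsMobius) (a : ℂ) (v : V) (f : RatFunc ℂ) :
    ⁅M.L.neg, oppMode M a (v ⊗ₜ f)⁆ =
      -(oppMode M a (𝒱.L.pos v ⊗ₜ f) + (2 : ℂ) • oppMode M a (𝒱.L.zero v ⊗ₜ (RatFunc.X * f)) +
        oppMode M a (𝒱.L.neg v ⊗ₜ (RatFunc.X ^ 2 * f))) := by
  simp only [oppMode_apply]
  rw [lie_neg_tauAt hM, ← map_smul, ← map_add, ← map_add, 𝒱.oppMap_pos_add, map_neg, neg_neg]

theorem lie_zero_oppMode (hM : M.IsMobius) (a : ℂ) (v : V) (f : RatFunc ℂ) :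
    ⁅M.L.zero + a • M.L.neg, oppMode M a (v ⊗ₜ f)⁆ =
      -(oppMode M a (𝒱.L.zero v ⊗ₜ f) + oppMode M a (𝒱.L.neg v ⊗ₜ (RatFunc.X * f))) := by
  simp only [oppMode_apply]
  rw [lie_zero_tauAt hM, ← map_add, 𝒱.oppMap_zero_add_neg, map_neg, neg_neg]

theorem lie_pos_oppMode (hM : M.IsMobius) (a : ℂ) (v : V) (f : RatFunc ℂ) :
    ⁅M.L.pos + (2 * a) • M.L.zero + a ^ 2 • M.L.neg, oppMode M a (v ⊗ₜ f)⁆ =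
      -oppMode M a (𝒱.L.neg v ⊗ₜ f) := by
  simp only [oppMode_apply]
  rw [lie_pos_tauAt hM, 𝒱.oppMap_neg_tmul, map_neg, neg_neg]

/-- The transpose of `B ⊗ 1 + 1 ⊗ C`. -/
def dualSum (B : Module.End ℂ W₁) (C : Module.End ℂ W₂) : Module.End ℂ (TDual W₁ W₂) :=
  (C.lTensor W₁ + B.rTensor W₂).dualMap

theorem dualSum_apply (B : Module.End ℂ W₁) (C : Module.End ℂ W₂) (lam : TDual W₁ W₂)
    (w₁ : W₁) (w₂ : W₂) :
    dualSum B C lam (w₁ ⊗ₜ w₂) = lam (B w₁ ⊗ₜ w₂) + lam (w₁ ⊗ₜ C w₂) := by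
  simp [dualSum, add_comm]

/-- Transposition reverses products, hence the signs. The mixed terms cancel because operators on
different tensor factors commute. -/
theorem lie_dualSum (B B' : Module.End ℂ W₁) (C C' : Module.End ℂ W₂) :
    ⁅dualSum B C, dualSum B' C'⁆ = dualSum (-⁅B, B'⁆) (-⁅C, C'⁆) := by
  ext lam w₁ w₂
  simp only [Ring.lie_def, TensorProduct.AlgebraTensorModule.curry_apply, TensorProduct.curry_apply,
    LinearMap.sub_apply, Module.End.mul_apply, dualSum_apply, LinearMap.restrictScalars_self,
    LinearMap.neg_apply, TensorProduct.neg_tmul, TensorProduct.tmul_neg, map_neg,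
    TensorProduct.sub_tmul, TensorProduct.tmul_sub, map_sub]
  ring

theorem dualSum_add (B B' : Module.End ℂ W₁) (C C' : Module.End ℂ W₂) :
    dualSum (B + B') (C + C') = dualSum B C + dualSum B' C' := by
  ext lam w₁ w₂
  simp only [TensorProduct.AlgebraTensorModule.curry_apply, TensorProduct.curry_apply,
    LinearMap.add_apply, dualSum_apply, LinearMap.restrictScalars_self,
    TensorProduct.add_tmul, TensorProduct.tmul_add, map_add]
  ring

theorem dualSum_smul (c : ℂ) (B : Module.End ℂ W₁) (C : Module.End ℂ W₂) :
    dualSum (c • B) (c • C) = c • dualSum B C := by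
  ext lam w₁ w₂
  simp [TensorProduct.AlgebraTensorModule.curry_apply, TensorProduct.curry_apply,
    dualSum_apply, ← TensorProduct.smul_tmul', mul_add]

theorem dualSum_zero : dualSum (0 : Module.End ℂ W₁) (0 : Module.End ℂ W₂) = 0 := by
  ext lam w₁ w₂
  simp [TensorProduct.AlgebraTensorModule.curry_apply, TensorProduct.curry_apply,
    dualSum_apply]

theorem dualSum_neg (B : Module.End ℂ W₁) (C : Module.End ℂ W₂) :
    dualSum (-B) (-C) = -dualSum B C := by
  ext lam w₁ w₂
  simp only [TensorProduct.AlgebraTensorModule.curry_apply, TensorProduct.curry_apply,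
    LinearMap.neg_apply, dualSum_apply, LinearMap.restrictScalars_self,
    TensorProduct.neg_tmul, TensorProduct.tmul_neg, map_neg, neg_add]

theorem tauP_eq_dualSum (M₁ : GeneralizedModule 𝒱 W₁) (M₂ : GeneralizedModule 𝒱 W₂) (z : ℂ)
    (ξ : V ⊗[ℂ] RatFunc ℂ) :
    tauP M₁ M₂ z ξ = dualSum (oppMode M₁ z ξ) (oppMode M₂ 0 ξ) := by
  rw [tauP_eq, dualSum, add_comm]
  rfl

/-! ### The $\mathfrak{sl}(2)$-action on the dual space and its brackets with $\tau_{P(z)}$. -/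

section LP

variable (M₁ : GeneralizedModule 𝒱 W₁) (M₂ : GeneralizedModule 𝒱 W₂) (z : ℂ)

/-- The vanishing terms on $W_2$ are kept so that both factors have the same form, with $a=z$ and
$a=0$. -/
theorem LP_neg : (LP M₁ M₂ z).neg = dualSum (M₁.L.pos + (2 * z) • M₁.L.zero + z ^ 2 • M₁.L.neg)
    (M₂.L.pos + (2 * 0 : ℂ) • M₂.L.zero + (0 : ℂ) ^ 2 • M₂.L.neg) := by
  simp [LP, dualSum]

theorem LP_zero : (LP M₁ M₂ z).zero = dualSum (M₁.L.zero + z • M₁.L.neg)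
    (M₂.L.zero + (0 : ℂ) • M₂.L.neg) := by
  simp [LP, dualSum]

theorem LP_pos : (LP M₁ M₂ z).pos = dualSum M₁.L.neg M₂.L.neg := rfl

/-- Formally $L(-1)$, $L(0)+aL(-1)$, $L(1)+2aL(0)+a^2L(-1)$ are the conjugates of $L(-1),L(0),L(1)$
by $e^{-aL(-1)}$, so they satisfy the same relations. -/
theorem lie_translated_zero_pos {L : Sl2Ops W} (hL : L.IsRep) (a : ℂ) :
    ⁅L.zero + a • L.neg, L.pos + (2 * a) • L.zero + a ^ 2 • L.neg⁆ =
      -(L.pos + (2 * a) • L.zero + a ^ 2 • L.neg) := by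
  have h := hL.zero_neg
  rw [← commutator_skew] at h
  simp only [add_commutator, commutator_add, smul_commutator, commutator_smul, commutator_self,
    hL.zero_pos, hL.zero_neg, hL.neg_pos,
    neg_eq_iff_eq_neg.1 h]
  module

theorem lie_translated_zero_neg {L : Sl2Ops W} (hL : L.IsRep) (a : ℂ) :
    ⁅L.zero + a • L.neg, L.neg⁆ = L.neg := by
  simp only [add_commutator, smul_commutator, commutator_self, hL.zero_neg, smul_zero, add_zero]

theorem lie_translated_pos_neg {L : Sl2Ops W} (hL : L.IsRep) (a : ℂ) :
    ⁅L.pos + (2 * a) • L.zero + a ^ 2 • L.neg, L.neg⁆ = (2 : ℂ) • (L.zero + a • L.neg) := by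
  have h := hL.neg_pos
  rw [← commutator_skew] at h
  simp only [add_commutator, smul_commutator, commutator_self, hL.zero_neg, neg_eq_iff_eq_neg.1 h]
  module

theorem LP_isRep : (LP M₁ M₂ z).IsRep where
  zero_neg := by
    rw [LP_zero, LP_neg, lie_dualSum, lie_translated_zero_pos M₁.sl2,
      lie_translated_zero_pos M₂.sl2, neg_neg, neg_neg]
  zero_pos := by
    rw [LP_zero, LP_pos, lie_dualSum, lie_translated_zero_neg M₁.sl2,
      lie_translated_zero_neg M₂.sl2, dualSum_neg]
  neg_pos := by
    rw [LP_neg, LP_pos, LP_zero, lie_dualSum, lie_translated_pos_neg M₁.sl2,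
      lie_translated_pos_neg M₂.sl2, dualSum_neg, dualSum_smul]

variable {M₁ M₂}

theorem lie_LP_neg (h₁ : M₁.IsMobius) (h₂ : M₂.IsMobius) (v : V) (f : RatFunc ℂ) :
    ⁅(LP M₁ M₂ z).neg, tauP M₁ M₂ z (v ⊗ₜ f)⁆ = tauP M₁ M₂ z (𝒱.L.neg v ⊗ₜ f) := by
  rw [LP_neg, tauP_eq_dualSum, lie_dualSum, lie_pos_oppMode h₁, lie_pos_oppMode h₂, neg_neg,
    neg_neg, tauP_eq_dualSum]

theorem lie_LP_zero (h₁ : M₁.IsMobius) (h₂ : M₂.IsMobius) (v : V) (f : RatFunc ℂ) :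
    ⁅(LP M₁ M₂ z).zero, tauP M₁ M₂ z (v ⊗ₜ f)⁆ =
      tauP M₁ M₂ z (𝒱.L.zero v ⊗ₜ f) + tauP M₁ M₂ z (𝒱.L.neg v ⊗ₜ (RatFunc.X * f)) := by
  simp only [LP_zero, tauP_eq_dualSum]
  rw [lie_dualSum, lie_zero_oppMode h₁, lie_zero_oppMode h₂, neg_neg,
    neg_neg, dualSum_add]

theorem lie_LP_pos (h₁ : M₁.IsMobius) (h₂ : M₂.IsMobius) (v : V) (f : RatFunc ℂ) :
    ⁅(LP M₁ M₂ z).pos, tauP M₁ M₂ z (v ⊗ₜ f)⁆ =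
      tauP M₁ M₂ z (𝒱.L.pos v ⊗ₜ f) + (2 : ℂ) • tauP M₁ M₂ z (𝒱.L.zero v ⊗ₜ (RatFunc.X * f)) +
        tauP M₁ M₂ z (𝒱.L.neg v ⊗ₜ (RatFunc.X ^ 2 * f)) := by
  simp only [LP_pos, tauP_eq_dualSum]
  rw [lie_dualSum, lie_neg_oppMode h₁, lie_neg_oppMode h₂, neg_neg,
    neg_neg, dualSum_add, dualSum_add, dualSum_smul]

theorem YP_sl2Commutators (h₁ : M₁.IsMobius) (h₂ : M₂.IsMobius) :
    Sl2Commutators 𝒱.L (LP M₁ M₂ z) (YP M₁ M₂ z) where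
  neg v n := lie_LP_neg z h₁ h₂ v _
  zero v n := by
    rw [YP_apply, lie_LP_zero z h₁ h₂, ← zpow_one_add₀ RatFunc.X_ne_zero, add_comm 1 n]
    rfl
  pos v n := by
    rw [YP_apply, lie_LP_pos z h₁ h₂, ← zpow_one_add₀ RatFunc.X_ne_zero, add_comm 1 n,
      ← zpow_natCast, ← zpow_add₀ RatFunc.X_ne_zero, add_comm _ n]
    rfl

end LP
end OppMode

/-! ### Weak commutativity -/

section CommLift

variable {R : Type*} [Ring R] [Algebra ℂ R]

/-- The linear map `f ⊗ g ↦ [α f, β g]`. -/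
def commLift (α β : RatFunc ℂ →ₗ[ℂ] R) : RatFunc ℂ ⊗[ℂ] RatFunc ℂ →ₗ[ℂ] R :=
  TensorProduct.lift ((LinearMap.mul ℂ R).compl₁₂ α β - ((LinearMap.mul ℂ R).compl₁₂ β α).flip)

@[simp] theorem commLift_tmul (α β : RatFunc ℂ →ₗ[ℂ] R) (f g : RatFunc ℂ) :
    commLift α β (f ⊗ₜ g) = ⁅α f, β g⁆ := by
  simp [commLift, Ring.lie_def]

/-- The function `t₁ - t₂`. -/
def diagonal : RatFunc ℂ ⊗[ℂ] RatFunc ℂ := RatFunc.X ⊗ₜ 1 - 1 ⊗ₜ RatFunc.X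

theorem diagonal_eq (a : ℂ) : diagonal =
    (RatFunc.X - RatFunc.C a) ⊗ₜ[ℂ] (1 : RatFunc ℂ) - 1 ⊗ₜ (RatFunc.X - RatFunc.C a) := by
  have : (RatFunc.C a : RatFunc ℂ) ⊗ₜ[ℂ] (1 : RatFunc ℂ) = 1 ⊗ₜ RatFunc.C a := by
    have h : (RatFunc.C a : RatFunc ℂ) = a • 1 := by rw [RatFunc.smul_eq_C_mul, mul_one]
    rw [h, TensorProduct.smul_tmul]
  rw [TensorProduct.sub_tmul, TensorProduct.tmul_sub, this, diagonal]
  abel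

theorem sub_tmul_pow_mul (x f g : RatFunc ℂ) (L : ℕ) :
    (x ⊗ₜ[ℂ] (1 : RatFunc ℂ) - 1 ⊗ₜ x) ^ L * (f ⊗ₜ g) = ∑ i ∈ Finset.range (L + 1),
      ((-1 : ℂ) ^ (i + L) * L.choose i) • ((x ^ i * f) ⊗ₜ[ℂ] (x ^ (L - i) * g)) := by
  rw [sub_pow, Finset.sum_mul]
  refine Finset.sum_congr rfl fun i _ => ?_
  have h : ((-1 : RatFunc ℂ ⊗[ℂ] RatFunc ℂ) ^ (i + L)) * (L.choose i : ℕ) =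
      algebraMap ℂ _ ((-1 : ℂ) ^ (i + L) * L.choose i) := by
    rw [map_mul, map_pow, map_neg, map_one, map_natCast]
  rw [Algebra.smul_def, ← h, Algebra.TensorProduct.tmul_pow, Algebra.TensorProduct.tmul_pow,
    one_pow, one_pow]
  have h2 : (x ^ i * f) ⊗ₜ[ℂ] (x ^ (L - i) * g) =
      (x ^ i) ⊗ₜ[ℂ] (1 : RatFunc ℂ) * (1 ⊗ₜ[ℂ] (x ^ (L - i))) * (f ⊗ₜ g) := by
    simp
  rw [h2]
  ring

/-- `(t₁ - t₂)^L [α(t₁), β(t₂)] = 0` -/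
def IsLocal (L : ℕ) (α β : RatFunc ℂ →ₗ[ℂ] R) : Prop :=
  ∀ ξ, commLift α β (diagonal ^ L * ξ) = 0

theorem isLocal_of_tmul (a : ℂ) {L : ℕ} {α β : RatFunc ℂ →ₗ[ℂ] R}
    (h : ∀ f g, ∑ i ∈ Finset.range (L + 1), ((-1 : ℂ) ^ (i + L) * L.choose i) •
      ⁅α ((RatFunc.X - RatFunc.C a) ^ i * f), β ((RatFunc.X - RatFunc.C a) ^ (L - i) * g)⁆ = 0) :
    IsLocal L α β := by
  intro ξ
  induction ξ using TensorProduct.induction_on with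
  | zero => simp
  | add ξ η h1 h2 => rw [mul_add, map_add, h1, h2, add_zero]
  | tmul f g =>
    rw [diagonal_eq a, sub_tmul_pow_mul, map_sum, ← h f g]
    simp only [map_smul, commLift_tmul]

theorem IsLocal.sum_eq_zero {L : ℕ} {α β : RatFunc ℂ →ₗ[ℂ] R} (h : IsLocal L α β)
    (f g : RatFunc ℂ) : ∑ i ∈ Finset.range (L + 1), ((-1 : ℂ) ^ (i + L) * L.choose i) •
      ⁅α (RatFunc.X ^ i * f), β (RatFunc.X ^ (L - i) * g)⁆ = 0 := by
  have := h (f ⊗ₜ g)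
  rw [diagonal, sub_tmul_pow_mul, map_sum] at this
  simpa only [map_smul, commLift_tmul] using this

/-- Locality is preserved by the substitution `t ↦ t⁻¹`. -/
theorem IsLocal.comp_ratInv {L : ℕ} {α β : RatFunc ℂ →ₗ[ℂ] R} (h : IsLocal L α β) (e e' : ℤ) :
    IsLocal L (α ∘ₗ LinearMap.mulLeft ℂ (RatFunc.X ^ e) ∘ₗ ratInv.toLinearMap)
      (β ∘ₗ LinearMap.mulLeft ℂ (RatFunc.X ^ e') ∘ₗ ratInv.toLinearMap) := by
  intro ξ
  have key : ∀ ξ, commLift (α ∘ₗ LinearMap.mulLeft ℂ (RatFunc.X ^ e) ∘ₗ ratInv.toLinearMap)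
      (β ∘ₗ LinearMap.mulLeft ℂ (RatFunc.X ^ e') ∘ₗ ratInv.toLinearMap) ξ =
      commLift α β (((RatFunc.X ^ e : RatFunc ℂ) ⊗ₜ[ℂ] (RatFunc.X ^ e' : RatFunc ℂ)) *
        Algebra.TensorProduct.map ratInv ratInv ξ) := by
    intro ξ
    induction ξ using TensorProduct.induction_on with
    | zero => simp
    | add ξ η h1 h2 => rw [map_add, map_add, mul_add, map_add, h1, h2]
    | tmul f g => simp
  have hX := RatFunc.X_ne_zero (K := ℂ)
  -- Since $t_1^{-1}-t_2^{-1}=-(t_1-t_2)t_1^{-1}t_2^{-1}$, the $L$-th power of the diagonal is sent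
  -- to a multiple of itself.
  have hd : Algebra.TensorProduct.map ratInv ratInv diagonal =
      diagonal * (-(RatFunc.X⁻¹ ⊗ₜ[ℂ] RatFunc.X⁻¹)) := by
    simp [diagonal, ratInv_X, sub_mul, hX]
  rw [key, map_mul (Algebra.TensorProduct.map ratInv ratInv), map_pow, hd, mul_pow]
  convert h ((-(RatFunc.X⁻¹ ⊗ₜ[ℂ] RatFunc.X⁻¹)) ^ L *
    ((RatFunc.X ^ e : RatFunc ℂ) ⊗ₜ[ℂ] (RatFunc.X ^ e' : RatFunc ℂ) *
    Algebra.TensorProduct.map ratInv ratInv ξ)) using 2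
  ring

theorem commLift_sum {ι κ : Type*} (s : Finset ι) (t : Finset κ)
    (α : ι → RatFunc ℂ →ₗ[ℂ] R) (β : κ → RatFunc ℂ →ₗ[ℂ] R) (c d : ℂ) :
    commLift (∑ i ∈ s, c • α i) (∑ j ∈ t, d • β j) =
      ∑ i ∈ s, ∑ j ∈ t, (c * d) • commLift (α i) (β j) := by
  ext f g
  simp only [TensorProduct.AlgebraTensorModule.curry_apply, TensorProduct.curry_apply,
    LinearMap.restrictScalars_self, commLift_tmul, LinearMap.sum_apply, LinearMap.smul_apply,
    Ring.lie_def, Finset.sum_mul_sum, smul_sub, Finset.sum_sub_distrib, smul_mul_smul_comm]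
  rw [Finset.sum_comm (s := t)]
  simp only [mul_comm d c]

end CommLift

/-! ### Locality of the modes and of Laurent series of modes. -/

section Modes

variable {V W : Type*} [AddCommGroup V] [Module ℂ V] [AddCommGroup W] [Module ℂ W]
  {YV : Modes V V} {Y : Modes V W}

/-- This is the Jacobi identity with $l=L$: its right side involves only $u_{L+i}v=0$, and the
binomial coefficients on the left vanish beyond $L$. -/
theorem weak_commutativity_modes (hJ : JacobiIdentity YV Y) {u v : V} {L : ℕ}
    (hL : ∀ j : ℤ, L ≤ j → YV u j v = 0) (m k : ℤ) :
    ∑ i ∈ Finset.range (L + 1), ((-1 : ℂ) ^ (i + L) * L.choose i) •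
      ⁅Y u (m + i), Y v (k + (L - i : ℕ))⁆ = 0 := by
  ext w
  have h := hJ u v w L m k
  have hc : ∀ i : ℕ, (Ring.choose (L : ℤ) i : ℤ) = (L.choose i : ℕ) := fun i =>
    Ring.choose_natCast L i
  have hz : ∀ i : ℕ, L + 1 ≤ i → (Ring.choose (L : ℤ) i : ℤ) = 0 := fun i hi => by
    rw [hc, Nat.choose_eq_zero_of_lt hi, Nat.cast_zero]
  rw [finsum_eq_sum_range (B := L + 1) fun i hi => by rw [hz i hi]; simp,
    finsum_eq_sum_range (B := L + 1) fun i hi => by rw [hz i hi]; simp,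
    finsum_eq_zero_of_forall_eq_zero fun i => by rw [hL _ (by omega)]; simp,
    ← Finset.sum_range_reflect, ← Finset.sum_sub_distrib] at h
  rw [LinearMap.zero_apply, ← h, LinearMap.sum_apply]
  refine Finset.sum_congr rfl fun i hi => ?_
  have hi' : i ≤ L := by simpa [Nat.lt_succ_iff] using hi
  have hs : L + 1 - 1 - i = L - i := by omega
  have hsgn : (-1 : ℂ) ^ (L - i) = (-1) ^ (i + L) := by
    rw [show i + L = 2 * i + (L - i) by omega, pow_add, pow_mul, neg_one_sq, one_pow, one_mul]
  have hsgn2 : (-1 : ℂ) ^ ((L : ℤ) + i) = (-1) ^ (i + L) := by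
    rw [add_comm i L]
    exact_mod_cast rfl
  rw [hs, hc, hc, Nat.choose_symm hi', hsgn, hsgn2, LinearMap.smul_apply, Ring.lie_def,
    LinearMap.sub_apply, smul_sub, Module.End.mul_apply, Module.End.mul_apply]
  have e1 : m + L - ((L - i : ℕ) : ℤ) = m + i := by omega
  have e2 : k + L - (i : ℤ) = k + ((L - i : ℕ) : ℤ) := by omega
  rw [e1, e2]
  push_cast
  rfl

theorem mulT_pow_single (i : ℕ) (n : ℤ) :
    (mulT ^ i) (HahnSeries.single n 1) = HahnSeries.single (n + i) 1 := by
  induction i with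
  | zero => simp
  | succ i ih =>
    rw [pow_succ', Module.End.mul_apply, ih, mulT_single]
    push_cast
    rw [add_assoc]

theorem mulT_pow_coeff {F : LaurentSeries ℂ} {N : ℤ} (hF : ∀ n < N, F.coeff n = 0) (i : ℕ) :
    ∀ n < N, ((mulT ^ i) F).coeff n = 0 := by
  induction i with
  | zero => simpa using hF
  | succ i ih =>
    rw [pow_succ', Module.End.mul_apply]
    exact mulT_coeff ih

theorem exists_forall_mem_int {ι : Type*} (s : Finset ι) (p : ι → ℤ → Prop)
    (h : ∀ i ∈ s, ∃ N, ∀ n, N ≤ n → p i n) : ∃ N, ∀ i ∈ s, ∀ n, N ≤ n → p i n := by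
  classical
  choose! N hN using h
  induction s using Finset.induction_on with
  | empty => exact ⟨0, by simp⟩
  | insert a s _ ih =>
    obtain ⟨M, hM⟩ := ih fun i hi => hN i (Finset.mem_insert_of_mem hi)
    refine ⟨max M (N a), fun i hi n hn => ?_⟩
    rcases Finset.mem_insert.1 hi with rfl | hi
    · exact hN _ (Finset.mem_insert_self _ _) n ((le_max_right _ _).trans hn)
    · exact hM i hi n ((le_max_left _ _).trans hn)

/-- The expression is bilinear in $F$ and $H$. Apply `laurent_hom_eq_zero` in $H$ for $F$ a
monomial, then in $F$. For a fixed $w$ only finitely many vectors occur, so one truncation bound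
serves for all terms. -/
theorem weak_commutativity_laurent (hY : LowerTruncated Y) (hJ : JacobiIdentity YV Y) {u v : V}
    {L : ℕ} (hL : ∀ j : ℤ, L ≤ j → YV u j v = 0) (F H : LaurentSeries ℂ) :
    ∑ i ∈ Finset.range (L + 1), ((-1 : ℂ) ^ (i + L) * L.choose i) •
      ⁅tauW Y hY (u ⊗ₜ (mulT ^ i) F), tauW Y hY (v ⊗ₜ (mulT ^ (L - i)) H)⁆ = 0 := by
  let B (α β : LaurentSeries ℂ →ₗ[ℂ] Module.End ℂ W) :
      LaurentSeries ℂ →ₗ[ℂ] LaurentSeries ℂ →ₗ[ℂ] Module.End ℂ W :=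
    (LinearMap.mul ℂ (Module.End ℂ W)).compl₁₂ α β -
      ((LinearMap.mul ℂ (Module.End ℂ W)).compl₁₂ β α).flip
  let T : LaurentSeries ℂ →ₗ[ℂ] LaurentSeries ℂ →ₗ[ℂ] Module.End ℂ W :=
    ∑ i ∈ Finset.range (L + 1), ((-1 : ℂ) ^ (i + L) * L.choose i) •
      B (tauWHom hY u ∘ₗ mulT ^ i) (tauWHom hY v ∘ₗ mulT ^ (L - i))
  have hT : ∀ F H, T F H = ∑ i ∈ Finset.range (L + 1), ((-1 : ℂ) ^ (i + L) * L.choose i) •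
      ⁅tauW Y hY (u ⊗ₜ (mulT ^ i) F), tauW Y hY (v ⊗ₜ (mulT ^ (L - i)) H)⁆ := fun F H => by
    simp [T, B, LinearMap.sum_apply, Ring.lie_def, tauWHom_apply]
  rw [← hT]
  ext w
  have hT' : ∀ F H, T F H w = ∑ i ∈ Finset.range (L + 1), ((-1 : ℂ) ^ (i + L) * L.choose i) •
      (tauW Y hY (u ⊗ₜ (mulT ^ i) F) (tauW Y hY (v ⊗ₜ (mulT ^ (L - i)) H) w) -
        tauW Y hY (v ⊗ₜ (mulT ^ (L - i)) H) (tauW Y hY (u ⊗ₜ (mulT ^ i) F) w)) := fun F H => by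
    rw [hT]
    simp [LinearMap.sum_apply, Ring.lie_def]
  have h1 : ∀ n m, T (HahnSeries.single n 1) (HahnSeries.single m 1) w = 0 := fun n m => by
    rw [hT]
    simp only [mulT_pow_single, tauW_single, one_smul]
    rw [weak_commutativity_modes hJ hL, LinearMap.zero_apply]
  have hfin : ∀ (x : V) (s : Finset ℕ) (y : ℕ → W), ∃ N : ℤ, ∀ i ∈ s, ∀ n, N ≤ n →
      ∀ F : LaurentSeries ℂ, (∀ m < n, F.coeff m = 0) → tauW Y hY (x ⊗ₜ F) (y i) = 0 :=
    fun x s y => exists_forall_mem_int s _ fun i _ => by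
      obtain ⟨N, hN⟩ := exists_tauW_eq_zero hY x (y i)
      exact ⟨N, fun n hn F hF => hN F fun m hm => hF m (hm.trans_le hn)⟩
  have h2 : ∀ n, (LinearMap.applyₗ w) ∘ₗ T (HahnSeries.single n 1) = 0 := fun n => by
    obtain ⟨N₁, hN₁⟩ := hfin v (Finset.range (L + 1)) fun _ => w
    obtain ⟨N₂, hN₂⟩ := hfin v (Finset.range (L + 1)) fun i =>
      tauW Y hY (u ⊗ₜ (mulT ^ i) (HahnSeries.single n 1)) w
    refine laurent_hom_eq_zero (N := max N₁ N₂) _ (h1 n) fun H hH => ?_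
    rw [LinearMap.comp_apply, LinearMap.applyₗ_apply_apply, hT']
    refine Finset.sum_eq_zero fun i hi => ?_
    rw [hN₁ i hi _ (le_max_left _ _) _ (mulT_pow_coeff hH _),
      hN₂ i hi _ (le_max_right _ _) _ (mulT_pow_coeff hH _)]
    simp
  have h3 : (LinearMap.applyₗ w) ∘ₗ T.flip H = 0 := by
    obtain ⟨N₁, hN₁⟩ := hfin u (Finset.range (L + 1)) fun i =>
      tauW Y hY (v ⊗ₜ (mulT ^ (L - i)) H) w
    obtain ⟨N₂, hN₂⟩ := hfin u (Finset.range (L + 1)) fun _ => w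
    refine laurent_hom_eq_zero (N := max N₁ N₂) _ (fun n => LinearMap.congr_fun (h2 n) H)
      fun F hF => ?_
    rw [LinearMap.comp_apply, LinearMap.applyₗ_apply_apply, LinearMap.flip_apply, hT']
    refine Finset.sum_eq_zero fun i hi => ?_
    rw [hN₁ i hi _ (le_max_left _ _) _ (mulT_pow_coeff hF _),
      hN₂ i hi _ (le_max_right _ _) _ (mulT_pow_coeff hF _)]
    simp
  exact LinearMap.congr_fun h3 F

end Modes

/-! ### Locality of opposite operators and of $\tau_{P(z)}$. -/

section OppMode

variable {G : Type*} [AddCommGroup G] {A : AddSubgroup G} {V : Type*} [AddCommGroup V]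
  [Module ℂ V] {𝒱 : VertexAlgebra A V} {W : Type*} [AddCommGroup W] [Module ℂ W]
  {W₁ : Type*} [AddCommGroup W₁] [Module ℂ W₁] {W₂ : Type*} [AddCommGroup W₂] [Module ℂ W₂]

/-- Write $t_1-t_2=(t_1-a)-(t_2-a)$; expansion about $a$ turns $t-a$ into the variable of the
Laurent series. -/
theorem isLocal_tauAt (M : GeneralizedModule 𝒱 W) (a : ℂ) {u v : V} {L : ℕ}
    (hL : ∀ j : ℤ, L ≤ j → 𝒱.Y u j v = 0) :
    IsLocal L (tauAt M a ∘ₗ TensorProduct.mk ℂ V (RatFunc ℂ) u)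
      (tauAt M a ∘ₗ TensorProduct.mk ℂ V (RatFunc ℂ) v) := by
  refine isLocal_of_tmul a fun f g => ?_
  have h : ∀ (i : ℕ) (f : RatFunc ℂ), expansion a ((RatFunc.X - RatFunc.C a) ^ i * f) =
      (mulT ^ i) (expansion a f) := fun i f => by
    induction i with
    | zero => simp
    | succ i ih =>
      have hC : expansion a (RatFunc.C a) = HahnSeries.C a := by
        change iotaPlusHom (ratShift a (RatFunc.C a)) = _
        rw [← RatFunc.algebraMap_eq_C, AlgHom.commutes, RatFunc.algebraMap_eq_C, iotaPlusHom_C]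
      rw [pow_succ', mul_assoc, map_mul, ih, pow_succ', Module.End.mul_apply, mulT_apply, map_sub,
        expansion_X, hC, add_sub_cancel_right]
  simp only [LinearMap.comp_apply, TensorProduct.mk_apply, tauAt_tmul, h]
  exact weak_commutativity_laurent M.truncation M.jacobi hL _ _

theorem exists_nat_mode_eq_zero {YV : Modes V W} (hY : LowerTruncated YV) (s t : Finset ℕ)
    (x : ℕ → V) (y : ℕ → W) :
    ∃ L : ℕ, ∀ p ∈ s, ∀ q ∈ t, ∀ j : ℤ, L ≤ j → YV (x p) j (y q) = 0 := by
  obtain ⟨N, hN⟩ := exists_forall_mem_int (s ×ˢ t)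
    (fun i j => YV (x i.1) j (y i.2) = 0) fun i _ => hY (x i.1) (y i.2)
  exact ⟨N.toNat, fun p hp q hq j hj => hN (p, q) (Finset.mk_mem_product hp hq) j
    (N.self_le_toNat.trans hj)⟩

/-- The opposite of a homogeneous vector is a finite sum of divided powers times powers of $t$,
followed by $t\mapsto t^{-1}$. Each pair of summands is local, with a common order $L$. -/
theorem isLocal_oppMode (M : GeneralizedModule 𝒱 W) (a : ℂ) {u v : V} {h h' : ℤ}
    (hu : u ∈ 𝒱.L.zero.eigenspace (h : ℂ)) (hv : v ∈ 𝒱.L.zero.eigenspace (h' : ℂ)) {K K' L : ℕ}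
    (hK : ∀ p, K ≤ p → 𝒱.divPow p u = 0) (hK' : ∀ q, K' ≤ q → 𝒱.divPow q v = 0)
    (hL : ∀ p ∈ Finset.range K, ∀ q ∈ Finset.range K', ∀ j : ℤ, L ≤ j →
      𝒱.Y (𝒱.divPow p u) j (𝒱.divPow q v) = 0) :
    IsLocal L (oppMode M a ∘ₗ TensorProduct.mk ℂ V (RatFunc ℂ) u)
      (oppMode M a ∘ₗ TensorProduct.mk ℂ V (RatFunc ℂ) v) := by
  intro ξ
  have e : ∀ {x : V} {n : ℤ} (hx : x ∈ 𝒱.L.zero.eigenspace (n : ℂ)) {K : ℕ}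
      (hK : ∀ m, K ≤ m → 𝒱.divPow m x = 0), oppMode M a ∘ₗ TensorProduct.mk ℂ V (RatFunc ℂ) x =
      ∑ p ∈ Finset.range K, ((-1 : ℂ) ^ n) •
        ((tauAt M a ∘ₗ TensorProduct.mk ℂ V (RatFunc ℂ) (𝒱.divPow p x)) ∘ₗ
          LinearMap.mulLeft ℂ (RatFunc.X ^ (-(p : ℤ) - 2 + 2 * n)) ∘ₗ ratInv.toLinearMap) := by
    intro x n hx K hK
    ext f : 1
    rw [LinearMap.comp_apply, TensorProduct.mk_apply, oppMode_of_mem M a hx hK]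
    simp [LinearMap.sum_apply, tauAt_tmul]
  rw [e hu hK, e hv hK', commLift_sum, LinearMap.sum_apply]
  refine Finset.sum_eq_zero fun p hp => ?_
  rw [LinearMap.sum_apply]
  refine Finset.sum_eq_zero fun q hq => ?_
  rw [LinearMap.smul_apply, (isLocal_tauAt M a (hL p hp q hq)).comp_ratInv _ _ ξ, smul_zero]

/-- The order $L$ depends only on $u$ and $v$, so it serves for $W_1$ and $W_2$ alike, and the
bracket on the dual is assembled from the brackets on the two factors. -/
theorem exists_isLocal_tauP (M₁ : GeneralizedModule 𝒱 W₁) (M₂ : GeneralizedModule 𝒱 W₂) (z : ℂ)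
    {u v : V} {h h' : ℤ}
    (hu : u ∈ 𝒱.L.zero.eigenspace (h : ℂ)) (hv : v ∈ 𝒱.L.zero.eigenspace (h' : ℂ)) :
    ∃ L : ℕ, IsLocal L (tauP M₁ M₂ z ∘ₗ TensorProduct.mk ℂ V (RatFunc ℂ) u)
      (tauP M₁ M₂ z ∘ₗ TensorProduct.mk ℂ V (RatFunc ℂ) v) := by
  obtain ⟨K, hK⟩ := 𝒱.exists_divPow_eq_zero u
  obtain ⟨K', hK'⟩ := 𝒱.exists_divPow_eq_zero v
  obtain ⟨L, hL⟩ := exists_nat_mode_eq_zero 𝒱.truncation (Finset.range K) (Finset.range K')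
    (fun p => 𝒱.divPow p u) fun q => 𝒱.divPow q v
  refine ⟨L, fun ξ => ?_⟩
  have key : ∀ ξ, commLift (tauP M₁ M₂ z ∘ₗ TensorProduct.mk ℂ V (RatFunc ℂ) u)
      (tauP M₁ M₂ z ∘ₗ TensorProduct.mk ℂ V (RatFunc ℂ) v) ξ =
      dualSum (-commLift (oppMode M₁ z ∘ₗ TensorProduct.mk ℂ V (RatFunc ℂ) u)
          (oppMode M₁ z ∘ₗ TensorProduct.mk ℂ V (RatFunc ℂ) v) ξ)
        (-commLift (oppMode M₂ 0 ∘ₗ TensorProduct.mk ℂ V (RatFunc ℂ) u)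
          (oppMode M₂ 0 ∘ₗ TensorProduct.mk ℂ V (RatFunc ℂ) v) ξ) := by
    intro ξ
    induction ξ using TensorProduct.induction_on with
    | zero => simp only [map_zero, neg_zero, dualSum_zero]
    | add ξ η h1 h2 => simp only [map_add, h1, h2, neg_add, dualSum_add]
    | tmul f g =>
      simp only [commLift_tmul, LinearMap.comp_apply, TensorProduct.mk_apply, tauP_eq_dualSum,
        lie_dualSum]
  rw [key, isLocal_oppMode M₁ z hu hv hK hK' hL, isLocal_oppMode M₂ 0 hu hv hK hK' hL,
    neg_zero, neg_zero, dualSum_zero]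

/-! ### The compatibility condition -/

/-- The uniqueness principle of the proof, by descent from $N$: $1-zs$, with $s$ the shift, is
injective on sequences that vanish for large index. -/
theorem eq_zero_of_eq_smul_succ {X : Type*} [AddCommGroup X] [Module ℂ X] {d : ℤ → X} {z : ℂ}
    {N : ℤ} (h : ∀ a, d a = z • d (a + 1)) (hN : ∀ a, N ≤ a → d a = 0) (a : ℤ) : d a = 0 := by
  have key : ∀ (k : ℕ) (a : ℤ), N ≤ a + k → d a = 0 := by
    intro k
    induction k with
    | zero => exact fun a ha => hN a (by simpa using ha)
    | succ k ih =>
      intro a ha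
      rw [h, ih (a + 1) (by push_cast at ha; omega), smul_zero]
  exact key (N - a).toNat a (by omega)

/-- `(t⁻¹ - z)ⁿ tⁿ⁺ᵃ = (1 - zt)ⁿ tᵃ` -/
def testFunc (z : ℂ) (n a : ℤ) : RatFunc ℂ :=
  (RatFunc.X⁻¹ - RatFunc.C z) ^ n * RatFunc.X ^ (n + a)

theorem X_inv_sub_ne_zero (z : ℂ) : (RatFunc.X⁻¹ - RatFunc.C z : RatFunc ℂ) ≠ 0 := fun h =>
  transcendental_X_inv (by
    rw [sub_eq_zero.1 h, ← RatFunc.algebraMap_eq_C]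
    exact isAlgebraic_algebraMap z)

theorem testFunc_zero (z : ℂ) (a : ℤ) : testFunc z 0 a = RatFunc.X ^ a := by
  simp [testFunc]

theorem X_pow_mul_testFunc (z : ℂ) (n a : ℤ) (i : ℕ) :
    RatFunc.X ^ i * testFunc z n a = testFunc z n (a + i) := by
  rw [testFunc, mul_left_comm, ← zpow_natCast, ← zpow_add₀ RatFunc.X_ne_zero, testFunc]
  congr 2
  ring

theorem X_mul_testFunc (z : ℂ) (n a : ℤ) :
    RatFunc.X * testFunc z n a = testFunc z n (a + 1) := by
  simpa using X_pow_mul_testFunc z n a 1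

theorem testFunc_succ (z : ℂ) (n a : ℤ) :
    testFunc z (n + 1) a = testFunc z n a - z • testFunc z n (a + 1) := by
  have hX := RatFunc.X_ne_zero (K := ℂ)
  rw [testFunc, zpow_add_one₀ (X_inv_sub_ne_zero z), mul_assoc, sub_mul, ← X_mul_testFunc,
    RatFunc.smul_eq_C_mul, testFunc, mul_sub,
    show (n + 1 + a) = (n + a) + 1 by ring, zpow_add_one₀ hX,
    mul_comm (RatFunc.X ^ (n + a)) RatFunc.X, inv_mul_cancel_left₀ hX]
  ring

variable (M₁ : GeneralizedModule 𝒱 W₁) (M₂ : GeneralizedModule 𝒱 W₂) (z : ℂ)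

/-- `τ_{P(z)}(v ⊗ f)λ = 0` for all `f` of order at least `N` at `0` of the form
`(1 - zt)ⁿ tᵃ`. -/
def UniformlyTruncated (lam : TDual W₁ W₂) (v : V) : Prop :=
  ∃ N : ℤ, ∀ n a, N ≤ a → tauP M₁ M₂ z (v ⊗ₜ testFunc z n a) lam = 0

variable {M₁ M₂ z}

theorem UniformlyTruncated.add_left {lam mu : TDual W₁ W₂} {v : V}
    (h : UniformlyTruncated M₁ M₂ z lam v) (h' : UniformlyTruncated M₁ M₂ z mu v) :
    UniformlyTruncated M₁ M₂ z (lam + mu) v := by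
  obtain ⟨N, hN⟩ := h
  obtain ⟨N', hN'⟩ := h'
  exact ⟨max N N', fun n a ha => by
    rw [map_add, hN n a (le_of_max_le_left ha), hN' n a (le_of_max_le_right ha), add_zero]⟩

theorem UniformlyTruncated.add_right {lam : TDual W₁ W₂} {v v' : V}
    (h : UniformlyTruncated M₁ M₂ z lam v) (h' : UniformlyTruncated M₁ M₂ z lam v') :
    UniformlyTruncated M₁ M₂ z lam (v + v') := by
  obtain ⟨N, hN⟩ := h
  obtain ⟨N', hN'⟩ := h'
  exact ⟨max N N', fun n a ha => by
    rw [TensorProduct.add_tmul, map_add, LinearMap.add_apply, hN n a (le_of_max_le_left ha),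
      hN' n a (le_of_max_le_right ha), add_zero]⟩

theorem UniformlyTruncated.smul_left {lam : TDual W₁ W₂} {v : V}
    (h : UniformlyTruncated M₁ M₂ z lam v) (c : ℂ) : UniformlyTruncated M₁ M₂ z (c • lam) v := by
  obtain ⟨N, hN⟩ := h
  exact ⟨N, fun n a ha => by rw [map_smul, hN n a ha, smul_zero]⟩

variable (M₁ M₂ z)

/-- The space `COMP_{P(z)}((W₁ ⊗ W₂)^*)`. -/
def compSubmodule : Submodule ℂ (TDual W₁ W₂) where
  carrier := {lam | ∀ v, UniformlyTruncated M₁ M₂ z lam v}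
  add_mem' h h' v := (h v).add_left (h' v)
  zero_mem' _ := ⟨0, fun _ _ _ => map_zero _⟩
  smul_mem' c _ h v := (h v).smul_left c

variable {M₁ M₂ z}

/-- Pascal's rule. This is the recursion that `testFunc_succ` gives for $\tau_{P(z)}$, now for the
binomial expansion of $(1-zt)^n$. -/
theorem finsum_testFunc_succ {X : Type*} [AddCommGroup X] [Module ℂ X] {y : ℤ → X} {N : ℤ}
    (hN : ∀ a, N ≤ a → y a = 0) (z : ℂ) (n a : ℤ) :
    ∑ᶠ i : ℕ, ((Ring.choose (n + 1) i : ℤ) * (-z) ^ i : ℂ) • y (a + i) =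
      ∑ᶠ i : ℕ, ((Ring.choose n i : ℤ) * (-z) ^ i : ℂ) • y (a + i) -
        z • ∑ᶠ i : ℕ, ((Ring.choose n i : ℤ) * (-z) ^ i : ℂ) • y (a + 1 + i) := by
  have hB : ∀ a' : ℤ, a ≤ a' → ∀ i : ℕ, (N - a).toNat ≤ i → y (a' + i) = 0 := fun a' ha i hi =>
    hN _ (by omega)
  rw [finsum_eq_sum_range (B := (N - a).toNat + 1) fun i hi => by
      rw [hB a le_rfl i (by omega), smul_zero],
    finsum_eq_sum_range (B := (N - a).toNat + 1) fun i hi => by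
      rw [hB a le_rfl i (by omega), smul_zero],
    finsum_eq_sum_range (B := (N - a).toNat) fun i hi => by
      rw [hB (a + 1) (by omega) i (by omega), smul_zero], Finset.sum_range_succ',
      Finset.sum_range_succ', Finset.smul_sum, add_sub_right_comm, ← Finset.sum_sub_distrib]
  congr 1
  · refine Finset.sum_congr rfl fun i _ => ?_
    rw [Ring.choose_succ_succ]
    push_cast
    rw [show a + 1 + (i : ℤ) = a + (i + 1) by ring]
    module
  · simp

/-- A compatible $\lambda$ is uniformly truncated because the expansion of $(1-zt)^nt^a$ involves
only the modes with index at least $a$, whatever $n$ is. Conversely, the two sides of the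
compatibility condition agree at $n=0$ and satisfy the same recursion in $n$. -/
theorem coe_compSubmodule : (compSubmodule M₁ M₂ z : Set (TDual W₁ W₂)) = compP M₁ M₂ z := by
  ext lam
  have hE : ∀ n m : ℤ, ((RatFunc.X⁻¹ - RatFunc.C z) ^ n * RatFunc.X ^ m : RatFunc ℂ) =
      testFunc z n (m - n) := fun n m => by
    rw [testFunc, add_sub_cancel]
  constructor
  · intro h
    refine ⟨fun v => ?_, fun v n m => ?_⟩
    · obtain ⟨N, hN⟩ := h v
      refine ⟨N, fun n hn => ?_⟩
      rw [YP_apply, ← testFunc_zero z, hN _ _ hn]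
    · obtain ⟨N, hN⟩ := h v
      have hy : ∀ a, N ≤ a → YP M₁ M₂ z v a lam = 0 := fun a ha => by
        rw [YP_apply, ← testFunc_zero z, hN _ _ ha]
      rw [hE]
      generalize m - n = a
      have hs : ∀ n a, tauP M₁ M₂ z (v ⊗ₜ testFunc z (n + 1) a) lam =
          tauP M₁ M₂ z (v ⊗ₜ testFunc z n a) lam -
            z • tauP M₁ M₂ z (v ⊗ₜ testFunc z n (a + 1)) lam := fun n a => by
        rw [testFunc_succ, TensorProduct.tmul_sub, map_sub, TensorProduct.tmul_smul, map_smul]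
        rfl
      induction n generalizing a with
      | zero =>
        rw [finsum_eq_single _ 0 fun i hi => by
          rw [Ring.choose_zero_pos ℤ (Nat.pos_of_ne_zero hi)]; simp]
        simp [testFunc_zero, YP_apply]
      | succ n ih => rw [hs, ih, ih, finsum_testFunc_succ hy]
      | pred n ih =>
        -- Going down in $n$, the recursion only says that the difference $d$ of the two sides
        -- satisfies $d(a)=z\,d(a+1)$. The uniform truncation supplies $d(a)=0$ for large $a$.
        refine sub_eq_zero.1 (eq_zero_of_eq_smul_succ (z := z) (N := N) (d := fun a =>
          tauP M₁ M₂ z (v ⊗ₜ testFunc z (-(n : ℤ) - 1) a) lam -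
          ∑ᶠ i : ℕ, ((Ring.choose (-(n : ℤ) - 1) i : ℤ) * (-z) ^ i : ℂ) • YP M₁ M₂ z v (a + i) lam)
          (fun a => ?_) (fun a ha => ?_) a)
        · have h1 := hs (-(n : ℤ) - 1) a
          have h2 := finsum_testFunc_succ hy z (-(n : ℤ) - 1) a
          rw [sub_add_cancel] at h1 h2
          have h3 := ih a
          rw [h1, h2, ← sub_eq_zero] at h3
          rw [← sub_eq_zero, ← h3]
          module
        · rw [hN _ _ ha, finsum_eq_zero_of_forall_eq_zero fun i => by
            rw [hy _ (by omega), smul_zero], sub_zero]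
  · rintro ⟨h1, h2⟩ v
    obtain ⟨N, hN⟩ := h1 v
    refine ⟨N, fun n a ha => ?_⟩
    rw [testFunc, h2 v n (n + a)]
    exact finsum_eq_zero_of_forall_eq_zero fun i => by
      rw [hN _ (by omega), smul_zero]

theorem YP_truncated {lam : TDual W₁ W₂} (h : lam ∈ compSubmodule M₁ M₂ z) (v : V) :
    ∃ N : ℤ, ∀ n, N ≤ n → YP M₁ M₂ z v n lam = 0 := by
  obtain ⟨N, hN⟩ := h v
  exact ⟨N, fun n hn => by rw [YP_apply, ← testFunc_zero z, hN _ _ hn]⟩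

/-- Descending induction on $k$, starting where $v_k\lambda=0$. Locality applied to
$(1-zt)^nt^{a-L}$ and $t^k$ expresses the wanted term through terms with $v_{k+j}\lambda$, $1\le
j\le L$, and terms in which $u$ meets $\lambda$ first; all of these vanish for large $a$, uniformly
in $n$. -/
theorem YP_mem_compSubmodule {lam : TDual W₁ W₂} (hlam : lam ∈ compSubmodule M₁ M₂ z) (v : V)
    (k : ℤ) : YP M₁ M₂ z v k lam ∈ compSubmodule M₁ M₂ z := by
  intro u
  induction v using 𝒱.wt_induction with
  | add v v' h h' =>
    rw [map_add]
    exact h.add_left h'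
  | mem h' v hv =>
    induction u using 𝒱.wt_induction with
    | add u u' h h' => exact h.add_right h'
    | mem h u hu =>
      obtain ⟨L, hL⟩ := exists_isLocal_tauP M₁ M₂ z hu hv
      obtain ⟨N, hN⟩ := hlam u
      obtain ⟨K, hK⟩ := YP_truncated hlam v
      have key : ∀ d : ℕ, ∃ N : ℤ, ∀ k, K - d ≤ k → ∀ n a, N ≤ a →
          tauP M₁ M₂ z (u ⊗ₜ testFunc z n a) (YP M₁ M₂ z v k lam) = 0 := by
        intro d
        induction d with
        | zero => exact ⟨0, fun k hk n a _ => by rw [hK k (by simpa using hk), map_zero]⟩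
        | succ d ih =>
          obtain ⟨N', hN'⟩ := ih
          -- The exponents for $u$ in the locality relation run from $a-L$ to $a$, which costs $L$
          -- at each step.
          refine ⟨max N N' + L, fun k hk n a ha => ?_⟩
          have hNa : N + L ≤ a := (add_le_add_left (le_max_left _ _) _).trans ha
          have hNa' : N' + L ≤ a := (add_le_add_left (le_max_right _ _) _).trans ha
          by_cases hk' : K - d ≤ k
          · exact hN' k hk' n a (by omega)
          have h := LinearMap.congr_fun (hL.sum_eq_zero (testFunc z n (a - L)) (RatFunc.X ^ k)) lam
          simp only [LinearMap.comp_apply, TensorProduct.mk_apply, X_pow_mul_testFunc] at h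
          rw [Finset.sum_range_succ, LinearMap.add_apply, LinearMap.sum_apply,
            Finset.sum_eq_zero fun i hi => ?_, zero_add, LinearMap.zero_apply] at h
          · simp only [Ring.lie_def, LinearMap.sub_apply,
              Module.End.mul_apply, Nat.sub_self, pow_zero, one_mul, Nat.choose_self,
              Nat.cast_one, mul_one, (Even.add_self L).neg_one_pow, one_smul,
              sub_add_cancel] at h
            rw [hN n a (by omega), map_zero, sub_zero] at h
            exact h
          · have hi' := Finset.mem_range.1 hi
            rw [LinearMap.smul_apply, Ring.lie_def, LinearMap.sub_apply, Module.End.mul_apply,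
              Module.End.mul_apply, hN n _ (by omega), map_zero, sub_zero,
              ← zpow_natCast (RatFunc.X : RatFunc ℂ), ← zpow_add₀ RatFunc.X_ne_zero, ← YP_apply,
              hN' _ (by push_cast at hk; omega) n _ (by omega),
              smul_zero]
      obtain ⟨N', hN'⟩ := key (K - k).toNat
      exact ⟨N', fun n a ha => hN' k (by omega) n a ha⟩

/-- Multiplication by $t$ or $t^2$ only raises the exponent $a$, so the truncation bounds for $bv$,
$cv$, $dv$ remain valid. -/
theorem map_mem_compSubmodule {B : Module.End ℂ (TDual W₁ W₂)} {b c d : V → V}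
    (hB : ∀ v f, ⁅B, tauP M₁ M₂ z (v ⊗ₜ f)⁆ = tauP M₁ M₂ z (b v ⊗ₜ f) +
      tauP M₁ M₂ z (c v ⊗ₜ (RatFunc.X * f)) + tauP M₁ M₂ z (d v ⊗ₜ (RatFunc.X ^ 2 * f)))
    {lam : TDual W₁ W₂} (hlam : lam ∈ compSubmodule M₁ M₂ z) : B lam ∈ compSubmodule M₁ M₂ z := by
  intro v
  obtain ⟨N, hN⟩ := hlam v
  obtain ⟨N₁, h₁⟩ := hlam (b v)
  obtain ⟨N₂, h₂⟩ := hlam (c v)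
  obtain ⟨N₃, h₃⟩ := hlam (d v)
  refine ⟨max (max N N₁) (max N₂ N₃), fun n a ha => ?_⟩
  simp only [max_le_iff] at ha
  have h := LinearMap.congr_fun (hB v (testFunc z n a)) lam
  rw [X_mul_testFunc, X_pow_mul_testFunc, Ring.lie_def] at h
  simp only [LinearMap.sub_apply, LinearMap.add_apply, Module.End.mul_apply] at h
  rw [hN n a ha.1.1, h₁ n a ha.1.2, h₂ n _ (by omega), h₃ n _ (by omega), map_zero] at h
  simpa using h

theorem LP_mem_compSubmodule (h₁ : M₁.IsMobius) (h₂ : M₂.IsMobius) {lam : TDual W₁ W₂}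
    (hlam : lam ∈ compSubmodule M₁ M₂ z) :
    (LP M₁ M₂ z).neg lam ∈ compSubmodule M₁ M₂ z ∧
      (LP M₁ M₂ z).zero lam ∈ compSubmodule M₁ M₂ z ∧
      (LP M₁ M₂ z).pos lam ∈ compSubmodule M₁ M₂ z :=
  ⟨map_mem_compSubmodule (b := 𝒱.L.neg) (c := 0) (d := 0)
      (fun v f => by rw [lie_LP_neg z h₁ h₂]; simp) hlam,
    map_mem_compSubmodule (b := 𝒱.L.zero) (c := 𝒱.L.neg) (d := 0)
      (fun v f => by rw [lie_LP_zero z h₁ h₂]; simp) hlam,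
    map_mem_compSubmodule (b := 𝒱.L.pos) (c := fun v => (2 : ℂ) • 𝒱.L.zero v) (d := 𝒱.L.neg)
      (fun v f => by rw [lie_LP_pos z h₁ h₂, ← TensorProduct.smul_tmul', map_smul]) hlam⟩

end OppMode

/-! ### Binomial identities and finite sums -/

theorem succ_mul_choose_succ (n : ℤ) (j : ℕ) :
    ((j : ℤ) + 1) * Ring.choose n (j + 1) = (n - j) * Ring.choose n j := by
  have h := Ring.choose_smul_choose n (n := j + 1) (k := j) (Nat.le_succ j)
  rw [Nat.choose_succ_self_right, Nat.add_sub_cancel_left, Ring.choose_one_right, nsmul_eq_mul,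
    mul_comm (Ring.choose n j)] at h
  exact_mod_cast h

/-- Negating the upper index of the second binomial coefficient makes this the Chu–Vandermonde
identity. -/
theorem sum_antidiagonal_neg_one_pow_mul_choose (m n : ℤ) (J : ℕ) :
    ∑ x ∈ Finset.HasAntidiagonal.antidiagonal J, (-1) ^ x.1 * Ring.choose m x.1 * Ring.choose
      (n - x.1) x.2 =
      Ring.choose (n - m) J := by
  have hneg : ∀ (r : ℤ) (j : ℕ), Ring.choose (-r) j = (-1) ^ j * Ring.choose (r + j - 1) j :=
    fun r j => by
      rw [Ring.choose_neg, Units.smul_def, Int.coe_negOnePow_natCast, smul_eq_mul]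
  have h1 : ∀ x ∈ Finset.HasAntidiagonal.antidiagonal J,
      (-1) ^ x.1 * Ring.choose m x.1 * Ring.choose (n - x.1) x.2 =
        (-1) ^ J * (Ring.choose m x.1 * Ring.choose (J - n - 1) x.2) := by
    intro x hx
    have hx' := Finset.HasAntidiagonal.mem_antidiagonal.1 hx
    rw [← neg_sub (x.1 : ℤ) n, hneg, ← hx',
      show (x.1 : ℤ) - n + x.2 - 1 = ((x.1 + x.2 : ℕ) : ℤ) - n - 1 by push_cast; ring]
    ring
  rw [Finset.sum_congr rfl h1, ← Finset.mul_sum, ← Ring.add_choose_eq J (Commute.all m _),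
    ← neg_sub m n, hneg]
  congr 2
  ring

theorem sum_range_sum_antidiagonal {X : Type*} [AddCommMonoid X] {f : ℕ → ℕ → X} {B B' T : ℕ}
    (h : ∀ i j, B ≤ i ∨ B' ≤ j → f i j = 0) (hT : B + B' ≤ T) :
    ∑ r ∈ Finset.range T, ∑ x ∈ Finset.HasAntidiagonal.antidiagonal r, f x.1 x.2 =
      ∑ i ∈ Finset.range B, ∑ j ∈ Finset.range B', f i j := by
  rw [← Finset.sum_product', ← Finset.sum_fiberwise_of_maps_to
    (s := Finset.range B ×ˢ Finset.range B')
    (t := Finset.range T) (g := fun x => x.1 + x.2) fun x hx => by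
      have := Finset.mem_product.1 hx
      simp only [Finset.mem_range] at this ⊢
      omega]
  refine Finset.sum_congr rfl fun r _ => ?_
  refine (Finset.sum_subset (fun x hx => ?_) fun x hx hx' => ?_).symm
  · exact Finset.HasAntidiagonal.mem_antidiagonal.2 (Finset.mem_filter.1 hx).2
  · refine h _ _ ?_
    simp only [Finset.mem_filter, Finset.mem_product, Finset.mem_range, not_and] at hx'
    by_contra hc
    push Not at hc
    exact hx' hc (Finset.HasAntidiagonal.mem_antidiagonal.1 hx)

theorem sum_antidiagonal_shift {X : Type*} [AddCommMonoid X] {F H : ℕ → ℕ → X}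
    (hF : ∀ j, F 0 j = 0) (hH : ∀ p, H p 0 = 0) (s : ℕ) :
    ∑ x ∈ Finset.HasAntidiagonal.antidiagonal s, (F (x.1 + 1) x.2 + H x.1 (x.2 + 1)) =
      ∑ x ∈ Finset.HasAntidiagonal.antidiagonal (s + 1), (F x.1 x.2 + H x.1 x.2) := by
  rw [Finset.sum_add_distrib, Finset.sum_add_distrib,
    Finset.Nat.sum_antidiagonal_succ (f := fun x => F x.1 x.2),
    Finset.Nat.sum_antidiagonal_succ' (f := fun x => H x.1 x.2), hF, hH, zero_add, zero_add]

/-! ### `L(1)` and the modes of a Möbius vertex algebra -/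

namespace VertexAlgebra

variable {A V : Type*} [AddCommGroup A] [AddCommGroup V] [Module ℂ V] {𝒱 : VertexAlgebra A V}

theorem neg_mode_add_one (v : V) (n : ℤ) :
    𝒱.Y (𝒱.L.neg v) (n + 1) = -((n : ℂ) + 1) • 𝒱.Y v n := by
  rw [← 𝒱.derivative v (n + 1), add_sub_cancel_right]
  push_cast
  rfl

theorem mode_mem_eigenspace (hV : 𝒱.IsMobius) {u v : V} {h h' : ℤ}
    (hu : u ∈ 𝒱.L.zero.eigenspace (h : ℂ))
    (hv : v ∈ 𝒱.L.zero.eigenspace (h' : ℂ)) (n : ℤ) :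
    𝒱.Y u n v ∈ 𝒱.L.zero.eigenspace ((h + h' - n - 1 : ℤ) : ℂ) := by
  have h1 := LinearMap.congr_fun (hV.zero u n) v
  rw [Ring.lie_def, neg_mode_add_one, Module.End.mem_eigenspace_iff.1 hu] at h1
  simp only [LinearMap.sub_apply, LinearMap.add_apply, Module.End.mul_apply, map_smul,
    Module.End.mem_eigenspace_iff.1 hv, Pi.smul_apply, LinearMap.smul_apply] at h1
  rw [Module.End.mem_eigenspace_iff, sub_eq_iff_eq_add.1 h1]
  push_cast
  module

theorem pos_mode (hV : 𝒱.IsMobius) {u : V} {c : ℂ} (hu : 𝒱.L.zero u = c • u) (n : ℤ) (x : V) :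
    𝒱.L.pos (𝒱.Y u n x) = 𝒱.Y (𝒱.L.pos u) n x + (2 * c - n - 2) • 𝒱.Y u (n + 1) x +
      𝒱.Y u n (𝒱.L.pos x) := by
  have h1 := LinearMap.congr_fun (hV.pos u n) x
  rw [Ring.lie_def, show n + 2 = n + 1 + 1 by ring, neg_mode_add_one, hu] at h1
  simp only [LinearMap.sub_apply, LinearMap.add_apply, Module.End.mul_apply, map_smul,
    Pi.smul_apply, LinearMap.smul_apply] at h1
  rw [sub_eq_iff_eq_add.1 h1]
  push_cast
  module

/-- `ad(L(1))^s(u_l) / s!` for `u` of weight `h` -/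
def adPow (𝒱 : VertexAlgebra A V) (u : V) (h l : ℤ) (s : ℕ) : Module.End ℂ V :=
  ∑ x ∈ Finset.HasAntidiagonal.antidiagonal s, ((Ring.choose (2 * h - l - x.1 - 2) x.2 : ℤ) : ℂ) •
    𝒱.Y (𝒱.divPow x.1 u) (l + x.2)

/-- This recursion justifies the closed form of `adPow`: bracketing with $L(1)$ raises either $p$ or
$j$, and on level $s+1$ these account for $p+j=s+1$ copies of the summand. -/
theorem pos_adPow (hV : 𝒱.IsMobius) {u : V} {h : ℤ} (hu : u ∈ 𝒱.L.zero.eigenspace (h : ℂ)) (l : ℤ)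
    (s : ℕ) (x : V) :
    𝒱.L.pos (adPow 𝒱 u h l s x) =
      ((s : ℂ) + 1) • adPow 𝒱 u h l (s + 1) x + adPow 𝒱 u h l s (𝒱.L.pos x) := by
  have hu' := Module.End.mem_eigenspace_iff.1 hu
  rw [← sub_eq_iff_eq_add]
  let t : ℕ → ℕ → V := fun p j => 𝒱.Y (𝒱.divPow p u) (l + j) x
  let N : ℕ → ℤ := fun p => 2 * h - l - p - 2
  -- $F$ collects the terms in which $p$ was raised, whose binomial has upper index $N(p-1)=N(p)+1$.
  -- $H$ is the remainder, chosen so that $F+H$ is $p+j$ times the summand.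
  let F : ℕ → ℕ → V := fun p j => ((p * Ring.choose (N p + 1) j : ℤ) : ℂ) • t p j
  let H : ℕ → ℕ → V := fun p j =>
    (((p + j) * Ring.choose (N p) j - p * Ring.choose (N p + 1) j : ℤ) : ℂ) • t p j
  have hs := sum_antidiagonal_shift (F := F) (H := H) (fun j => by simp [F]) (fun p => by simp [H])
    s
  simp only [adPow, LinearMap.sum_apply, LinearMap.smul_apply, map_sum, map_smul]
  rw [← Finset.sum_sub_distrib, Finset.smul_sum]
  trans ∑ x ∈ Finset.HasAntidiagonal.antidiagonal s, (F (x.1 + 1) x.2 + H x.1 (x.2 + 1))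
  · refine Finset.sum_congr rfl fun y _ => ?_
    obtain ⟨p, j⟩ := y
    dsimp only
    rw [pos_mode hV (𝒱.zero_divPow hu' p), 𝒱.pos_divPow]
    have e1 : N (p + 1) + 1 = N p := by simp only [N]; push_cast; ring
    have e2 : ((p + (j + 1 : ℕ)) * Ring.choose (N p) (j + 1) - p * Ring.choose (N p + 1) (j + 1) :
        ℤ) =
        (N p - j - p) * Ring.choose (N p) j := by
      have := succ_mul_choose_succ (N p) j
      rw [Ring.choose_succ_succ]
      push_cast
      linear_combination this
    simp only [F, H, e1, e2, t]
    simp only [N, map_smul, Pi.smul_apply, LinearMap.smul_apply]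
    push_cast
    rw [show l + ((j : ℤ) + 1) = l + j + 1 by ring]
    module
  · rw [hs]
    refine Finset.sum_congr rfl fun y hy => ?_
    have hy' : (y.1 : ℂ) + y.2 = s + 1 := by exact_mod_cast
      Finset.HasAntidiagonal.mem_antidiagonal.1 hy
    simp only [F, H, t, N, ← hy']
    push_cast
    module

/-- The Leibniz rule for divided powers of the derivation $\operatorname{ad}L(1)$, by comparing
$L(1)$ of level $r$ with $r+1$ times level $r+1$. -/
theorem divPow_mode (hV : 𝒱.IsMobius) {u : V} {h : ℤ} (hu : u ∈ 𝒱.L.zero.eigenspace (h : ℂ))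
    (l : ℤ) (r : ℕ) (x : V) :
    𝒱.divPow r (𝒱.Y u l x) =
      ∑ y ∈ Finset.HasAntidiagonal.antidiagonal r, adPow 𝒱 u h l y.1 (𝒱.divPow y.2 x) := by
  induction r with
  | zero => simp [adPow, divPow_zero]
  | succ r ih =>
    have hr : (r : ℂ) + 1 ≠ 0 := by exact_mod_cast r.succ_ne_zero
    refine smul_right_injective V hr ?_
    change ((r : ℂ) + 1) • _ = ((r : ℂ) + 1) • _
    rw [← pos_divPow, ih, map_sum, Finset.smul_sum]
    let F : ℕ → ℕ → V := fun p j => (p : ℂ) • adPow 𝒱 u h l p (𝒱.divPow j x)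
    let H : ℕ → ℕ → V := fun p j => (j : ℂ) • adPow 𝒱 u h l p (𝒱.divPow j x)
    have hs := sum_antidiagonal_shift (F := F) (H := H) (fun j => by simp [F])
      (fun p => by simp [H]) r
    trans ∑ x ∈ Finset.HasAntidiagonal.antidiagonal r, (F (x.1 + 1) x.2 + H x.1 (x.2 + 1))
    · refine Finset.sum_congr rfl fun y _ => ?_
      rw [pos_adPow hV hu, pos_divPow, map_smul]
      simp only [F, H]
      push_cast
      rfl
    · rw [hs]
      refine Finset.sum_congr rfl fun y hy => ?_
      have hy' : (y.1 : ℂ) + y.2 = r + 1 := by exact_mod_cast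
        Finset.HasAntidiagonal.mem_antidiagonal.1 hy
      simp only [F, H, ← hy', add_smul]

/-- Prepares the computation of $(u_lv)^o$, where $\Phi_r$ attaches the power of $t$ belonging to
$L(1)^r/r!$. The sum over $r=p+q+j$ becomes one over independent indices. -/
theorem sum_divPow_mode (hV : 𝒱.IsMobius) {X : Type*} [AddCommGroup X] [Module ℂ X]
    (Φ : ℕ → V →ₗ[ℂ] X) {u v : V}
    {h : ℤ} (hu : u ∈ 𝒱.L.zero.eigenspace (h : ℂ)) (l : ℤ) {K B R : ℕ}
    (hK : ∀ p, K ≤ p → 𝒱.divPow p u = 0) (hK' : ∀ q, K ≤ q → 𝒱.divPow q v = 0)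
    (hB : ∀ p q j, B ≤ j → 𝒱.Y (𝒱.divPow p u) (l + (j : ℕ)) (𝒱.divPow q v) = 0)
    (hR : K + B + K ≤ R) :
    ∑ r ∈ Finset.range R, Φ r (𝒱.divPow r (𝒱.Y u l v)) =
      ∑ p ∈ Finset.range K, ∑ q ∈ Finset.range K, ∑ j ∈ Finset.range B,
        ((Ring.choose (2 * h - l - p - 2) j : ℤ) : ℂ) •
          Φ (p + q + j) (𝒱.Y (𝒱.divPow p u) (l + j) (𝒱.divPow q v)) := by
  let g : ℕ → ℕ → ℕ → X := fun q p j => ((Ring.choose (2 * h - l - p - 2) j : ℤ) : ℂ) •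
    Φ (p + q + j) (𝒱.Y (𝒱.divPow p u) (l + j) (𝒱.divPow q v))
  have hg : ∀ q p j, K ≤ p ∨ B ≤ j → g q p j = 0 := by
    rintro q p j (hp | hj)
    · simp [g, hK p hp]
    · simp [g, hB p q j hj]
  have hgq : ∀ q p j, K ≤ q → g q p j = 0 := fun q p j hq => by simp [g, hK' q hq]
  have hsum : ∀ r, Φ r (𝒱.divPow r (𝒱.Y u l v)) = ∑ y ∈ Finset.HasAntidiagonal.antidiagonal r,
      ∑ x ∈ Finset.HasAntidiagonal.antidiagonal y.1, g y.2 x.1 x.2 := fun r => by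
    rw [divPow_mode hV hu, map_sum]
    refine Finset.sum_congr rfl fun y hy => ?_
    rw [adPow, LinearMap.sum_apply, map_sum]
    refine Finset.sum_congr rfl fun x hx => ?_
    have h1 := Finset.HasAntidiagonal.mem_antidiagonal.1 hy
    have h2 := Finset.HasAntidiagonal.mem_antidiagonal.1 hx
    rw [LinearMap.smul_apply, map_smul]
    simp only [g]
    rw [show x.1 + y.2 + x.2 = r by omega]
  rw [Finset.sum_congr rfl fun r _ => hsum r,
    sum_range_sum_antidiagonal (B := K + B) (B' := K)
      (f := fun s q => ∑ x ∈ Finset.HasAntidiagonal.antidiagonal s, g q x.1 x.2) ?_ hR,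
      Finset.sum_comm]
  · rw [Finset.sum_comm (s := Finset.range K) (t := Finset.range K)]
    exact Finset.sum_congr rfl fun q _ => sum_range_sum_antidiagonal (hg q) le_rfl
  · rintro s q (hs | hq)
    · refine Finset.sum_eq_zero fun x hx => hg _ _ _ ?_
      have := Finset.HasAntidiagonal.mem_antidiagonal.1 hx
      omega
    · exact Finset.sum_eq_zero fun x _ => hgq _ _ _ hq

theorem divPow_mode_eq_zero (hV : 𝒱.IsMobius) {u v : V} {h : ℤ}
    (hu : u ∈ 𝒱.L.zero.eigenspace (h : ℂ)) (l : ℤ)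
    {K B r : ℕ} (hK : ∀ p, K ≤ p → 𝒱.divPow p u = 0) (hK' : ∀ q, K ≤ q → 𝒱.divPow q v = 0)
    (hB : ∀ p q j, B ≤ j → 𝒱.Y (𝒱.divPow p u) (l + (j : ℕ)) (𝒱.divPow q v) = 0)
    (hr : K + B + K ≤ r) : 𝒱.divPow r (𝒱.Y u l v) = 0 := by
  rw [divPow_mode hV hu]
  refine Finset.sum_eq_zero fun y hy => ?_
  rw [adPow, LinearMap.sum_apply]
  refine Finset.sum_eq_zero fun x hx => ?_
  have h1 := Finset.HasAntidiagonal.mem_antidiagonal.1 hy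
  have h2 := Finset.HasAntidiagonal.mem_antidiagonal.1 hx
  rw [LinearMap.smul_apply]
  rcases le_or_gt K y.2 with hq | hq
  · rw [hK' _ hq, map_zero, smul_zero]
  rcases le_or_gt B x.2 with hj | hj
  · rw [hB _ _ _ hj, smul_zero]
  · rw [hK x.1 (by omega), map_zero]
    simp

end VertexAlgebra

open Filter

/-! ### The Jacobi identity with finite sums -/

section JacobiSum

variable {X : Type*} [AddCommGroup X] [Module ℂ X]

/-- The difference of the two sides of the Jacobi identity, with all sums truncated at `N`; here
`P a b`, `Q a b` and `R i c` stand for `u_a v_b w`, `v_b u_a w` and `(u_{l+i} v)_c w`. -/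
def jacobiSum (P Q : ℤ → ℤ → X) (R : ℕ → ℤ → X) (l m k : ℤ) (N : ℕ) : X :=
  (∑ i ∈ Finset.range N, ((-1 : ℂ) ^ i * (Ring.choose l i : ℤ)) • P (m + l - i) (k + i)) -
    (∑ i ∈ Finset.range N, ((-1 : ℂ) ^ (l + i) * (Ring.choose l i : ℤ)) • Q (m + i) (k + l - i)) -
    ∑ i ∈ Finset.range N, ((Ring.choose m i : ℤ) : ℂ) • R i (m + k - i)

theorem jacobiSum_add (P Q P' Q' : ℤ → ℤ → X) (R R' : ℕ → ℤ → X) (l m k : ℤ) (N : ℕ) :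
    jacobiSum (fun a b => P a b + P' a b) (fun a b => Q a b + Q' a b) (fun i c => R i c + R' i c)
      l m k N = jacobiSum P Q R l m k N + jacobiSum P' Q' R' l m k N := by
  simp only [jacobiSum, smul_add, Finset.sum_add_distrib]
  abel

theorem map_jacobiSum {X' : Type*} [AddCommGroup X'] [Module ℂ X'] (φ : X →ₗ[ℂ] X')
    (P Q : ℤ → ℤ → X) (R : ℕ → ℤ → X) (l m k : ℤ) (N : ℕ) :
    φ (jacobiSum P Q R l m k N) = jacobiSum (fun a b => φ (P a b)) (fun a b => φ (Q a b))
      (fun i c => φ (R i c)) l m k N := by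
  simp only [jacobiSum, map_sub, map_sum, map_smul]

end JacobiSum

/-! ### The defect in the Jacobi identity and its truncations. -/

section Modes

variable {V W : Type*} [AddCommGroup V] [Module ℂ V] [AddCommGroup W] [Module ℂ W]

/-- The difference of the two sides of the Jacobi identity. -/
def jacobiator (YV : Modes V V) (Y : Modes V W) (u v : V) (w : W) (l m k : ℤ) : W :=
  (∑ᶠ i : ℕ, ((-1 : ℂ) ^ i * (Ring.choose l i : ℤ)) • Y u (m + l - i) (Y v (k + i) w)) -
    (∑ᶠ i : ℕ, ((-1 : ℂ) ^ (l + i) * (Ring.choose l i : ℤ)) • Y v (k + l - i) (Y u (m + i) w)) -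
    ∑ᶠ i : ℕ, ((Ring.choose m i : ℤ) : ℂ) • Y (YV u (l + i) v) (m + k - i) w

theorem jacobiIdentity_iff {YV : Modes V V} {Y : Modes V W} :
    JacobiIdentity YV Y ↔ ∀ u v w l m k, jacobiator YV Y u v w l m k = 0 := by
  simp only [JacobiIdentity, jacobiator, sub_eq_zero]

variable {YV : Modes V V} {Y : Modes V W} {u v : V} {w : W}

/-- The truncated sums in the Jacobi identity. -/
abbrev modesJacobiSum (YV : Modes V V) (Y : Modes V W) (u v : V) (w : W) (l m k : ℤ) (N : ℕ) : W :=
  jacobiSum (fun a b => Y u a (Y v b w)) (fun a b => Y v b (Y u a w))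
    (fun i c => Y (YV u (l + i) v) c w) l m k N

/-- Replacing the infinite ranges by one finite range makes the expression linear without conditions
on supports; the equality with the true defect holds for large $N$. -/
theorem eventually_jacobiSum (hYV : ∃ N : ℤ, ∀ n, N ≤ n → YV u n v = 0)
    (hu : ∃ N : ℤ, ∀ n, N ≤ n → Y u n w = 0) (hv : ∃ N : ℤ, ∀ n, N ≤ n → Y v n w = 0)
    (l m k : ℤ) :
    ∀ᶠ N in atTop, modesJacobiSum YV Y u v w l m k N = jacobiator YV Y u v w l m k := by
  obtain ⟨N₁, h₁⟩ := hYV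
  obtain ⟨N₂, h₂⟩ := hu
  obtain ⟨N₃, h₃⟩ := hv
  filter_upwards [eventually_ge_atTop ((N₁ - l).toNat + (N₂ - m).toNat + (N₃ - k).toNat)]
    with N hN
  rw [modesJacobiSum, jacobiSum, jacobiator,
    finsum_eq_sum_range (B := N) fun i hi => by rw [h₃ _ (by omega), map_zero, smul_zero],
    finsum_eq_sum_range (B := N) fun i hi => by rw [h₂ _ (by omega), map_zero, smul_zero],
    finsum_eq_sum_range (B := N) fun i hi => by
      rw [h₁ _ (by omega), map_zero, Pi.zero_apply, LinearMap.zero_apply, smul_zero]]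

theorem jacobiator_eq_zero_iff (hYV : ∃ N : ℤ, ∀ n, N ≤ n → YV u n v = 0)
    (hu : ∃ N : ℤ, ∀ n, N ≤ n → Y u n w = 0) (hv : ∃ N : ℤ, ∀ n, N ≤ n → Y v n w = 0)
    (l m k : ℤ) : jacobiator YV Y u v w l m k = 0 ↔
      ∀ᶠ N in atTop, modesJacobiSum YV Y u v w l m k N = 0 := by
  have h := eventually_jacobiSum hYV hu hv l m k
  constructor
  · intro h0
    filter_upwards [h] with N hN
    rw [hN, h0]
  · intro h0
    obtain ⟨N, h1, h2⟩ := (h.and h0).exists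
    rw [← h1, h2]

theorem jacobiIdentity_of_homogeneous {A : Type*} [AddCommGroup A] (𝒱 : VertexAlgebra A V)
    (hY : LowerTruncated Y)
    (h : ∀ (a b : ℤ), ∀ u ∈ 𝒱.L.zero.eigenspace (a : ℂ), ∀ v ∈ 𝒱.L.zero.eigenspace (b : ℂ),
      ∀ w l m k, jacobiator 𝒱.Y Y u v w l m k = 0) : JacobiIdentity 𝒱.Y Y := by
  rw [jacobiIdentity_iff]
  intro u v w l m k
  rw [jacobiator_eq_zero_iff (𝒱.truncation u v) (hY u w) (hY v w)]
  induction u using 𝒱.wt_induction with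
  | add u u' h h' =>
    filter_upwards [h, h'] with N hN hN'
    rw [← add_zero (0 : W)]
    nth_rw 1 [← hN]
    rw [← hN', ← jacobiSum_add]
    simp [modesJacobiSum]
  | mem a u hu =>
    induction v using 𝒱.wt_induction with
    | add v v' h h' =>
      filter_upwards [h, h'] with N hN hN'
      rw [← add_zero (0 : W)]
      nth_rw 1 [← hN]
      rw [← hN', ← jacobiSum_add]
      simp [modesJacobiSum]
    | mem b v hv =>
      rw [← jacobiator_eq_zero_iff (𝒱.truncation u v) (hY u w) (hY v w)]
      exact h a b u hu v hv w l m k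

end Modes

/-! ### The Jacobi identity for opposite vertex operators -/

section Opp

variable {G : Type*} [AddCommGroup G] {A : AddSubgroup G} {V : Type*} [AddCommGroup V]
  [Module ℂ V] {𝒱 : VertexAlgebra A V} {W : Type*} [AddCommGroup W] [Module ℂ W]

theorem oppMode_zero_zpow (M : GeneralizedModule 𝒱 W) {h : ℤ} {v : V}
    (hv : v ∈ 𝒱.L.zero.eigenspace (h : ℂ)) {K : ℕ}
    (hK : ∀ m, K ≤ m → 𝒱.divPow m v = 0) (n : ℤ) :
    oppMode M 0 (v ⊗ₜ[ℂ] (RatFunc.X ^ n : RatFunc ℂ)) = ∑ p ∈ Finset.range K, ((-1 : ℂ) ^ h) •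
      M.Y (𝒱.divPow p v) (-n - p - 2 + 2 * h) := by
  rw [oppMode_of_mem M 0 hv hK]
  refine Finset.sum_congr rfl fun p _ => ?_
  rw [map_zpow₀, ratInv_X, inv_zpow, ← zpow_neg, ← zpow_add₀ RatFunc.X_ne_zero,
    expansion_zero_X_zpow, tauW_single, one_smul]
  congr 2
  ring_nf

theorem sum_smul_sum_sum {X : Type*} [AddCommGroup X] [Module ℂ X] (s t r : Finset ℕ) (c : ℕ → ℂ)
    (f : ℕ → ℕ → ℕ → X) : ∑ i ∈ s, c i • ∑ p ∈ t, ∑ q ∈ r, f i p q =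
      ∑ p ∈ t, ∑ q ∈ r, ∑ i ∈ s, c i • f i p q := by
  simp only [Finset.smul_sum]
  rw [Finset.sum_comm]
  exact Finset.sum_congr rfl fun p _ => Finset.sum_comm

/-- Expand $u^o$ and $v^o$ and use the Jacobi identity of $W$ for each pair $L(1)^pu/p!$,
$L(1)^qv/q!$. Opposition interchanges the two products, and for the iterate term `sum_divPow_mode`
rewrites $(u_{l+i}v)^o$ through the same pairs. -/
theorem oppMode_jacobi (hV : 𝒱.IsMobius) (M : GeneralizedModule 𝒱 W) {u v : V} {h h' : ℤ}
    (hu : u ∈ 𝒱.L.zero.eigenspace (h : ℂ)) (hv : v ∈ 𝒱.L.zero.eigenspace (h' : ℂ)) (w : W)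
    (l m k : ℤ) : ∀ᶠ N in atTop, jacobiSum
      (fun a b => oppMode M 0 (v ⊗ₜ[ℂ] (RatFunc.X ^ b : RatFunc ℂ))
        (oppMode M 0 (u ⊗ₜ[ℂ] (RatFunc.X ^ a : RatFunc ℂ)) w))
      (fun a b => oppMode M 0 (u ⊗ₜ[ℂ] (RatFunc.X ^ a : RatFunc ℂ))
        (oppMode M 0 (v ⊗ₜ[ℂ] (RatFunc.X ^ b : RatFunc ℂ)) w))
      (fun i c => oppMode M 0 (𝒱.Y u (l + (i : ℕ)) v ⊗ₜ[ℂ] (RatFunc.X ^ c : RatFunc ℂ)) w)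
      l m k N = 0 := by
  obtain ⟨K₁, hK₁⟩ := 𝒱.exists_divPow_eq_zero u
  obtain ⟨K₂, hK₂⟩ := 𝒱.exists_divPow_eq_zero v
  obtain ⟨K, hKdef⟩ : ∃ K, K = max K₁ K₂ := ⟨_, rfl⟩
  have hK : ∀ p, K ≤ p → 𝒱.divPow p u = 0 := fun p hp => hK₁ p (by omega)
  have hK' : ∀ p, K ≤ p → 𝒱.divPow p v = 0 := fun p hp => hK₂ p (by omega)
  obtain ⟨L, hL⟩ := exists_nat_mode_eq_zero 𝒱.truncation (Finset.range K) (Finset.range K)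
    (fun p => 𝒱.divPow p u) fun q => 𝒱.divPow q v
  have hL' : ∀ (p q : ℕ) (j : ℤ), L ≤ j → 𝒱.Y (𝒱.divPow p u) j (𝒱.divPow q v) = 0 := by
    intro p q j hj
    rcases le_or_gt K p with hp | hp
    · simp [hK p hp]
    rcases le_or_gt K q with hq | hq
    · simp [hK' q hq]
    · exact hL p (by simpa using hp) q (by simpa using hq) j hj
  obtain ⟨B, hBdef⟩ : ∃ B, B = (L - l).toNat := ⟨_, rfl⟩
  have hB : ∀ (i p q j : ℕ), B ≤ i + j →
      𝒱.Y (𝒱.divPow p u) (l + i + (j : ℕ)) (𝒱.divPow q v) = 0 := fun i p q j hj =>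
    hL' p q _ (by omega)
  -- The shift by $-l$ is such that the exponents $m+l-i$ and $m+i$ become the mode indices `mu p +
  -- i` and `mu p + l - i`, and likewise for $k$ and `ka q`.
  let mu : ℕ → ℤ := fun p => -m - l - p - 2 + 2 * h
  let ka : ℕ → ℤ := fun q => -k - l - q - 2 + 2 * h'
  have hjac : ∀ p ∈ Finset.range K, ∀ q ∈ Finset.range K, ∀ᶠ N in atTop,
      modesJacobiSum 𝒱.Y M.Y (𝒱.divPow p u) (𝒱.divPow q v) w l (mu p) (ka q) N = 0 :=
    fun p _ q _ => (jacobiator_eq_zero_iff (𝒱.truncation _ _) (M.truncation _ _)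
      (M.truncation _ _) _ _ _).1 (jacobiIdentity_iff.1 M.jacobi _ _ _ _ _ _)
  simp only [← eventually_all_finset] at hjac
  filter_upwards [hjac, eventually_ge_atTop B] with N hN hBN
  let ε : ℂ := (-1) ^ h * (-1) ^ h'
  let P : ℕ → ℕ → ℤ → ℤ → W := fun p q a b =>
    M.Y (𝒱.divPow p u) a (M.Y (𝒱.divPow q v) b w)
  let Q : ℕ → ℕ → ℤ → ℤ → W := fun p q a b =>
    M.Y (𝒱.divPow q v) b (M.Y (𝒱.divPow p u) a w)
  let R : ℕ → ℕ → ℕ → ℤ → W := fun p q i c =>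
    M.Y (𝒱.Y (𝒱.divPow p u) (l + i) (𝒱.divPow q v)) c w
  have hP : ∀ a b, oppMode M 0 (v ⊗ₜ[ℂ] (RatFunc.X ^ b : RatFunc ℂ))
      (oppMode M 0 (u ⊗ₜ[ℂ] (RatFunc.X ^ a : RatFunc ℂ)) w) = ∑ p ∈ Finset.range K,
      ∑ q ∈ Finset.range K, ε • Q p q (-a - p - 2 + 2 * h) (-b - q - 2 + 2 * h') := fun a b => by
    rw [oppMode_zero_zpow M hu hK, oppMode_zero_zpow M hv hK', LinearMap.sum_apply]
    simp only [LinearMap.sum_apply, LinearMap.smul_apply, map_sum, map_smul, smul_smul, ε, Q,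
      mul_comm]
    rw [Finset.sum_comm]
  have hQ : ∀ a b, oppMode M 0 (u ⊗ₜ[ℂ] (RatFunc.X ^ a : RatFunc ℂ))
      (oppMode M 0 (v ⊗ₜ[ℂ] (RatFunc.X ^ b : RatFunc ℂ)) w) = ∑ p ∈ Finset.range K,
      ∑ q ∈ Finset.range K, ε • P p q (-a - p - 2 + 2 * h) (-b - q - 2 + 2 * h') := fun a b => by
    rw [oppMode_zero_zpow M hu hK, oppMode_zero_zpow M hv hK', LinearMap.sum_apply]
    simp only [LinearMap.sum_apply, LinearMap.smul_apply, map_sum, map_smul, smul_smul, ε, P,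
      mul_comm]
  have hneg : ∀ n : ℤ, (-1 : ℂ) ^ n * (-1) ^ n = 1 := fun n => by
    rw [← mul_zpow]; norm_num
  have hne : (-1 : ℂ) ≠ 0 := by norm_num
  have hR : ∑ i ∈ Finset.range N, ((Ring.choose m i : ℤ) : ℂ) •
      oppMode M 0 (𝒱.Y u (l + (i : ℕ)) v ⊗ₜ[ℂ] (RatFunc.X ^ (m + k - i) : RatFunc ℂ)) w =
      ∑ p ∈ Finset.range K, ∑ q ∈ Finset.range K, ∑ J ∈ Finset.range N,
        (-(ε * (-1) ^ l) * (Ring.choose (mu p) J : ℤ)) • R p q J (mu p + ka q - J) := by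
    have h1 : ∀ i : ℕ, oppMode M 0 (𝒱.Y u (l + i) v ⊗ₜ[ℂ] (RatFunc.X ^ (m + k - i) : RatFunc ℂ)) w =
        ∑ p ∈ Finset.range K, ∑ q ∈ Finset.range K, ∑ j ∈ Finset.range B,
          ((Ring.choose (2 * h - (l + i) - p - 2) j : ℤ) * (-(ε * (-1) ^ l) * (-1) ^ i) : ℂ) •
            R p q (i + j) (mu p + ka q - (i + j : ℕ)) := by
      intro i
      have hx := VertexAlgebra.mode_mem_eigenspace hV hu hv (l + i)
      rw [oppMode_zero_zpow M hx (K := K + B + K) fun r hr =>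
        VertexAlgebra.divPow_mode_eq_zero hV hu _ hK hK'
          (fun p q j hj => hB i p q j (by omega)) hr, LinearMap.sum_apply]
      have h2 := VertexAlgebra.sum_divPow_mode hV (v := v)
        (fun r => ((-1 : ℂ) ^ (h + h' - (l + i) - 1)) •
        (LinearMap.applyₗ w ∘ₗ LinearMap.proj (-(m + k - i) - r - 2 + 2 * (h + h' - (l + i) - 1)) ∘ₗ
          M.Y)) hu (l + i) hK hK' (fun p q j hj => hB i p q j (by omega)) (le_refl (K + B + K))
      refine (Finset.sum_congr rfl fun r _ => ?_).trans (h2.trans ?_)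
      · simp
      · refine Finset.sum_congr rfl fun p _ => Finset.sum_congr rfl fun q _ =>
          Finset.sum_congr rfl fun j _ => ?_
        have hs : (-1 : ℂ) ^ (h + h' - (l + i) - 1) = -(ε * (-1) ^ l) * (-1) ^ i := by
          rw [zpow_sub_one₀ hne, zpow_sub₀ hne, zpow_add₀ hne, zpow_add₀ hne, zpow_natCast,
            div_eq_mul_inv, mul_inv, ← inv_zpow, ← inv_pow]
          norm_num
          simp only [ε]
          ring_nf
        rw [LinearMap.smul_apply, smul_smul, hs]
        simp only [LinearMap.comp_apply, LinearMap.proj_apply, LinearMap.applyₗ_apply_apply, R]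
        congr 2
        simp only [mu, ka]
        push_cast
        ring_nf
    rw [Finset.sum_congr rfl fun i _ => congrArg _ (h1 i), sum_smul_sum_sum]
    refine Finset.sum_congr rfl fun p _ => Finset.sum_congr rfl fun q _ => ?_
    have hRz : ∀ J : ℕ, B ≤ J → ∀ c, R p q J c = 0 := fun J hJ c => by
      have := hB J p q 0 (by omega)
      simp only [Nat.cast_zero, add_zero] at this
      simp only [R, this, map_zero, Pi.zero_apply, LinearMap.zero_apply]
    -- Regroup by $J=i+j$, on which the mode depends. The alternating binomial sum over $i+j=J$ then
    -- collapses to $\binom{\mu_p}{J}$.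
    have h3 := sum_range_sum_antidiagonal (B := N) (B' := B) (T := N + B) (f := fun i j =>
      ((Ring.choose m i : ℤ) : ℂ) • ((Ring.choose (2 * h - (l + i) - p - 2) j : ℤ) *
        (-(ε * (-1) ^ l) * (-1) ^ i) : ℂ) • R p q (i + j) (mu p + ka q - (i + j : ℕ)))
      (fun i j hij => by rw [hRz _ (by omega), smul_zero, smul_zero]) le_rfl
    simp only [Finset.smul_sum] at h3 ⊢
    rw [← h3, Finset.sum_range_add, Finset.sum_eq_zero (s := Finset.range B) fun J _ => ?_,
      add_zero]
    · refine Finset.sum_congr rfl fun J _ => ?_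
      have h4 := sum_antidiagonal_neg_one_pow_mul_choose m (2 * h - l - p - 2) J
      rw [show 2 * h - l - p - 2 - m = mu p by simp only [mu]; ring] at h4
      rw [← h4, Int.cast_sum, Finset.mul_sum, Finset.sum_smul]
      refine Finset.sum_congr rfl fun x hx => ?_
      rw [Finset.HasAntidiagonal.mem_antidiagonal.1 hx, smul_smul,
        show 2 * h - (l + x.1) - p - 2 = 2 * h - l - p - 2 - (x.1 : ℤ) by ring]
      congr 1
      push_cast
      ring
    · refine Finset.sum_eq_zero fun x hx => ?_
      rw [hRz _ (by have := Finset.HasAntidiagonal.mem_antidiagonal.1 hx; omega), smul_zero,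
        smul_zero]
  have key : ∀ p q, jacobiSum (P p q) (Q p q) (R p q) l (mu p) (ka q) N =
      modesJacobiSum 𝒱.Y M.Y (𝒱.divPow p u) (𝒱.divPow q v) w l (mu p) (ka q) N := fun p q => rfl
  rw [jacobiSum, hR]
  simp only [hP, hQ]
  rw [sum_smul_sum_sum, sum_smul_sum_sum, ← Finset.sum_sub_distrib, ← Finset.sum_sub_distrib]
  refine Finset.sum_eq_zero fun p hp => ?_
  rw [← Finset.sum_sub_distrib, ← Finset.sum_sub_distrib]
  refine Finset.sum_eq_zero fun q hq => ?_
  have h5 := hN p hp q hq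
  rw [← key, jacobiSum] at h5
  have hl : ∀ i : ℕ, (-1 : ℂ) ^ (l + i) = (-1) ^ l * (-1) ^ i := fun i => by
    rw [zpow_add₀ hne, zpow_natCast]
  have hS₁ : ∑ i ∈ Finset.range N, ((-1 : ℂ) ^ i * (Ring.choose l i : ℤ)) •
      ε • Q p q (-(m + l - i) - p - 2 + 2 * h) (-(k + i) - q - 2 + 2 * h') =
      (ε * (-1) ^ l) • ∑ i ∈ Finset.range N, ((-1 : ℂ) ^ (l + i) * (Ring.choose l i : ℤ)) •
        Q p q (mu p + i) (ka q + l - i) := by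
    rw [Finset.smul_sum]
    refine Finset.sum_congr rfl fun i _ => ?_
    rw [smul_smul, smul_smul, hl, show -(m + l - (i : ℤ)) - p - 2 + 2 * h = mu p + i by
      simp only [mu]; ring, show -(k + (i : ℤ)) - q - 2 + 2 * h' = ka q + l - i by
      simp only [ka]; ring]
    congr 1
    linear_combination (-(ε * (-1) ^ i * (Ring.choose l i : ℤ) : ℂ)) * hneg l
  have hS₂ : ∑ i ∈ Finset.range N, ((-1 : ℂ) ^ (l + i) * (Ring.choose l i : ℤ)) •
      ε • P p q (-(m + i) - p - 2 + 2 * h) (-(k + l - i) - q - 2 + 2 * h') =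
      (ε * (-1) ^ l) • ∑ i ∈ Finset.range N, ((-1 : ℂ) ^ i * (Ring.choose l i : ℤ)) •
        P p q (mu p + l - i) (ka q + i) := by
    rw [Finset.smul_sum]
    refine Finset.sum_congr rfl fun i _ => ?_
    rw [smul_smul, smul_smul, hl, show -(m + (i : ℤ)) - p - 2 + 2 * h = mu p + l - i by
      simp only [mu]; ring, show -(k + l - (i : ℤ)) - q - 2 + 2 * h' = ka q + i by
      simp only [ka]; ring]
    congr 1
    ring
  simp only [mul_smul _ (((Ring.choose (mu p) _ : ℤ) : ℂ)), ← Finset.smul_sum]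
  -- The contribution of $(p,q)$ is $-\varepsilon(-1)^l$ times the truncated Jacobi expression of
  -- $W$, whose two products appear interchanged.
  rw [hS₁, hS₂, ← smul_zero (-(ε * (-1) ^ l)), ← h5]
  module

end Opp

/-! ### Weighted difference operators -/

section ShiftOp

variable {X Z : Type*} [AddCommGroup X] [Module ℂ X] [AddCommGroup Z] [Module ℂ Z]

/-- The operator `c ↦ (n ↦ c n - z c (n + 1))` on sequences. -/
def shiftOp (z : ℂ) (X : Type*) [AddCommGroup X] [Module ℂ X] : Module.End ℂ (ℤ → X) :=
  1 - z • LinearMap.funLeft ℂ X (· + 1)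

theorem shiftOp_apply (z : ℂ) (c : ℤ → X) (n : ℤ) : shiftOp z X c n = c n - z • c (n + 1) := rfl

theorem shiftOp_pow_succ_apply (z : ℂ) (c : ℤ → X) (P : ℕ) (n : ℤ) :
    (shiftOp z X ^ (P + 1)) c n =
      (shiftOp z X ^ P) c n - z • (shiftOp z X ^ P) c (n + 1) := by
  rw [pow_succ', Module.End.mul_apply, shiftOp_apply]

theorem shiftOp_pow_map (z : ℂ) (φ : X →ₗ[ℂ] Z) (P : ℕ) (c : ℤ → X) (n : ℤ) :
    (shiftOp z Z ^ P) (fun n => φ (c n)) n = φ ((shiftOp z X ^ P) c n) := by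
  induction P generalizing n with
  | zero => rfl
  | succ P ih => rw [shiftOp_pow_succ_apply, shiftOp_pow_succ_apply, ih, ih, map_sub, map_smul]

theorem shiftOp_pow_eval (z : ℂ) (P : ℕ) (p : ℤ → ℤ → X) (m k : ℤ) :
    (shiftOp z (ℤ → X) ^ P) p m k = (shiftOp z X ^ P) (fun m => p m k) m :=
  (shiftOp_pow_map z (LinearMap.proj (R := ℂ) (φ := fun _ : ℤ => X) k) P p m).symm

theorem shiftOp_pow_translate (z : ℂ) (P : ℕ) (c : ℤ → X) (s n : ℤ) :
    (shiftOp z X ^ P) (fun n => c (n + s)) n = (shiftOp z X ^ P) c (n + s) := by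
  induction P generalizing n with
  | zero => rfl
  | succ P ih =>
    rw [shiftOp_pow_succ_apply, shiftOp_pow_succ_apply, ih, ih, add_right_comm]

theorem eventually_zero_shiftOp_pow {z : ℂ} {c : ℤ → X} {N : ℤ} (hN : ∀ n, N ≤ n → c n = 0)
    (P : ℕ) : ∀ n, N ≤ n → (shiftOp z X ^ P) c n = 0 := by
  induction P with
  | zero => exact hN
  | succ P ih =>
    intro n hn
    rw [shiftOp_pow_succ_apply, ih n hn, ih (n + 1) (by omega), smul_zero, sub_zero]

theorem eq_zero_of_shiftOp_pow_eq_zero {z : ℂ} {c : ℤ → X} {N : ℤ} (hN : ∀ n, N ≤ n → c n = 0)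
    {P : ℕ} (h : ∀ n, (shiftOp z X ^ P) c n = 0) : ∀ n, c n = 0 := by
  induction P with
  | zero => exact h
  | succ P ih =>
    refine ih (eq_zero_of_eq_smul_succ (z := z) (fun n => ?_) (eventually_zero_shiftOp_pow hN P))
    rw [← sub_eq_zero, ← shiftOp_pow_succ_apply, h]

/-- The operator `(1 - z s₁)^P (1 - z s₂)^P` on functions of two integers, with `s₁` and `s₂` the
shifts in the two variables. -/
def biShift (z : ℂ) (X : Type*) [AddCommGroup X] [Module ℂ X] (P : ℕ) :
    Module.End ℂ (ℤ → ℤ → X) :=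
  shiftOp z (ℤ → X) ^ P * (shiftOp z X ^ P).compLeft ℤ

theorem biShift_apply (z : ℂ) (P : ℕ) (p : ℤ → ℤ → X) :
    biShift z X P p = (shiftOp z (ℤ → X) ^ P) (fun m => (shiftOp z X ^ P) (p m)) := rfl

theorem biShift_eq_zero_left {z : ℂ} {P : ℕ} {p : ℤ → ℤ → X}
    (h : ∀ k, (shiftOp z X ^ P) (fun m => p m k) = 0) : biShift z X P p = 0 := by
  rw [biShift_apply]
  have h1 : (shiftOp z (ℤ → X) ^ P) p = 0 := by
    ext m k
    rw [shiftOp_pow_eval, h k]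
    rfl
  ext m : 1
  rw [shiftOp_pow_map, h1, Pi.zero_apply, map_zero]

theorem biShift_eq_zero_right {z : ℂ} {P : ℕ} {p : ℤ → ℤ → X}
    (h : ∀ m, (shiftOp z X ^ P) (p m) = 0) : biShift z X P p = 0 := by
  rw [biShift_apply, show (fun m => (shiftOp z X ^ P) (p m)) = 0 from funext h, map_zero]

theorem biShift_translate (z : ℂ) (P : ℕ) (p : ℤ → ℤ → X) (s t : ℤ) (m k : ℤ) :
    biShift z X P (fun m k => p (m + s) (k + t)) m k = biShift z X P p (m + s) (k + t) := by
  rw [biShift_apply, biShift_apply, ← shiftOp_pow_translate z P _ s, shiftOp_pow_eval,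
    shiftOp_pow_eval]
  exact congrArg (fun c => (shiftOp z X ^ P) c m)
    (funext fun m => shiftOp_pow_translate z P (p (m + s)) t k)

/-- The product terms are combinations, with coefficients independent of $m$ and $k$, of translates
of $p$ and $q$, and the difference operators commute with translations. The coefficients of the
iterate term depend on $m$, but at fixed $m$ it is a translate of $R_i$ in $k$, so the operator in
$k$ alone kills it. -/
theorem biShift_jacobiSum {z : ℂ} {P : ℕ} {p q : ℤ → ℤ → X} {R : ℕ → ℤ → X}
    (hp : biShift z X P p = 0) (hq : biShift z X P q = 0) (hR : ∀ i, (shiftOp z X ^ P) (R i) = 0)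
    (l : ℤ) (N : ℕ) : biShift z X P (fun m k => jacobiSum p q R l m k N) = 0 := by
  have e : (fun m k => jacobiSum p q R l m k N) =
      (∑ i ∈ Finset.range N, ((-1 : ℂ) ^ i * (Ring.choose l i : ℤ)) •
        fun m k => p (m + (l - i)) (k + i)) -
      (∑ i ∈ Finset.range N, ((-1 : ℂ) ^ (l + i) * (Ring.choose l i : ℤ)) •
        fun m k => q (m + i) (k + (l - i))) -
      ∑ i ∈ Finset.range N, fun m k => ((Ring.choose m i : ℤ) : ℂ) • R i (k + (m - i)) := by
    ext m k
    simp only [jacobiSum, Pi.sub_apply, Finset.sum_apply, Pi.smul_apply, add_sub_assoc,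
      add_sub_left_comm m k]
  rw [e, map_sub, map_sub, map_sum, map_sum, map_sum, Finset.sum_eq_zero, Finset.sum_eq_zero,
    Finset.sum_eq_zero, sub_zero, sub_zero]
  · intro i _
    refine biShift_eq_zero_right fun m => ?_
    ext k
    have h1 := shiftOp_pow_map z (((Ring.choose m i : ℤ) : ℂ) • (LinearMap.id : X →ₗ[ℂ] X)) P
      (fun k => R i (k + (m - i))) k
    rw [shiftOp_pow_translate, hR, Pi.zero_apply, map_zero] at h1
    exact h1
  · intro i _
    rw [map_smul]
    ext m k
    rw [Pi.smul_apply, Pi.smul_apply, biShift_translate, hq]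
    simp
  · intro i _
    rw [map_smul]
    ext m k
    rw [Pi.smul_apply, Pi.smul_apply, biShift_translate, hp]
    simp

theorem biShift_eventually {z : ℂ} {P : ℕ} {a : ℤ → ℤ → X} {b : ℕ → ℤ → ℤ → X}
    (h : ∀ m k, ∀ᶠ N in atTop, b N m k = a m k) (m k : ℤ) :
    ∀ᶠ N in atTop, biShift z X P (b N) m k = biShift z X P a m k := by
  have h1 : ∀ (P : ℕ) (m k : ℤ), ∀ᶠ N in atTop,
      (shiftOp z X ^ P) (b N m) k = (shiftOp z X ^ P) (a m) k := by
    intro P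
    induction P with
    | zero => exact h
    | succ P ih =>
      intro m k
      filter_upwards [ih m k, ih m (k + 1)] with N h₁ h₂
      rw [shiftOp_pow_succ_apply, shiftOp_pow_succ_apply, h₁, h₂]
  have h2 : ∀ (P' : ℕ) (m k : ℤ), ∀ᶠ N in atTop,
      (shiftOp z (ℤ → X) ^ P') (fun m => (shiftOp z X ^ P) (b N m)) m k =
        (shiftOp z (ℤ → X) ^ P') (fun m => (shiftOp z X ^ P) (a m)) m k := by
    intro P'
    induction P' with
    | zero => exact h1 P
    | succ P' ih =>
      intro m k
      filter_upwards [ih m k, ih (m + 1) k] with N h₁ h₂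
      rw [shiftOp_pow_succ_apply, shiftOp_pow_succ_apply, Pi.sub_apply, Pi.sub_apply,
        Pi.smul_apply, Pi.smul_apply, h₁, h₂]
  exact h2 P m k

/-- Cancel the factor in $m$ at fixed $k$, then the factor in $k$ at fixed $m$. The bounds may
depend on the other variable, since a power of the operator in $k$ involves only finitely many
values of $k$. -/
theorem eq_zero_of_biShift_eq_zero {z : ℂ} {P : ℕ} {a : ℤ → ℤ → X} (h : biShift z X P a = 0)
    (hm : ∀ k, ∃ N, ∀ m, N ≤ m → a m k = 0) (hk : ∀ m, ∃ N, ∀ k, N ≤ k → a m k = 0) (m k : ℤ) :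
    a m k = 0 := by
  obtain ⟨N, hN⟩ := hk m
  refine eq_zero_of_shiftOp_pow_eq_zero (z := z) (P := P) hN (fun k => ?_) k
  have h1 : ∀ (P : ℕ) (k : ℤ), ∃ N, ∀ m, N ≤ m → (shiftOp z X ^ P) (a m) k = 0 := by
    intro P
    induction P with
    | zero => exact hm
    | succ P ih =>
      intro k
      obtain ⟨N₁, h₁⟩ := ih k
      obtain ⟨N₂, h₂⟩ := ih (k + 1)
      refine ⟨max N₁ N₂, fun m hm => ?_⟩
      rw [shiftOp_pow_succ_apply, h₁ m (le_of_max_le_left hm), h₂ m (le_of_max_le_right hm),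
        smul_zero, sub_zero]
  obtain ⟨N', hN'⟩ := h1 P k
  refine eq_zero_of_shiftOp_pow_eq_zero (z := z) (P := P)
    (c := fun m => (shiftOp z X ^ P) (a m) k) hN' (fun m => ?_) m
  have h2 := shiftOp_pow_map z (LinearMap.proj (R := ℂ) (φ := fun _ : ℤ => X) k) P
    (fun m => (shiftOp z X ^ P) (a m)) m
  simp only [LinearMap.proj_apply] at h2
  rw [h2, ← biShift_apply, h]
  rfl

end ShiftOp

/-! ### Vanishing of the Jacobi defect for large exponents. -/

section Modes

variable {V W : Type*} [AddCommGroup V] [Module ℂ V] [AddCommGroup W] [Module ℂ W]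
  {YV : Modes V V} {Y : Modes V W}

/-- For fixed $k$ and large $m$: $u$ acting first kills $w$; only finitely many $v_{k+i}w$ are
nonzero, and `h₂` truncates $u$ on each; and only finitely many $u_{l+i}v$ are nonzero. The case of
fixed $m$ is symmetric. -/
theorem jacobiator_eventually_zero (hYV : LowerTruncated YV) {w : W}
    (h₁ : ∀ x, ∃ N : ℤ, ∀ n, N ≤ n → Y x n w = 0)
    (h₂ : ∀ x y n, ∃ N : ℤ, ∀ m, N ≤ m → Y x m (Y y n w) = 0) (u v : V) (l : ℤ) :
    (∀ k, ∃ N : ℤ, ∀ m, N ≤ m → jacobiator YV Y u v w l m k = 0) ∧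
      ∀ m, ∃ N : ℤ, ∀ k, N ≤ k → jacobiator YV Y u v w l m k = 0 := by
  obtain ⟨Nu, hu⟩ := h₁ u
  obtain ⟨Nv, hv⟩ := h₁ v
  obtain ⟨N₀, h₀⟩ := hYV u v
  obtain ⟨N₃, h₃⟩ := exists_forall_mem_int (Finset.range (N₀ - l).toNat)
    (fun i n => Y (YV u (l + i) v) n w = 0) fun i _ => h₁ _
  have hR : ∀ m k : ℤ, N₃ + (N₀ - l).toNat ≤ m + k →
      ∀ i : ℕ, ((Ring.choose m i : ℤ) : ℂ) • Y (YV u (l + i) v) (m + k - i) w = 0 := by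
    intro m k h i
    by_cases hi : i < (N₀ - l).toNat
    · rw [h₃ i (by simpa using hi) _ (by omega), smul_zero]
    · rw [h₀ _ (by omega), map_zero, Pi.zero_apply, LinearMap.zero_apply, smul_zero]
  constructor
  · intro k
    obtain ⟨N₁, h₁⟩ := exists_forall_mem_int (Finset.range (Nv - k).toNat)
      (fun i n => Y u n (Y v (k + i) w) = 0) fun i _ => h₂ _ _ _
    refine ⟨max (max Nu (N₁ - l + (Nv - k).toNat)) (N₃ + (N₀ - l).toNat - k), fun m hm => ?_⟩
    rw [jacobiator, finsum_eq_zero_of_forall_eq_zero fun i => ?_,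
      finsum_eq_zero_of_forall_eq_zero fun i => ?_,
      finsum_eq_zero_of_forall_eq_zero (hR m k (by omega)), sub_zero, sub_zero]
    · rw [hu _ (by omega), map_zero, smul_zero]
    · by_cases hi : i < (Nv - k).toNat
      · rw [h₁ i (by simpa using hi) _ (by omega), smul_zero]
      · rw [hv _ (by omega), map_zero, smul_zero]
  · intro m
    obtain ⟨N₁, h₁⟩ := exists_forall_mem_int (Finset.range (Nu - m).toNat)
      (fun i n => Y v n (Y u (m + i) w) = 0) fun i _ => h₂ _ _ _
    refine ⟨max (max Nv (N₁ - l + (Nu - m).toNat)) (N₃ + (N₀ - l).toNat - m), fun k hk => ?_⟩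
    rw [jacobiator, finsum_eq_zero_of_forall_eq_zero fun i => ?_,
      finsum_eq_zero_of_forall_eq_zero fun i => ?_,
      finsum_eq_zero_of_forall_eq_zero (hR m k (by omega)), sub_zero, sub_zero]
    · by_cases hi : i < (Nu - m).toNat
      · rw [h₁ i (by simpa using hi) _ (by omega), smul_zero]
      · rw [hu _ (by omega), map_zero, smul_zero]
    · rw [hv _ (by omega), map_zero, smul_zero]

end Modes

/-! ### The Jacobi identity on the dual space -/

section Dual

variable {G : Type*} [AddCommGroup G] {A : AddSubgroup G} {V : Type*} [AddCommGroup V]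
  [Module ℂ V] {𝒱 : VertexAlgebra A V} {W : Type*} [AddCommGroup W] [Module ℂ W]
  {W₁ : Type*} [AddCommGroup W₁] [Module ℂ W₁] {W₂ : Type*} [AddCommGroup W₂] [Module ℂ W₂]

/-- Shifting $n$ is multiplication by $t$, so the difference operator is multiplication by $1-zt$.
-/
theorem shiftOp_pow_oppMode (M : GeneralizedModule 𝒱 W) (z : ℂ) (x : V) (w : W) (Q : ℕ) (n : ℤ) :
    (shiftOp z W ^ Q) (fun n => oppMode M z (x ⊗ₜ[ℂ] (RatFunc.X ^ n : RatFunc ℂ)) w) n =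
      oppMode M z (x ⊗ₜ[ℂ] (RatFunc.X ^ n * (1 - RatFunc.C z * RatFunc.X) ^ Q : RatFunc ℂ)) w := by
  induction Q generalizing n with
  | zero => simp
  | succ Q ih =>
    rw [shiftOp_pow_succ_apply, ih, ih, ← LinearMap.smul_apply, ← map_smul,
      ← TensorProduct.tmul_smul, ← LinearMap.sub_apply, ← map_sub, ← TensorProduct.tmul_sub,
      RatFunc.smul_eq_C_mul, zpow_add_one₀ RatFunc.X_ne_zero]
    congr 4
    ring

theorem expansion_C (a b : ℂ) : expansion a (RatFunc.C b) = HahnSeries.C b := by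
  change iotaPlusHom (ratShift a (RatFunc.C b)) = _
  rw [← RatFunc.algebraMap_eq_C, AlgHom.commutes, RatFunc.algebraMap_eq_C, iotaPlusHom_C]

/-- Under $t\mapsto t^{-1}$ the factor $(1-zt)^Q$ becomes $t^{-Q}(t-z)^Q$. As $z\ne0$, powers of $t$
expanded about $z$ have no negative part, so the whole expansion has order at least $Q$ and kills
$w$ for large $Q$. -/
theorem exists_shiftOp_pow_oppMode_eq_zero (M : GeneralizedModule 𝒱 W) {z : ℂ} (hz : z ≠ 0)
    (x : V) (w : W) : ∃ P : ℕ, ∀ Q, P ≤ Q →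
      (shiftOp z W ^ Q) (fun n => oppMode M z (x ⊗ₜ[ℂ] (RatFunc.X ^ n : RatFunc ℂ)) w) = 0 := by
  induction x using 𝒱.wt_induction with
  | add x y hx hy =>
    obtain ⟨P, hP⟩ := hx
    obtain ⟨P', hP'⟩ := hy
    refine ⟨max P P', fun Q hQ => ?_⟩
    have : (fun n : ℤ => oppMode M z ((x + y) ⊗ₜ[ℂ] (RatFunc.X ^ n : RatFunc ℂ)) w) =
        (fun n : ℤ => oppMode M z (x ⊗ₜ[ℂ] (RatFunc.X ^ n : RatFunc ℂ)) w) +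
          fun n : ℤ => oppMode M z (y ⊗ₜ[ℂ] (RatFunc.X ^ n : RatFunc ℂ)) w := by
      ext n
      rw [TensorProduct.add_tmul, map_add]
      rfl
    rw [this, map_add, hP Q (le_of_max_le_left hQ), hP' Q (le_of_max_le_right hQ), add_zero]
  | mem h x hx =>
    obtain ⟨K, hK⟩ := 𝒱.exists_divPow_eq_zero x
    obtain ⟨N, hN⟩ := exists_forall_mem_int (Finset.range K)
      (fun p n => M.Y (𝒱.divPow p x) n w = 0) fun p _ => M.truncation _ _
    refine ⟨N.toNat, fun Q hQ => ?_⟩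
    ext n
    rw [shiftOp_pow_oppMode, oppMode_of_mem M z hx hK, LinearMap.sum_apply, Pi.zero_apply]
    refine Finset.sum_eq_zero fun p hp => ?_
    have hX := RatFunc.X_ne_zero (K := ℂ)
    have e : (RatFunc.X ^ (-(p : ℤ) - 2 + 2 * h) *
        ratInv (RatFunc.X ^ n * (1 - RatFunc.C z * RatFunc.X) ^ Q) : RatFunc ℂ) =
        RatFunc.X ^ (-(p : ℤ) - 2 + 2 * h - n - Q) * (RatFunc.X - RatFunc.C z) ^ Q := by
      rw [map_mul, map_zpow₀, map_pow, map_sub, map_mul, map_one, ratInv_X,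
        ← RatFunc.algebraMap_eq_C, AlgHom.commutes, RatFunc.algebraMap_eq_C,
        show (1 - RatFunc.C z * RatFunc.X⁻¹ : RatFunc ℂ) =
            RatFunc.X⁻¹ * (RatFunc.X - RatFunc.C z) by
          field_simp, mul_pow, zpow_sub₀ hX _ (Q : ℤ), zpow_sub₀ hX _ n, zpow_natCast, inv_zpow,
        inv_pow]
      ring
    rw [LinearMap.smul_apply, tauW_eq_zero M.truncation (hN p hp) fun j hj => ?_, smul_zero]
    rw [e, map_mul, map_pow, map_sub, expansion_X, expansion_C, add_sub_cancel_right]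
    refine coeff_mul_eq_zero_of_lt (expansion_X_zpow_coeff hz _) (b := Q) (fun i hi => ?_) j
      (by omega)
    rw [HahnSeries.single_pow, HahnSeries.coeff_single_of_ne]
    simp
    omega

variable {M₁ : GeneralizedModule 𝒱 W₁} {M₂ : GeneralizedModule 𝒱 W₂} {z : ℂ}

theorem YP_YP_apply (u v : V) (a b : ℤ) (lam : TDual W₁ W₂) (w₁ : W₁) (w₂ : W₂) :
    YP M₁ M₂ z u a (YP M₁ M₂ z v b lam) (w₁ ⊗ₜ w₂) =
      lam (oppMode M₁ z (v ⊗ₜ[ℂ] (RatFunc.X ^ b : RatFunc ℂ))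
        (oppMode M₁ z (u ⊗ₜ[ℂ] (RatFunc.X ^ a : RatFunc ℂ)) w₁) ⊗ₜ w₂) +
      lam (oppMode M₁ z (u ⊗ₜ[ℂ] (RatFunc.X ^ a : RatFunc ℂ)) w₁ ⊗ₜ
        oppMode M₂ 0 (v ⊗ₜ[ℂ] (RatFunc.X ^ b : RatFunc ℂ)) w₂) +
      lam (oppMode M₁ z (v ⊗ₜ[ℂ] (RatFunc.X ^ b : RatFunc ℂ)) w₁ ⊗ₜ
        oppMode M₂ 0 (u ⊗ₜ[ℂ] (RatFunc.X ^ a : RatFunc ℂ)) w₂) +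
      lam (w₁ ⊗ₜ oppMode M₂ 0 (v ⊗ₜ[ℂ] (RatFunc.X ^ b : RatFunc ℂ))
        (oppMode M₂ 0 (u ⊗ₜ[ℂ] (RatFunc.X ^ a : RatFunc ℂ)) w₂)) := by
  rw [YP_apply, YP_apply, tauP_apply, tauP_apply, tauP_apply]
  ring

/-- The pairing of `λ` with `w₁ ⊗ w₂`, with the operator `σ₁` applied to `w₁` before `B` and
with `C` applied to `w₂`, is annihilated by a power of the difference operator. -/
theorem shiftOp_pow_pairing {P : ℕ} {c : ℤ → W₁} (hc : (shiftOp z W₁ ^ P) c = 0)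
    (lam : TDual W₁ W₂) (B : Module.End ℂ W₁) (w : W₂) :
    (shiftOp z ℂ ^ P) (fun n => lam (B (c n) ⊗ₜ w)) = 0 := by
  ext n
  have h := shiftOp_pow_map z (lam ∘ₗ (TensorProduct.mk ℂ W₁ W₂).flip w ∘ₗ B) P c n
  rw [hc, Pi.zero_apply, map_zero] at h
  exact h

theorem jacobiator_YP (hV : 𝒱.IsMobius) (hz : z ≠ 0) {lam : TDual W₁ W₂}
    (hlam : lam ∈ compSubmodule M₁ M₂ z) {u v : V} {h h' : ℤ}
    (hu : u ∈ 𝒱.L.zero.eigenspace (h : ℂ)) (hv : v ∈ 𝒱.L.zero.eigenspace (h' : ℂ)) (l m k : ℤ) :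
    jacobiator 𝒱.Y (YP M₁ M₂ z) u v lam l m k = 0 := by
  refine TensorProduct.ext' fun w₁ w₂ => ?_
  rw [LinearMap.zero_apply]
  let s₁ (x : V) (n : ℤ) : Module.End ℂ W₁ := oppMode M₁ z (x ⊗ₜ[ℂ] (RatFunc.X ^ n : RatFunc ℂ))
  let s₂ (x : V) (n : ℤ) : Module.End ℂ W₂ := oppMode M₂ 0 (x ⊗ₜ[ℂ] (RatFunc.X ^ n : RatFunc ℂ))
  obtain ⟨N₀, hN₀⟩ := 𝒱.truncation u v
  -- One power serves for all $i$, because $u_{l+i}v=0$ for $i\ge N_0-l$.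
  obtain ⟨P, hPu, hPv, hPR⟩ : ∃ P : ℕ, (shiftOp z W₁ ^ P) (fun n => s₁ u n w₁) = 0 ∧
      (shiftOp z W₁ ^ P) (fun n => s₁ v n w₁) = 0 ∧
      ∀ i : ℕ, (shiftOp z W₁ ^ P) (fun n => s₁ (𝒱.Y u (l + i) v) n w₁) = 0 := by
    obtain ⟨P₁, h₁⟩ := exists_shiftOp_pow_oppMode_eq_zero M₁ hz u w₁
    obtain ⟨P₂, h₂⟩ := exists_shiftOp_pow_oppMode_eq_zero M₁ hz v w₁
    obtain ⟨P₃, h₃⟩ := exists_forall_mem_int (Finset.range (N₀ - l).toNat)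
      (fun i n => (shiftOp z W₁ ^ n.toNat) (fun n => s₁ (𝒱.Y u (l + i) v) n w₁) = 0) fun i _ => by
        obtain ⟨P₃, h₃⟩ := exists_shiftOp_pow_oppMode_eq_zero M₁ hz (𝒱.Y u (l + i) v) w₁
        exact ⟨P₃, fun n hn => h₃ _ (by omega)⟩
    refine ⟨max (max P₁ P₂) P₃.toNat, h₁ _ (by omega), h₂ _ (by omega), fun i => ?_⟩
    by_cases hi : i < (N₀ - l).toNat
    · exact h₃ i (by simpa using hi) ((max (max P₁ P₂) P₃.toNat : ℕ) : ℤ) (by omega)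
    · rw [hN₀ _ (by omega)]
      simp only [s₁, TensorProduct.zero_tmul, map_zero, LinearMap.zero_apply]
      exact map_zero _
  have htr := jacobiator_eventually_zero 𝒱.truncation (YP_truncated hlam)
    (fun x y n => YP_truncated (YP_mem_compSubmodule hlam y n) x) u v l
  -- These are the matrix coefficients without the term in which all operators act on $w_2$; that
  -- part cancels by `oppMode_jacobi`.
  let p : ℤ → ℤ → ℂ := fun a b => lam (s₁ v b (s₁ u a w₁) ⊗ₜ w₂) + lam (s₁ u a w₁ ⊗ₜ s₂ v b w₂) +
    lam (s₁ v b w₁ ⊗ₜ s₂ u a w₂)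
  let q : ℤ → ℤ → ℂ := fun a b => lam (s₁ u a (s₁ v b w₁) ⊗ₜ w₂) + lam (s₁ v b w₁ ⊗ₜ s₂ u a w₂) +
    lam (s₁ u a w₁ ⊗ₜ s₂ v b w₂)
  let R : ℕ → ℤ → ℂ := fun i c => lam (s₁ (𝒱.Y u (l + i) v) c w₁ ⊗ₜ w₂)
  have hid : ∀ {c : ℤ → W₁}, (shiftOp z W₁ ^ P) c = 0 → ∀ w,
      (shiftOp z ℂ ^ P) (fun n => lam (c n ⊗ₜ w)) = 0 := fun hc w =>
    shiftOp_pow_pairing hc lam 1 w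
  have hp : biShift z ℂ P p = 0 := by
    have e : p = (fun a b => lam (s₁ v b (s₁ u a w₁) ⊗ₜ w₂)) +
      (fun a b => lam (s₁ u a w₁ ⊗ₜ s₂ v b w₂)) + fun a b => lam (s₁ v b w₁ ⊗ₜ s₂ u a w₂) := rfl
    rw [e, map_add, map_add, biShift_eq_zero_left fun b => shiftOp_pow_pairing hPu lam (s₁ v b) w₂,
      biShift_eq_zero_left fun b => hid hPu (s₂ v b w₂),
      biShift_eq_zero_right fun a => hid hPv (s₂ u a w₂), add_zero, add_zero]
  have hq : biShift z ℂ P q = 0 := by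
    have e : q = (fun a b => lam (s₁ u a (s₁ v b w₁) ⊗ₜ w₂)) +
      (fun a b => lam (s₁ v b w₁ ⊗ₜ s₂ u a w₂)) + fun a b => lam (s₁ u a w₁ ⊗ₜ s₂ v b w₂) := rfl
    rw [e, map_add, map_add, biShift_eq_zero_right fun a => shiftOp_pow_pairing hPv lam (s₁ u a) w₂,
      biShift_eq_zero_right fun a => hid hPv (s₂ u a w₂),
      biShift_eq_zero_left fun b => hid hPu (s₂ v b w₂), add_zero, add_zero]
  have hlim : ∀ m k, ∀ᶠ N in atTop, jacobiSum p q R l m k N =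
      jacobiator 𝒱.Y (YP M₁ M₂ z) u v lam l m k (w₁ ⊗ₜ w₂) := fun m k => by
    filter_upwards [eventually_jacobiSum (𝒱.truncation u v) (YP_truncated hlam u)
      (YP_truncated hlam v) l m k, oppMode_jacobi hV M₂ hu hv w₂ l m k] with N h₁ h₂
    have h₃ := map_jacobiSum (lam ∘ₗ TensorProduct.mk ℂ W₁ W₂ w₁) (fun a b => s₂ v b (s₂ u a w₂))
      (fun a b => s₂ u a (s₂ v b w₂)) (fun i c => s₂ (𝒱.Y u (l + (i : ℕ)) v) c w₂) l m k N
    rw [h₂, map_zero] at h₃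
    rw [← h₁, ← LinearMap.applyₗ_apply_apply (R := ℂ) (w₁ ⊗ₜ[ℂ] w₂), map_jacobiSum,
      ← add_zero (jacobiSum p q R l m k N), h₃, ← jacobiSum_add]
    simp only [LinearMap.applyₗ_apply_apply, YP_YP_apply, LinearMap.comp_apply,
      TensorProduct.mk_apply, p, q, R, s₁, s₂, YP_apply _ _ _ (𝒱.Y _ _ _), tauP_apply]
  refine eq_zero_of_biShift_eq_zero (P := P) (z := z)
    (a := fun m k => jacobiator 𝒱.Y (YP M₁ M₂ z) u v lam l m k (w₁ ⊗ₜ w₂)) ?_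
    (fun k => ?_) (fun m => ?_) m k
  · ext m k
    obtain ⟨N, hN⟩ := (biShift_eventually (z := z) (P := P) hlim m k).exists
    rw [← hN, biShift_jacobiSum hp hq (fun i => hid (hPR i) w₂)]
  · obtain ⟨N, hN⟩ := htr.1 k
    exact ⟨N, fun m hm => by rw [hN m hm, LinearMap.zero_apply]⟩
  · obtain ⟨N, hN⟩ := htr.2 m
    exact ⟨N, fun k hk => by rw [hN k hk, LinearMap.zero_apply]⟩

/-- The Jacobi identity holds on every stable subspace of the space of compatible functionals. -/
theorem jacobiIdentity_restrict (hV : 𝒱.IsMobius) (hz : z ≠ 0) {S : Submodule ℂ (TDual W₁ W₂)}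
    (hS : S ≤ compSubmodule M₁ M₂ z) (hY : ∀ v n, ∀ x ∈ S, YP M₁ M₂ z v n x ∈ S) :
    JacobiIdentity 𝒱.Y ((YP M₁ M₂ z).restrict S hY) := by
  refine jacobiIdentity_of_homogeneous 𝒱 (fun v x => ?_) fun a b u hu v hv x l m k => ?_
  · obtain ⟨N, hN⟩ := YP_truncated (hS x.2) v
    exact ⟨N, fun n hn => Subtype.ext (hN n hn)⟩
  · have hi : Function.Injective S.subtype.toAddMonoidHom := Subtype.val_injective
    refine hi ?_
    rw [map_zero, ← jacobiator_YP hV hz (hS x.2) hu hv l m k, jacobiator, jacobiator, map_sub,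
      map_sub, AddMonoidHom.map_finsum_of_injective _ hi, AddMonoidHom.map_finsum_of_injective _ hi,
      AddMonoidHom.map_finsum_of_injective _ hi]
    rfl

end Dual

/-! ### The vacuum property and the derivative property -/

section Modes

variable {A V W : Type*} [AddCommGroup A] [AddCommGroup V] [Module ℂ V] [AddCommGroup W]
  [Module ℂ W] (𝒱 : VertexAlgebra A V)

theorem VertexAlgebra.neg_eq_mode (v : V) : 𝒱.L.neg v = 𝒱.Y v (-2) 𝒱.vac := by
  have h := LinearMap.congr_fun (𝒱.derivative v (-1)) 𝒱.vac
  rw [(𝒱.creation _).2] at h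
  simpa using h.symm

theorem neg_one_pow_mul_choose_neg_two (i : ℕ) :
    (-1 : ℂ) ^ i * (Ring.choose (-2 : ℤ) i : ℤ) = i + 1 := by
  rw [Ring.choose_neg', Ring.multichoose_two, Int.negOnePow_def, Units.smul_def, zpow_natCast]
  push_cast
  rw [smul_eq_mul]
  push_cast
  rw [← mul_assoc, ← mul_pow]
  simp

/-- The derivative property follows from the vacuum property and the Jacobi identity. -/
theorem derivativeProperty_of_jacobi {Y : Modes V W} (hvac : VacuumProperty 𝒱.vac Y)
    (hJ : JacobiIdentity 𝒱.Y Y) : DerivativeProperty 𝒱.L.neg Y := by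
  intro v k
  ext w
  -- These values make the iterate term $(v_{-2}\mathbf 1)_k=(L(-1)v)_k$. On the other side only one
  -- term survives, in the first sum for $k<0$ and in the second for $k>0$; there is none for $k=0$.
  have h := hJ v 𝒱.vac w (-2) 0 k
  have hs : ∀ i : ℕ, (-1 : ℂ) ^ ((-2 : ℤ) + i) = (-1) ^ i := fun i => by
    rw [zpow_add₀ (by norm_num), zpow_natCast]
    norm_num
  simp only [hs, neg_one_pow_mul_choose_neg_two] at h
  rw [finsum_eq_single (fun i : ℕ => ((Ring.choose (0 : ℤ) i : ℤ) : ℂ) • _) 0 fun i hi => by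
    rw [Ring.choose_zero_pos ℤ (Nat.pos_of_ne_zero hi)]; simp] at h
  simp only [Ring.choose_zero_right, Int.cast_one, one_smul, Nat.cast_zero, add_zero, sub_zero,
    zero_add, ← 𝒱.neg_eq_mode] at h
  rw [← h, LinearMap.smul_apply]
  have hY : ∀ n w, Y 𝒱.vac n w = if n = -1 then w else 0 := fun n w => by
    rw [hvac]
    split_ifs <;> rfl
  simp only [hY]
  rcases lt_trichotomy k 0 with hk | rfl | hk
  · rw [finsum_eq_single _ (-1 - k).toNat fun i hi => ?_,
      finsum_eq_zero_of_forall_eq_zero fun i => ?_, if_pos (by omega), sub_zero]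
    · congr 2
      · have : (((-1 - k).toNat : ℤ) : ℂ) = ((-1 - k : ℤ) : ℂ) := by
          rw [Int.toNat_of_nonneg (by omega)]
        push_cast at this ⊢
        linear_combination -this
      · exact congrArg (Y v) (show k - 1 = -2 - ((-1 - k).toNat : ℤ) by omega)
    · rw [if_neg (by omega), smul_zero]
    · rw [if_neg (by omega), map_zero, smul_zero]
  · rw [finsum_eq_zero_of_forall_eq_zero fun i => ?_, finsum_eq_zero_of_forall_eq_zero fun i => ?_]
    · simp
    · rw [if_neg (by omega), smul_zero]
    · rw [if_neg (by omega), map_zero, smul_zero]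
  · rw [finsum_eq_zero_of_forall_eq_zero fun i => ?_,
      finsum_eq_single _ (k - 1).toNat fun i hi => ?_,
      if_pos (by omega), zero_sub, neg_smul]
    · congr 2
      · have : (((k - 1).toNat : ℤ) : ℂ) = ((k - 1 : ℤ) : ℂ) := by
          rw [Int.toNat_of_nonneg (by omega)]
        push_cast at this ⊢
        linear_combination -this
      · exact congrArg (fun n => Y v n w) (by omega)
    · rw [if_neg (by omega), smul_zero]
    · rw [if_neg (by omega), map_zero, smul_zero]

variable {𝒱}

/-- As $\mathbf 1_{-1}$ is the identity, its bracket with $L(1)$ vanishes, which gives $(L(1)\mathbf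
1)_{-1}=0$; apply this to $\mathbf 1$. -/
theorem VertexAlgebra.pos_vac (hV : 𝒱.IsMobius) : 𝒱.L.pos 𝒱.vac = 0 := by
  have h0 : 𝒱.L.zero 𝒱.vac = 0 := by
    simpa using Module.End.mem_eigenspace_iff.1 𝒱.vac_mem.1
  have h1 : ∀ n, 𝒱.Y (𝒱.L.neg 𝒱.vac) n = 0 := fun n => by
    rw [← 𝒱.derivative, 𝒱.vacuum]
    split_ifs with h
    · rw [show n = 0 by omega]
      simp
    · rw [smul_zero]
  have h := hV.pos 𝒱.vac (-1)
  rw [h0, h1, 𝒱.vacuum, if_pos rfl, map_zero, Ring.lie_def, mul_one, one_mul, sub_self] at h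
  rw [← (𝒱.creation (𝒱.L.pos 𝒱.vac)).2]
  simp only [Pi.zero_apply, smul_zero, add_zero] at h
  rw [← h, LinearMap.zero_apply]

end Modes

/-! ### Vacuum property on the dual space, and weak modules from stable subspaces. -/

section Dual

variable {G : Type*} [AddCommGroup G] {A : AddSubgroup G} {V : Type*} [AddCommGroup V]
  [Module ℂ V] {𝒱 : VertexAlgebra A V}
  {W₁ : Type*} [AddCommGroup W₁] [Module ℂ W₁] {W₂ : Type*} [AddCommGroup W₂] [Module ℂ W₂]
  {M₁ : GeneralizedModule 𝒱 W₁} {M₂ : GeneralizedModule 𝒱 W₂} {z : ℂ}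

/-- Here $\mathbf 1^o=\mathbf 1\otimes t^{-2}$, and only the coefficient of $t^{-1}$ acts. On $W_2$
it occurs exactly for $n=-1$; on $W_1$ the expansion about $z\ne0$ has no negative powers. -/
theorem YP_vacuum (hV : 𝒱.IsMobius) (hz : z ≠ 0) : VacuumProperty 𝒱.vac (YP M₁ M₂ z) := by
  intro n
  have h0 : 𝒱.vac ∈ 𝒱.L.zero.eigenspace ((0 : ℤ) : ℂ) := by
    rw [Int.cast_zero]
    exact 𝒱.vac_mem.1
  have hK : ∀ m, 1 ≤ m → 𝒱.divPow m 𝒱.vac = 0 := fun m hm => by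
    obtain ⟨m, rfl⟩ := Nat.exists_eq_add_of_le' hm
    rw [VertexAlgebra.divPow, LinearMap.smul_apply, pow_succ, Module.End.mul_apply,
      VertexAlgebra.pos_vac hV, map_zero, smul_zero]
  have h₂ : oppMode M₂ 0 (𝒱.vac ⊗ₜ[ℂ] (RatFunc.X ^ n : RatFunc ℂ)) = if n = -1 then 1 else 0 := by
    rw [oppMode_zero_zpow M₂ h0 hK, Finset.sum_range_one, 𝒱.divPow_zero, Module.End.one_apply,
      M₂.vacuum, zpow_zero, one_smul]
    exact if_congr (by simp; omega) rfl rfl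
  have h₁ : oppMode M₁ z (𝒱.vac ⊗ₜ[ℂ] (RatFunc.X ^ n : RatFunc ℂ)) = 0 := by
    rw [oppMode_of_mem M₁ z h0 hK, Finset.sum_range_one, 𝒱.divPow_zero, Module.End.one_apply,
      zpow_zero, one_smul, map_zpow₀, ratInv_X, inv_zpow, ← zpow_neg, ← zpow_add₀ RatFunc.X_ne_zero]
    ext w
    exact tauW_eq_zero M₁.truncation (N := 0)
      (fun n hn => by rw [M₁.vacuum, if_neg (by omega)]; rfl)
      (expansion_X_zpow_coeff hz _)
  refine LinearMap.ext fun lam => TensorProduct.ext' fun w₁ w₂ => ?_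
  rw [YP_apply, tauP_apply, h₁, h₂]
  split_ifs <;> simp

variable {S : Submodule ℂ (TDual W₁ W₂)}

theorem isWeakModule_restrict (hV : 𝒱.IsMobius) (hz : z ≠ 0)
    (hS : S ≤ compSubmodule M₁ M₂ z) (hY : ∀ v n, ∀ x ∈ S, YP M₁ M₂ z v n x ∈ S) :
    IsWeakModule 𝒱 ((YP M₁ M₂ z).restrict S hY) := by
  have hvac : VacuumProperty 𝒱.vac ((YP M₁ M₂ z).restrict S hY) := fun n => by
    ext x : 2
    change YP M₁ M₂ z 𝒱.vac n x = _
    rw [YP_vacuum hV hz]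
    split_ifs <;> rfl
  exact
    { truncation := fun v x => by
        obtain ⟨N, hN⟩ := YP_truncated (hS x.2) v
        exact ⟨N, fun n hn => Subtype.ext (hN n hn)⟩
      vacuum := hvac
      jacobi := jacobiIdentity_restrict hV hz hS hY
      derivative := derivativeProperty_of_jacobi 𝒱 hvac (jacobiIdentity_restrict hV hz hS hY) }

theorem isWeakMobiusModule_restrict (hV : 𝒱.IsMobius) (h₁ : M₁.IsMobius) (h₂ : M₂.IsMobius)
    (hz : z ≠ 0) (hS : S ≤ compSubmodule M₁ M₂ z) (h : IsStable (YP M₁ M₂ z) (LP M₁ M₂ z) S) :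
    IsWeakMobiusModule 𝒱 ((YP M₁ M₂ z).restrict S h.mode)
      ((LP M₁ M₂ z).restrict S h.neg h.zero h.pos) where
  toIsWeakModule := isWeakModule_restrict hV hz hS h.mode
  sl2 :=
    { zero_neg := LinearMap.ext fun x => Subtype.ext
        (LinearMap.congr_fun (LP_isRep M₁ M₂ z).zero_neg (x : TDual W₁ W₂))
      zero_pos := LinearMap.ext fun x => Subtype.ext
        (LinearMap.congr_fun (LP_isRep M₁ M₂ z).zero_pos (x : TDual W₁ W₂))
      neg_pos := LinearMap.ext fun x => Subtype.ext
        (LinearMap.congr_fun (LP_isRep M₁ M₂ z).neg_pos (x : TDual W₁ W₂)) }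
  commutators :=
    { neg := fun v n => LinearMap.ext fun x => Subtype.ext
        (LinearMap.congr_fun ((YP_sl2Commutators z h₁ h₂).neg v n) (x : TDual W₁ W₂))
      zero := fun v n => LinearMap.ext fun x => Subtype.ext
        (LinearMap.congr_fun ((YP_sl2Commutators z h₁ h₂).zero v n) (x : TDual W₁ W₂))
      pos := fun v n => LinearMap.ext fun x => Subtype.ext
        (LinearMap.congr_fun ((YP_sl2Commutators z h₁ h₂).pos v n) (x : TDual W₁ W₂)) }

end Dual

/-! ### Graded subspaces -/

section Graded

variable {ι D : Type*} [AddCommGroup D] [Module ℂ D] {E : ι → Submodule ℂ D}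

theorem finsupp_eq_of_iSupIndep (hE : iSupIndep E) {f g : ι →₀ D} (hf : ∀ i, f i ∈ E i)
    (hg : ∀ i, g i ∈ E i) (h : (f.sum fun _ x => x) = g.sum fun _ x => x) : f = g := by
  classical
  have h1 := (iSupIndep_iff_finsetSum_eq_imp_eq E).1 hE (f.support ∪ g.support) f g
    (fun i _ => ⟨hf i, hg i⟩) (by
      rw [← Finsupp.sum_of_support_subset f Finset.subset_union_left (fun _ x => x) fun _ _ => rfl,
        ← Finsupp.sum_of_support_subset g Finset.subset_union_right (fun _ x => x) fun _ _ => rfl,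
        h])
  ext i
  by_cases hi : i ∈ f.support ∪ g.support
  · exact h1 i hi
  · simp only [Finset.mem_union, Finsupp.mem_support_iff, not_or, not_not] at hi
    rw [hi.1, hi.2]

/-- By independence the homogeneous components of $x$ found in different members of $F$ coincide, so
they lie in all of them. -/
theorem sInf_eq_iSup_inf (hE : iSupIndep E) {F : Set (Submodule ℂ D)} (hF : F.Nonempty)
    (h : ∀ S ∈ F, S = ⨆ i, E i ⊓ S) : sInf F = ⨆ i, E i ⊓ sInf F := by
  refine le_antisymm (fun x hx => ?_) (iSup_le fun i => inf_le_right)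
  have hx' : ∀ S ∈ F, ∃ f : ι →₀ D, (∀ i, f i ∈ E i ⊓ S) ∧ (f.sum fun _ x => x) = x := by
    intro S hS
    rw [← Submodule.mem_iSup_iff_exists_finsupp, ← h S hS]
    exact Submodule.mem_sInf.1 hx S hS
  obtain ⟨S₀, hS₀⟩ := hF
  obtain ⟨f, hf, hfx⟩ := hx' S₀ hS₀
  rw [Submodule.mem_iSup_iff_exists_finsupp]
  refine ⟨f, fun i => ⟨(hf i).1, Submodule.mem_sInf.2 fun S hS => ?_⟩, hfx⟩
  obtain ⟨g, hg, hgx⟩ := hx' S hS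
  rw [finsupp_eq_of_iSupIndep hE (fun i => (hf i).1) (fun i => (hg i).1) (hfx.trans hgx.symm)]
  exact (hg i).2

theorem sup_eq_iSup_inf {S T : Submodule ℂ D} (hS : S = ⨆ i, E i ⊓ S) (hT : T = ⨆ i, E i ⊓ T) :
    S ⊔ T = ⨆ i, E i ⊓ (S ⊔ T) := by
  refine le_antisymm (sup_le ?_ ?_) (iSup_le fun i => inf_le_right)
  · exact hS.le.trans (iSup_mono fun i => inf_le_inf_left _ le_sup_left)
  · exact hT.le.trans (iSup_mono fun i => inf_le_inf_left _ le_sup_right)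

/-- By uniqueness of components, an element of $E_i$ of the form $s+t$ equals $s_i+t_i$. -/
theorem inf_sup_of_graded (hE : iSupIndep E) {S T : Submodule ℂ D} (hS : S = ⨆ i, E i ⊓ S)
    (hT : T = ⨆ i, E i ⊓ T) (i : ι) : E i ⊓ (S ⊔ T) = E i ⊓ S ⊔ E i ⊓ T := by
  classical
  refine le_antisymm ?_ le_inf_sup
  rintro x ⟨hxE, hx⟩
  obtain ⟨s, hs, t, ht, rfl⟩ := Submodule.mem_sup.1 hx
  rw [hS, Submodule.mem_iSup_iff_exists_finsupp] at hs
  rw [hT, Submodule.mem_iSup_iff_exists_finsupp] at ht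
  obtain ⟨f, hf, rfl⟩ := hs
  obtain ⟨g, hg, rfl⟩ := ht
  rw [← Finsupp.sum_add_index' (h := fun _ x => x) (fun _ => rfl) fun _ _ _ => rfl] at hxE ⊢
  have h := finsupp_eq_of_iSupIndep hE (f := f + g)
    (g := Finsupp.single i ((f + g).sum fun _ x => x)) (fun j => add_mem (hf j).1 (hg j).1)
    (fun j => by
      rw [Finsupp.single_apply]
      split_ifs with hj
      · exact hj ▸ hxE
      · exact zero_mem _)
    (by rw [Finsupp.sum_single_index rfl])
  have hi := DFunLike.congr_fun h i
  rw [Finsupp.single_eq_same] at hi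
  rw [← hi]
  exact add_mem (Submodule.mem_sup_left (hf i)) (Submodule.mem_sup_right (hg i))

/-- Group a vanishing sum by the first index: independence of $E$ kills each group, and independence
of $K$ then kills its members. -/
theorem iSupIndep_inf {κ : Type*} {K : κ → Submodule ℂ D} (hE : iSupIndep E) (hK : iSupIndep K) :
    iSupIndep fun p : ι × κ => E p.1 ⊓ K p.2 := by
  classical
  rw [iSupIndep_iff_finsetSum_eq_zero_imp_eq_zero]
  intro s v hv h0 p hp
  have h1 := (iSupIndep_iff_finsetSum_eq_zero_imp_eq_zero E).1 hE (s.image Prod.fst)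
    (fun a => ∑ q ∈ s with q.1 = a, v q)
    (fun a _ => Submodule.sum_mem _ fun q hq => by
      rw [Finset.mem_filter] at hq
      exact hq.2 ▸ (hv q hq.1).1)
    ((Finset.sum_fiberwise_of_maps_to (g := Prod.fst)
      (fun q hq => Finset.mem_image_of_mem _ hq) v).trans h0)
    p.1 (Finset.mem_image_of_mem _ hp)
  have hinj : Set.InjOn Prod.snd
      ((s.filter fun q => q.1 = p.1 : Finset (ι × κ)) : Set (ι × κ)) := by
    intro q hq r hr h
    simp only [Finset.coe_filter, Set.mem_ofPred_eq] at hq hr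
    exact Prod.ext (hq.2.trans hr.2.symm) h
  refine (iSupIndep_iff_finsetSum_eq_zero_imp_eq_zero K).1 hK
    ((s.filter fun q => q.1 = p.1).image Prod.snd)
    (fun b => v (p.1, b)) (fun b hb => ?_) ?_ p.2
    (Finset.mem_image_of_mem _ (Finset.mem_filter.2 ⟨hp, rfl⟩))
  · obtain ⟨q, hq, rfl⟩ := Finset.mem_image.1 hb
    rw [Finset.mem_filter] at hq
    rw [← hq.2]
    exact (hv q hq.1).2
  · rw [Finset.sum_image hinj, ← h1]
    refine Finset.sum_congr rfl fun q hq => ?_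
    rw [← (Finset.mem_filter.1 hq).2]

end Graded

/-! ### The local grading restriction condition -/

section LGR

variable {G V D : Type*} [AddCommGroup V] [Module ℂ V] [AddCommGroup D] [Module ℂ D]
  {Y : Modes V D} {L : Sl2Ops D} {E : ℂ → G → Submodule ℂ D}

theorem IsStable.sInf {F : Set (Submodule ℂ D)} (h : ∀ S ∈ F, IsStable Y L S) :
    IsStable Y L (sInf F) where
  mode v n x hx := Submodule.mem_sInf.2 fun S hS =>
    (h S hS).mode v n x (Submodule.mem_sInf.1 hx S hS)
  neg x hx := Submodule.mem_sInf.2 fun S hS => (h S hS).neg x (Submodule.mem_sInf.1 hx S hS)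
  zero x hx := Submodule.mem_sInf.2 fun S hS => (h S hS).zero x (Submodule.mem_sInf.1 hx S hS)
  pos x hx := Submodule.mem_sInf.2 fun S hS => (h S hS).pos x (Submodule.mem_sInf.1 hx S hS)

theorem map_mem_sup {B : Module.End ℂ D} {S T : Submodule ℂ D} (hS : ∀ x ∈ S, B x ∈ S)
    (hT : ∀ x ∈ T, B x ∈ T) : ∀ x ∈ S ⊔ T, B x ∈ S ⊔ T := by
  intro x hx
  obtain ⟨s, hs, t, ht, rfl⟩ := Submodule.mem_sup.1 hx
  rw [map_add]
  exact Submodule.add_mem_sup (hS s hs) (hT t ht)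

theorem IsStable.sup {S T : Submodule ℂ D} (hS : IsStable Y L S) (hT : IsStable Y L T) :
    IsStable Y L (S ⊔ T) where
  mode v n := map_mem_sup (hS.mode v n) (hT.mode v n)
  neg := map_mem_sup hS.neg hT.neg
  zero := map_mem_sup hS.zero hT.zero
  pos := map_mem_sup hS.pos hT.pos

theorem IsStable.inf {S T : Submodule ℂ D} (hS : IsStable Y L S) (hT : IsStable Y L T) :
    IsStable Y L (S ⊓ T) where
  mode v n x hx := ⟨hS.mode v n x hx.1, hT.mode v n x hx.2⟩
  neg x hx := ⟨hS.neg x hx.1, hT.neg x hx.2⟩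
  zero x hx := ⟨hS.zero x hx.1, hT.zero x hx.2⟩
  pos x hx := ⟨hS.pos x hx.1, hT.pos x hx.2⟩

theorem IsStable.bot : IsStable Y L (⊥ : Submodule ℂ D) := by
  constructor <;> simp

theorem isDoublyGraded_iff {S : Submodule ℂ D} :
    IsDoublyGraded E S ↔ S = ⨆ p : ℂ × G, E p.1 p.2 ⊓ S := by
  rw [IsDoublyGraded, iSup_prod]

/-- The homogeneous subspaces of `S` are finite-dimensional and bounded below in weight. -/
def GradingRestricted (E : ℂ → G → Submodule ℂ D) (S : Submodule ℂ D) : Prop :=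
  ∀ (n : ℂ) (β : G), FiniteDimensional ℂ (E n β ⊓ S : Submodule ℂ D) ∧
    ∃ K : ℤ, ∀ k : ℤ, k < K → E (n + k) β ⊓ S = ⊥

theorem GradingRestricted.mono {S T : Submodule ℂ D} (h : GradingRestricted E T) (hST : S ≤ T) :
    GradingRestricted E S := by
  intro n β
  obtain ⟨h1, K, hK⟩ := h n β
  exact ⟨Submodule.finiteDimensional_of_le (inf_le_inf_left _ hST), K, fun k hk =>
    eq_bot_iff.2 (hK k hk ▸ inf_le_inf_left _ hST)⟩

theorem GradingRestricted.sup (hE : iSupIndep fun p : ℂ × G => E p.1 p.2) {S T : Submodule ℂ D}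
    (hS : GradingRestricted E S) (hT : GradingRestricted E T) (hS' : IsDoublyGraded E S)
    (hT' : IsDoublyGraded E T) : GradingRestricted E (S ⊔ T) := by
  intro n β
  have h : ∀ n β, E n β ⊓ (S ⊔ T) = E n β ⊓ S ⊔ E n β ⊓ T := fun n β =>
    inf_sup_of_graded hE (isDoublyGraded_iff.1 hS') (isDoublyGraded_iff.1 hT') (n, β)
  obtain ⟨h1, K, hK⟩ := hS n β
  obtain ⟨h1', K', hK'⟩ := hT n β
  refine ⟨h n β ▸ Submodule.finiteDimensional_sup _ _, min K K', fun k hk => ?_⟩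
  rw [h, hK k (hk.trans_le (min_le_left _ _)), hK' k (hk.trans_le (min_le_right _ _)), sup_bot_eq]

theorem generated_le {lam : D} {S : Submodule ℂ D} (hlam : lam ∈ S) (hS : IsDoublyGraded E S)
    (hS' : IsStable Y L S) : generated Y L E lam ≤ S :=
  sInf_le ⟨hlam, hS, hS'⟩

/-- $W_\lambda$ is itself a witness, and it lies in any other. Stability of the whole graded space
ensures that the intersection defining $W_\lambda$ is over a nonempty family, so that $W_\lambda$ is
graded. -/
theorem mem_localGradingRestriction_iff (hE : iSupIndep fun p : ℂ × G => E p.1 p.2)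
    (hH : IsStable Y L (⨆ (n : ℂ) (β : G), E n β)) {lam : D} :
    lam ∈ localGradingRestriction Y L E ↔ ∃ S : Submodule ℂ D, lam ∈ S ∧ IsDoublyGraded E S ∧
      IsStable Y L S ∧ GradingRestricted E S := by
  constructor
  · rintro ⟨h1, h2⟩
    refine ⟨generated Y L E lam, Submodule.mem_sInf.2 fun S hS => hS.1, ?_,
      IsStable.sInf fun S hS => hS.2.2, h2⟩
    refine isDoublyGraded_iff.2 (sInf_eq_iSup_inf hE ⟨⨆ (n : ℂ) (β : G), E n β, h1, ?_, hH⟩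
      fun S hS => isDoublyGraded_iff.1 hS.2.1)
    refine le_antisymm ?_ (iSup₂_le fun n β => inf_le_right)
    exact iSup₂_mono fun n β => le_inf le_rfl (le_iSup₂ (f := E) n β)
  · rintro ⟨S, h1, h2, h3, h4⟩
    refine ⟨?_, h4.mono (generated_le h1 h2 h3)⟩
    have h5 : S ≤ ⨆ (n : ℂ) (β : G), E n β := by
      rw [h2]
      exact iSup₂_mono fun n β => inf_le_left
    exact h5 h1

/-- The functionals that satisfy the local grading restriction condition form a stable
subspace. -/
theorem exists_coe_eq_localGradingRestriction (hE : iSupIndep fun p : ℂ × G => E p.1 p.2)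
    (hH : IsStable Y L (⨆ (n : ℂ) (β : G), E n β)) : ∃ S : Submodule ℂ D,
      (S : Set D) = localGradingRestriction Y L E ∧ IsStable Y L S := by
  have hmap : ∀ {B : Module.End ℂ D}, (∀ S, IsStable Y L S → ∀ x ∈ S, B x ∈ S) →
      ∀ lam ∈ localGradingRestriction Y L E, B lam ∈ localGradingRestriction Y L E := by
    intro B hB lam h
    rw [mem_localGradingRestriction_iff hE hH] at h ⊢
    obtain ⟨S, h1, h2, h3, h4⟩ := h
    exact ⟨S, hB S h3 lam h1, h2, h3, h4⟩
  refine ⟨⟨⟨⟨localGradingRestriction Y L E, ?_⟩, ?_⟩, fun c lam h =>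
      hmap (B := c • 1) (fun S _ x hx => S.smul_mem c hx) lam h⟩, rfl,
    ⟨fun v n => hmap fun S hS => hS.mode v n, hmap fun S hS => hS.neg,
      hmap fun S hS => hS.zero, hmap fun S hS => hS.pos⟩⟩
  · intro lam mu h h'
    rw [mem_localGradingRestriction_iff hE hH] at h h' ⊢
    obtain ⟨S, h1, h2, h3, h4⟩ := h
    obtain ⟨S', h1', h2', h3', h4'⟩ := h'
    exact ⟨S ⊔ S', Submodule.add_mem_sup h1 h1', isDoublyGraded_iff.2 (sup_eq_iSup_inf
      (isDoublyGraded_iff.1 h2) (isDoublyGraded_iff.1 h2')), h3.sup h3', h4.sup hE h4' h2 h2'⟩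
  · rw [mem_localGradingRestriction_iff hE hH]
    refine ⟨⊥, zero_mem _, ?_, IsStable.bot, fun n β => ⟨?_, 0, fun k _ => inf_bot_eq _⟩⟩
    · simp [IsDoublyGraded]
    · rw [inf_bot_eq]
      infer_instance

end LGR

/-! ### Weights of opposite vertex operators -/

theorem expansion_X_zpow_succ_coeff (a : ℂ) (e n : ℤ) :
    (expansion a (RatFunc.X ^ (e + 1))).coeff n =
      (expansion a (RatFunc.X ^ e)).coeff (n - 1) + a * (expansion a (RatFunc.X ^ e)).coeff n := by
  rw [zpow_add_one₀ RatFunc.X_ne_zero, mul_comm, map_mul, expansion_X, add_mul,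
    HahnSeries.coeff_add, HahnSeries.C_mul_eq_smul, HahnSeries.coeff_smul, smul_eq_mul]
  congr 1
  have h := HahnSeries.coeff_single_mul_add (r := (1 : ℂ)) (x := expansion a (RatFunc.X ^ e))
    (a := n - 1) (b := (1 : ℤ))
  rwa [sub_add_cancel, one_mul] at h

/-- The derivative of `tᵉ` is `e tᵉ⁻¹`, in terms of expansions in powers of `t - a`. -/
theorem expansion_X_zpow_derivative (a : ℂ) (e n : ℤ) :
    ((n : ℂ) + 1) * (expansion a (RatFunc.X ^ e)).coeff (n + 1) =
      e * (expansion a (RatFunc.X ^ (e - 1))).coeff n := by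
  let d : ℤ → ℤ → ℂ := fun e n => ((n : ℂ) + 1) * (expansion a (RatFunc.X ^ e)).coeff (n + 1) -
    e * (expansion a (RatFunc.X ^ (e - 1))).coeff n
  -- The defect $d$ is multiplied by $t$, expanded as $t+a$, when $e$ increases by one; this is the
  -- product rule.
  have hd : ∀ e n, d (e + 1) n = d e (n - 1) + a * d e n := fun e n => by
    have h1 := expansion_X_zpow_succ_coeff a e (n + 1)
    have h2 := expansion_X_zpow_succ_coeff a (e - 1) n
    rw [sub_add_cancel] at h2
    simp only [d, h1, add_sub_cancel_right, sub_add_cancel, h2]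
    push_cast
    ring
  suffices h : ∀ e n, d e n = 0 from sub_eq_zero.1 (h e n)
  intro e
  induction e with
  | zero =>
    intro n
    simp only [d, zpow_zero, map_one, Int.cast_zero, zero_mul, sub_zero, HahnSeries.coeff_one]
    split_ifs with h
    · have : (n : ℂ) + 1 = 0 := by exact_mod_cast h
      rw [this, zero_mul]
    · rw [mul_zero]
  | succ e ih => exact fun n => by rw [hd, ih, ih, mul_zero, add_zero]
  | pred e ih =>
    have h1 : ∀ n, d (-e - 1) (n - 1) + a * d (-e - 1) n = 0 := fun n => by
      rw [← hd, sub_add_cancel, ih]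
    rcases eq_or_ne a 0 with rfl | ha
    · intro n
      simpa using h1 (n + 1)
    · intro n
      rw [← neg_neg n]
      -- For $a\ne0$ the recursion is solved from the side where the expansions vanish, hence the
      -- reflection $n=-k$. The bound 2 makes both $n$ and $n+1$ negative.
      refine eq_zero_of_eq_smul_succ (d := fun k => d (-e - 1) (-k)) (z := -a⁻¹) (N := 2)
        (fun k => ?_) (fun k hk => ?_) (-n)
      · have h2 := h1 (-k)
        rw [neg_add', smul_eq_mul]
        field_simp
        linear_combination h2
      · simp only [d]
        rw [expansion_X_zpow_coeff ha _ _ (by omega), expansion_X_zpow_coeff ha _ _ (by omega)]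
        ring

section OppMode

variable {G : Type*} [AddCommGroup G] {A : AddSubgroup G} {V : Type*} [AddCommGroup V]
  [Module ℂ V] {𝒱 : VertexAlgebra A V} {W : Type*} [AddCommGroup W] [Module ℂ W]
  {W₁ : Type*} [AddCommGroup W₁] [Module ℂ W₁] {W₂ : Type*} [AddCommGroup W₂] [Module ℂ W₂]

/-- The $L(-1)$-derivative property moves the derivative to $t^e$; it commutes with expansion about
$a$. -/
theorem tauAt_neg (M : GeneralizedModule 𝒱 W) (a : ℂ) (x : V) (e : ℤ) :
    tauAt M a (𝒱.L.neg x ⊗ₜ[ℂ] (RatFunc.X ^ e : RatFunc ℂ)) =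
      (-(e : ℂ)) • tauAt M a (x ⊗ₜ[ℂ] (RatFunc.X ^ (e - 1) : RatFunc ℂ)) := by
  ext w
  rw [LinearMap.smul_apply, tauAt_tmul, tauAt_tmul, tauW_tmul, tauW_tmul, smul_finsum,
    ← finsum_comp_equiv (Equiv.addRight (1 : ℤ))]
  refine finsum_congr fun n => ?_
  rw [Equiv.coe_addRight, ← M.derivative, add_sub_cancel_right, LinearMap.smul_apply, smul_smul,
    smul_smul]
  congr 1
  have := expansion_X_zpow_derivative a e n
  push_cast
  linear_combination -this

variable {M : GeneralizedModule 𝒱 W}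

theorem lie_zero_tauAt_of_mem (hM : M.IsMobius) (a : ℂ) {c : ℂ} {x : V}
    (hx : 𝒱.L.zero x = c • x) (e : ℤ) :
    ⁅M.L.zero + a • M.L.neg, tauAt M a (x ⊗ₜ[ℂ] (RatFunc.X ^ e : RatFunc ℂ))⁆ =
      (c - e - 1) • tauAt M a (x ⊗ₜ[ℂ] (RatFunc.X ^ e : RatFunc ℂ)) := by
  rw [lie_zero_tauAt hM, tensorOp_tmul, tensorOp_tmul, map_add, one_mul, hx,
    ← zpow_one_add₀ RatFunc.X_ne_zero, tauAt_neg, add_sub_cancel_left, ← TensorProduct.smul_tmul',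
    map_smul]
  push_cast
  module

theorem oppMode_zpow (M : GeneralizedModule 𝒱 W) (a : ℂ) {h : ℤ} {v : V}
    (hv : v ∈ 𝒱.L.zero.eigenspace (h : ℂ)) {K : ℕ}
    (hK : ∀ m, K ≤ m → 𝒱.divPow m v = 0) (n : ℤ) :
    oppMode M a (v ⊗ₜ[ℂ] (RatFunc.X ^ n : RatFunc ℂ)) = ∑ p ∈ Finset.range K, ((-1 : ℂ) ^ h) •
      tauAt M a (𝒱.divPow p v ⊗ₜ[ℂ] (RatFunc.X ^ (-n - p - 2 + 2 * h) : RatFunc ℂ)) := by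
  rw [oppMode_of_mem M a hv hK]
  refine Finset.sum_congr rfl fun p _ => ?_
  rw [map_zpow₀, ratInv_X, inv_zpow, ← zpow_neg, ← zpow_add₀ RatFunc.X_ne_zero, tauAt_tmul]
  ring_nf

/-- The $p$-th term has weight $h-p$ and power $t^{-n-p-2+2h}$, and $p$ cancels in the resulting
eigenvalue. -/
theorem lie_zero_oppMode_of_mem (hM : M.IsMobius) (a : ℂ) {h : ℤ} {v : V}
    (hv : v ∈ 𝒱.L.zero.eigenspace (h : ℂ)) (n : ℤ) :
    ⁅M.L.zero + a • M.L.neg, oppMode M a (v ⊗ₜ[ℂ] (RatFunc.X ^ n : RatFunc ℂ))⁆ =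
      ((n : ℂ) + 1 - h) • oppMode M a (v ⊗ₜ[ℂ] (RatFunc.X ^ n : RatFunc ℂ)) := by
  obtain ⟨K, hK⟩ := 𝒱.exists_divPow_eq_zero v
  rw [oppMode_zpow M a hv hK, Ring.lie_def, Finset.mul_sum, Finset.sum_mul,
    ← Finset.sum_sub_distrib, Finset.smul_sum]
  refine Finset.sum_congr rfl fun p _ => ?_
  rw [← Ring.lie_def, commutator_smul, lie_zero_tauAt_of_mem hM a
    (𝒱.zero_divPow (Module.End.mem_eigenspace_iff.1 hv) p)]
  push_cast
  module

theorem lie_LP_zero_YP {M₁ : GeneralizedModule 𝒱 W₁} {M₂ : GeneralizedModule 𝒱 W₂} (z : ℂ)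
    (h₁ : M₁.IsMobius) (h₂ : M₂.IsMobius) {h : ℤ} {v : V}
    (hv : v ∈ 𝒱.L.zero.eigenspace (h : ℂ)) (n : ℤ) :
    ⁅(LP M₁ M₂ z).zero, YP M₁ M₂ z v n⁆ = ((h : ℂ) - n - 1) • YP M₁ M₂ z v n := by
  rw [YP_apply, LP_zero, tauP_eq_dualSum, lie_dualSum, lie_zero_oppMode_of_mem h₁ z hv,
    lie_zero_oppMode_of_mem h₂ 0 hv, ← neg_smul, ← neg_smul, dualSum_smul]
  congr 1
  ring

theorem map_mem_genEigenspace {D : Type*} [AddCommGroup D] [Module ℂ D] {T B : Module.End ℂ D}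
    {c : ℂ} (h : ⁅T, B⁆ = c • B) {n : ℂ} {k : ℕ∞} {x : D} (hx : x ∈ T.genEigenspace n k) :
    B x ∈ T.genEigenspace (n + c) k := by
  rw [Module.End.mem_genEigenspace] at hx ⊢
  obtain ⟨l, hl, hx⟩ := hx
  refine ⟨l, hl, ?_⟩
  have h1 : ∀ l : ℕ, (T - (n + c) • 1) ^ l * B = B * (T - n • 1) ^ l := by
    intro l
    induction l with
    | zero => simp
    | succ l ih =>
      rw [pow_succ, mul_assoc, show (T - (n + c) • 1) * B = B * (T - n • 1) by
        rw [Ring.lie_def, sub_eq_iff_eq_add] at h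
        rw [sub_mul, h, mul_sub, smul_mul_assoc, mul_smul_comm, one_mul, mul_one]
        module, ← mul_assoc, ih, mul_assoc, ← pow_succ]
  rw [LinearMap.mem_ker] at hx ⊢
  rw [← Module.End.mul_apply, h1, Module.End.mul_apply, hx, map_zero]

/-! ### Degrees of opposite vertex operators -/

theorem _root_.Submodule.finsum_mem {ι D : Type*} [AddCommGroup D] [Module ℂ D]
    (S : Submodule ℂ D) {f : ι → D} (h : ∀ i, f i ∈ S) : ∑ᶠ i, f i ∈ S :=
  finsum_induction (· ∈ S) S.zero_mem (fun _ _ => S.add_mem) h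

theorem VertexAlgebra.divPow_mem_deg {α : A} {v : V} (hv : v ∈ 𝒱.deg α) (p : ℕ) :
    𝒱.divPow p v ∈ 𝒱.deg α := by
  refine Submodule.smul_mem _ _ ?_
  induction p with
  | zero => simpa using hv
  | succ p ih =>
    rw [pow_succ', Module.End.mul_apply]
    exact (𝒱.L_deg α _ ih).2.2

theorem oppMode_mem_deg (M : GeneralizedModule 𝒱 W) (a : ℂ) {h : ℤ} {α : A} {v : V}
    (hv : v ∈ 𝒱.L.zero.eigenspace (h : ℂ) ⊓ 𝒱.deg α) (f : RatFunc ℂ) {γ : G} {w : W}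
    (hw : w ∈ M.deg γ) : oppMode M a (v ⊗ₜ f) w ∈ M.deg (α + γ) := by
  obtain ⟨K, hK⟩ := 𝒱.exists_divPow_eq_zero v
  rw [oppMode_of_mem M a hv.1 hK, LinearMap.sum_apply]
  refine Submodule.sum_mem _ fun p _ => Submodule.smul_mem _ _ ?_
  rw [tauW_tmul]
  exact Submodule.finsum_mem _ fun n => Submodule.smul_mem _ _
    (M.mode_deg α γ _ (VertexAlgebra.divPow_mem_deg hv.2 p) w hw n)

variable {M₁ : GeneralizedModule 𝒱 W₁} {M₂ : GeneralizedModule 𝒱 W₂}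

theorem mem_dualDeg {β : G} {lam : TDual W₁ W₂} : lam ∈ dualDeg M₁ M₂ β ↔
    ∀ γ₁ γ₂, γ₁ + γ₂ ≠ -β → ∀ w₁ ∈ M₁.deg γ₁, ∀ w₂ ∈ M₂.deg γ₂, lam (w₁ ⊗ₜ w₂) = 0 := by
  simp only [dualDeg, Submodule.mem_iInf, Submodule.mem_dualAnnihilator]
  constructor
  · intro h γ₁ γ₂ hγ w₁ hw₁ w₂ hw₂
    exact h _ hγ _ (Submodule.mem_iSup_of_mem ⟨(γ₁, γ₂), rfl⟩
      (Submodule.apply_mem_map₂ (TensorProduct.mk ℂ W₁ W₂) hw₁ hw₂))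
  · intro h γ hγ w hw
    have : tensorDeg M₁ M₂ γ ≤ LinearMap.ker lam := iSup_le fun p => Submodule.map₂_le.2
      fun w₁ hw₁ w₂ hw₂ => h _ _ (by rwa [p.2]) w₁ hw₁ w₂ hw₂
    exact this hw

/-- Functionals of degree $\beta$ live on $-\beta$; with this sign the transpose shifts degrees by
$\alpha$ as well. -/
theorem dualSum_mem_dualDeg {B : Module.End ℂ W₁} {C : Module.End ℂ W₂} {α : G}
    (hB : ∀ γ, ∀ w ∈ M₁.deg γ, B w ∈ M₁.deg (α + γ))
    (hC : ∀ γ, ∀ w ∈ M₂.deg γ, C w ∈ M₂.deg (α + γ)) {β : G} {lam : TDual W₁ W₂}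
    (hlam : lam ∈ dualDeg M₁ M₂ β) : dualSum B C lam ∈ dualDeg M₁ M₂ (α + β) := by
  rw [mem_dualDeg] at hlam ⊢
  intro γ₁ γ₂ hγ w₁ hw₁ w₂ hw₂
  have h : ∀ γ, γ = α + (γ₁ + γ₂) → γ ≠ -β := by
    rintro γ rfl h
    exact hγ (by rw [neg_add, ← h]; abel)
  rw [dualSum_apply, hlam _ _ (h _ (add_assoc _ _ _)) _ (hB _ _ hw₁) _ hw₂,
    hlam _ _ (h _ (add_left_comm _ _ _)) _ hw₁ _ (hC _ _ hw₂), add_zero]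

/-- On $w_1\otimes w_2$ of total degree $-\beta$ only the summand of degree $\beta$ can be nonzero,
and homogeneous tensors span. -/
theorem iSupIndep_dualDeg (M₁ : GeneralizedModule 𝒱 W₁) (M₂ : GeneralizedModule 𝒱 W₂) :
    iSupIndep (dualDeg M₁ M₂) := by
  rw [iSupIndep_iff_finsetSum_eq_zero_imp_eq_zero]
  intro s v hv h0 β hβ
  have h : ∀ γ₁, ∀ w₁ ∈ M₁.deg γ₁, ∀ γ₂, ∀ w₂ ∈ M₂.deg γ₂, v β (w₁ ⊗ₜ w₂) = 0 := by
    intro γ₁ w₁ hw₁ γ₂ w₂ hw₂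
    by_cases hγ : γ₁ + γ₂ = -β
    · have h1 := LinearMap.congr_fun h0 (w₁ ⊗ₜ w₂)
      rwa [LinearMap.sum_apply, Finset.sum_eq_single_of_mem β hβ fun b hb hbβ =>
        mem_dualDeg.1 (hv b hb) γ₁ γ₂ (fun h => hbβ (neg_injective (h.symm.trans hγ)))
          w₁ hw₁ w₂ hw₂] at h1
    · exact mem_dualDeg.1 (hv β hβ) γ₁ γ₂ hγ w₁ hw₁ w₂ hw₂
  refine TensorProduct.ext' fun w₁ w₂ => ?_
  have hw₁ : w₁ ∈ iSup M₁.deg := M₁.deg_grading.2 ▸ Submodule.mem_top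
  have hw₂ : w₂ ∈ iSup M₂.deg := M₂.deg_grading.2 ▸ Submodule.mem_top
  rw [LinearMap.zero_apply]
  induction hw₁ using Submodule.iSup_induction' with
  | zero => simp
  | add x y _ _ hx hy => rw [TensorProduct.add_tmul, map_add, hx, hy, add_zero]
  | mem γ₁ w₁ hw₁ =>
    induction hw₂ using Submodule.iSup_induction' with
    | zero => simp
    | add x y _ _ hx hy => rw [TensorProduct.tmul_add, map_add, hx, hy, add_zero]
    | mem γ₂ w₂ hw₂ => exact h γ₁ w₁ hw₁ γ₂ w₂ hw₂

/-! ### The doubly graded subspaces of the dual space -/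

variable (M₁ M₂) in
/-- The intersections of `((W₁ ⊗ W₂)^*)^{(β)}` with generalized eigenspaces of `L'_{P(z)}(0)` of
exponent `k`. -/
def dualPiece (z : ℂ) (k : ℕ∞) (n : ℂ) (β : G) : Submodule ℂ (TDual W₁ W₂) :=
  (LP M₁ M₂ z).zero.genEigenspace n k ⊓ dualDeg M₁ M₂ β

theorem iSupIndep_dualPiece (z : ℂ) (k : ℕ∞) :
    iSupIndep fun p : ℂ × G => dualPiece M₁ M₂ z k p.1 p.2 :=
  iSupIndep_inf (Module.End.independent_genEigenspace _ k) (iSupIndep_dualDeg M₁ M₂)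

theorem map_mem_iSup_dualPiece {z : ℂ} {k : ℕ∞} {T : Module.End ℂ (TDual W₁ W₂)} {c : ℂ} {α : G}
    (hT : ⁅(LP M₁ M₂ z).zero, T⁆ = c • T)
    (hα : ∀ β, ∀ lam ∈ dualDeg M₁ M₂ β, T lam ∈ dualDeg M₁ M₂ (α + β)) :
    ∀ x ∈ ⨆ (n : ℂ) (β : G), dualPiece M₁ M₂ z k n β,
      T x ∈ ⨆ (n : ℂ) (β : G), dualPiece M₁ M₂ z k n β := by
  suffices h : (⨆ (n : ℂ) (β : G), dualPiece M₁ M₂ z k n β) ≤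
      Submodule.comap T (⨆ (n : ℂ) (β : G), dualPiece M₁ M₂ z k n β) from h
  refine iSup₂_le fun n β x hx => ?_
  exact Submodule.mem_iSup_of_mem (n + c) (Submodule.mem_iSup_of_mem (α + β)
    ⟨map_mem_genEigenspace hT hx.1, hα β x hx.2⟩)

theorem isStable_iSup_dualPiece (h₁ : M₁.IsMobius) (h₂ : M₂.IsMobius) (z : ℂ) (k : ℕ∞) :
    IsStable (YP M₁ M₂ z) (LP M₁ M₂ z) (⨆ (n : ℂ) (β : G), dualPiece M₁ M₂ z k n β) where
  mode v n := by
    have hv : v ∈ ⨆ (α : A) (h : ℤ), 𝒱.L.zero.eigenspace (h : ℂ) ⊓ 𝒱.deg α := by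
      simp_rw [← 𝒱.compat]
      exact 𝒱.deg_grading.2 ▸ Submodule.mem_top
    rw [iSup_prod'] at hv
    induction hv using Submodule.iSup_induction' with
    | zero => simp
    | add x y _ _ hx hy =>
      intro lam hlam
      rw [map_add, Pi.add_apply, LinearMap.add_apply]
      exact add_mem (hx lam hlam) (hy lam hlam)
    | mem i v hv =>
      refine map_mem_iSup_dualPiece (α := (i.1 : G)) (lie_LP_zero_YP z h₁ h₂ hv.1 n)
        fun β lam hlam => ?_
      rw [YP_apply, tauP_eq_dualSum]
      exact dualSum_mem_dualDeg (fun γ w hw => oppMode_mem_deg M₁ z hv _ hw)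
        (fun γ w hw => oppMode_mem_deg M₂ 0 hv _ hw) hlam
  neg := map_mem_iSup_dualPiece (c := 1) (α := 0)
    ((LP_isRep M₁ M₂ z).zero_neg.trans (one_smul _ _).symm) fun β lam hlam => by
      rw [LP_neg]
      exact dualSum_mem_dualDeg (fun γ w hw => by
        rw [zero_add]
        obtain ⟨h₁, h₂, h₃⟩ := M₁.L_deg γ w hw
        exact add_mem (add_mem h₃ (Submodule.smul_mem _ _ h₂)) (Submodule.smul_mem _ _ h₁))
        (fun γ w hw => by
        rw [zero_add]
        obtain ⟨h₁, h₂, h₃⟩ := M₂.L_deg γ w hw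
        exact add_mem (add_mem h₃ (Submodule.smul_mem _ _ h₂)) (Submodule.smul_mem _ _ h₁)) hlam
  zero := map_mem_iSup_dualPiece (c := 0) (α := 0)
    ((commutator_self _).trans (zero_smul _ _).symm) fun β lam hlam => by
      rw [LP_zero]
      exact dualSum_mem_dualDeg (fun γ w hw => by
        rw [zero_add]
        obtain ⟨h₁, h₂, h₃⟩ := M₁.L_deg γ w hw
        exact add_mem h₂ (Submodule.smul_mem _ _ h₁))
        (fun γ w hw => by
        rw [zero_add]
        obtain ⟨h₁, h₂, h₃⟩ := M₂.L_deg γ w hw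
        exact add_mem h₂ (Submodule.smul_mem _ _ h₁)) hlam
  pos := map_mem_iSup_dualPiece (c := -1) (α := 0)
    ((LP_isRep M₁ M₂ z).zero_pos.trans (neg_one_smul _ _).symm) fun β lam hlam => by
      rw [LP_pos]
      exact dualSum_mem_dualDeg (fun γ w hw => by
        rw [zero_add]
        exact (M₁.L_deg γ w hw).1)
        (fun γ w hw => by
        rw [zero_add]
        exact (M₂.L_deg γ w hw).1) hlam

end OppMode

/-! ### The weak modules for a Möbius vertex algebra -/

section Mobius

variable {G : Type*} [AddCommGroup G] {A : AddSubgroup G} {V : Type*} [AddCommGroup V]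
  [Module ℂ V] {𝒱 : VertexAlgebra A V}
  {W₁ : Type*} [AddCommGroup W₁] [Module ℂ W₁] {W₂ : Type*} [AddCommGroup W₂] [Module ℂ W₂]
  {M₁ : GeneralizedModule 𝒱 W₁} {M₂ : GeneralizedModule 𝒱 W₂} {z : ℂ}

theorem IsWeakMobiusModuleOn.isWeakModuleOn {A V W : Type*} [AddCommGroup A] [AddCommGroup V]
    [Module ℂ V] [AddCommGroup W] [Module ℂ W] {𝒱 : VertexAlgebra A V} {Y : Modes V W}
    {L : Sl2Ops W} {P : Set W} (h : IsWeakMobiusModuleOn 𝒱 Y L P) : IsWeakModuleOn 𝒱 Y P := by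
  obtain ⟨S, hS, hY, h1, h2, h3, h⟩ := h
  exact ⟨S, hS, hY, h.toIsWeakModule⟩

theorem isStable_compSubmodule (h₁ : M₁.IsMobius) (h₂ : M₂.IsMobius) :
    IsStable (YP M₁ M₂ z) (LP M₁ M₂ z) (compSubmodule M₁ M₂ z) where
  mode v n _ hx := YP_mem_compSubmodule hx v n
  neg _ hx := (LP_mem_compSubmodule h₁ h₂ hx).1
  zero _ hx := (LP_mem_compSubmodule h₁ h₂ hx).2.1
  pos _ hx := (LP_mem_compSubmodule h₁ h₂ hx).2.2

theorem isWeakMobiusModuleOn_compP (hV : 𝒱.IsMobius) (h₁ : M₁.IsMobius) (h₂ : M₂.IsMobius)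
    (hz : z ≠ 0) :
    IsWeakMobiusModuleOn 𝒱 (YP M₁ M₂ z) (LP M₁ M₂ z) (compP M₁ M₂ z) :=
  have h := isStable_compSubmodule h₁ h₂
  ⟨compSubmodule M₁ M₂ z, coe_compSubmodule, h.mode, h.neg, h.zero, h.pos,
    isWeakMobiusModule_restrict hV h₁ h₂ hz le_rfl h⟩

/-- The exponent $k$ covers both grading conditions: $k=\top$ gives generalized eigenspaces and
$k=1$ gives eigenspaces. -/
theorem isWeakMobiusModuleOn_inter (hV : 𝒱.IsMobius) (h₁ : M₁.IsMobius) (h₂ : M₂.IsMobius)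
    (hz : z ≠ 0) (k : ℕ∞) : IsWeakMobiusModuleOn 𝒱 (YP M₁ M₂ z) (LP M₁ M₂ z)
      (compP M₁ M₂ z ∩ localGradingRestriction (YP M₁ M₂ z) (LP M₁ M₂ z)
        (dualPiece M₁ M₂ z k)) := by
  obtain ⟨S, hS, hS'⟩ := exists_coe_eq_localGradingRestriction (iSupIndep_dualPiece z k)
    (isStable_iSup_dualPiece h₁ h₂ z k)
  have h := (isStable_compSubmodule (z := z) h₁ h₂).inf hS'
  exact ⟨compSubmodule M₁ M₂ z ⊓ S, by rw [Submodule.coe_inf, hS, coe_compSubmodule],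
    h.mode, h.neg, h.zero, h.pos, isWeakMobiusModule_restrict hV h₁ h₂ hz inf_le_left h⟩

theorem isWeakMobiusModuleOn_lgrGen (hV : 𝒱.IsMobius) (h₁ : M₁.IsMobius) (h₂ : M₂.IsMobius)
    (hz : z ≠ 0) : IsWeakMobiusModuleOn 𝒱 (YP M₁ M₂ z) (LP M₁ M₂ z)
      (compP M₁ M₂ z ∩ lgrGen M₁ M₂ z (LP M₁ M₂ z)) :=
  isWeakMobiusModuleOn_inter hV h₁ h₂ hz ⊤

theorem isWeakMobiusModuleOn_lgrSemisimple (hV : 𝒱.IsMobius) (h₁ : M₁.IsMobius)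
    (h₂ : M₂.IsMobius) (hz : z ≠ 0) : IsWeakMobiusModuleOn 𝒱 (YP M₁ M₂ z) (LP M₁ M₂ z)
      (compP M₁ M₂ z ∩ lgrSemisimple M₁ M₂ z (LP M₁ M₂ z)) :=
  isWeakMobiusModuleOn_inter hV h₁ h₂ hz 1

end Mobius

/-! ### Conformal vertex algebras -/

section Modes

variable {V W : Type*} [AddCommGroup V] [Module ℂ V] [AddCommGroup W] [Module ℂ W]

/-- The commutator formula. -/
theorem lie_modes_of_jacobi {YV : Modes V V} {Y : Modes V W} (hJ : JacobiIdentity YV Y) (u v : V)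
    (m : ℕ) (k : ℤ) : ⁅Y u m, Y v k⁆ =
      ∑ i ∈ Finset.range (m + 1), ((m.choose i : ℕ) : ℂ) • Y (YV u i v) (m + k - i) := by
  ext w
  have h := hJ u v w 0 m k
  have hz : ∀ i : ℕ, i ≠ 0 → (Ring.choose (0 : ℤ) i : ℤ) = 0 := fun i hi =>
    Ring.choose_zero_pos ℤ (Nat.pos_of_ne_zero hi)
  rw [finsum_eq_single _ 0 fun i hi => by rw [hz i hi]; simp,
    finsum_eq_single _ 0 fun i hi => by rw [hz i hi]; simp,
    finsum_eq_sum_range (B := m + 1) fun i hi => by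
      rw [Ring.choose_natCast, Nat.choose_eq_zero_of_lt hi]; simp] at h
  simp only [Ring.choose_natCast] at h
  rw [Ring.lie_def, LinearMap.sum_apply]
  simpa using h

/-- With $L(j)=\omega_{j+1}$ this is the commutator formula for $u=\omega$, where only
$\omega_iv=L(i-1)v$ with $i\le2$ occur. -/
theorem sl2Commutators_of_virasoro {YV : Modes V V} {Y : Modes V W} {LV : Sl2Ops V} {L : Sl2Ops W}
    {ω : V} {c : ℂ} (hJ : JacobiIdentity YV Y) (hV : VirasoroRelations ω c LV YV)
    (hW : VirasoroRelations ω c L Y) : Sl2Commutators LV L Y where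
  neg v n := by
    rw [hW.neg_eq, hV.neg_eq, ← Nat.cast_zero, lie_modes_of_jacobi hJ]
    simp
  zero v n := by
    rw [hW.zero_eq, hV.neg_eq, hV.zero_eq, ← Nat.cast_one, lie_modes_of_jacobi hJ]
    simp [Finset.sum_range_succ, add_comm]
  pos v n := by
    have h : (2 : ℤ) = (2 : ℕ) := rfl
    rw [hW.pos_eq, hV.neg_eq, hV.zero_eq, hV.pos_eq, h, lie_modes_of_jacobi hJ]
    simp only [Finset.sum_range_succ, Finset.sum_range_zero, zero_add, Nat.choose_zero_right,
      Nat.choose_one_right, Nat.choose_self, Nat.cast_one, one_smul, Nat.cast_ofNat, Nat.cast_zero,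
      sub_zero, add_sub_cancel_left]
    rw [show (2 : ℤ) + n - 1 = n + 1 by ring, add_comm 2 n]
    abel

end Modes

/-- Apply $[L(1),L(-2)]=3L(-1)$, which has no central term, to $\mathbf 1$: $L(-2)\mathbf 1=\omega$,
while $L(1)$ and $L(-1)$ kill $\mathbf 1$. -/
theorem VertexAlgebra.IsConformal.pos_eq_zero {A V : Type*} [AddCommGroup A] [AddCommGroup V]
    [Module ℂ V] {𝒱 : VertexAlgebra A V} {ω : V} {c : ℂ} (h : 𝒱.IsConformal ω c) :
    𝒱.L.pos ω = 0 := by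
  have h1 := LinearMap.congr_fun (h.virasoro.bracket 1 (-2)) 𝒱.vac
  rw [Ring.lie_def, if_neg (by norm_num), zero_smul, add_zero] at h1
  norm_num at h1
  rw [(𝒱.creation ω).2, (𝒱.creation ω).1 2 (by norm_num), (𝒱.creation ω).1 0 le_rfl] at h1
  rw [h.virasoro.pos_eq]
  simpa using h1

section Dual

variable {G : Type*} [AddCommGroup G] {A : AddSubgroup G} {V : Type*} [AddCommGroup V]
  [Module ℂ V] {𝒱 : VertexAlgebra A V} {W : Type*} [AddCommGroup W] [Module ℂ W]
  {W₁ : Type*} [AddCommGroup W₁] [Module ℂ W₁] {W₂ : Type*} [AddCommGroup W₂] [Module ℂ W₂]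
  {ω : V} {c : ℂ}

theorem VertexAlgebra.IsConformal.isMobius (h : 𝒱.IsConformal ω c) : 𝒱.IsMobius :=
  sl2Commutators_of_virasoro 𝒱.jacobi h.virasoro h.virasoro

theorem GeneralizedModule.IsConformal.isMobius {M : GeneralizedModule 𝒱 W}
    (hM : M.IsConformal ω c) (h : 𝒱.IsConformal ω c) : M.IsMobius :=
  sl2Commutators_of_virasoro M.jacobi h.virasoro hM

/-- Since $L(1)\omega=0$ and $\omega$ has weight 2, $\omega^o=\omega\otimes t^2$. So $\omega\otimes
t^j$ acts through $(t+a)^{2-j}$, expanded in $\omega_i=L(i-1)$. -/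
theorem oppMode_conformal {M : GeneralizedModule 𝒱 W} (h : 𝒱.IsConformal ω c)
    (hM : M.IsConformal ω c) (a : ℂ) :
    oppMode M a (ω ⊗ₜ[ℂ] (RatFunc.X ^ (0 : ℤ) : RatFunc ℂ)) =
        M.L.pos + (2 * a) • M.L.zero + a ^ 2 • M.L.neg ∧
      oppMode M a (ω ⊗ₜ[ℂ] (RatFunc.X ^ (1 : ℤ) : RatFunc ℂ)) = M.L.zero + a • M.L.neg ∧
      oppMode M a (ω ⊗ₜ[ℂ] (RatFunc.X ^ (2 : ℤ) : RatFunc ℂ)) = M.L.neg := by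
  have h0 : ω ∈ 𝒱.L.zero.eigenspace ((2 : ℤ) : ℂ) := by
    rw [Int.cast_ofNat]
    exact h.mem.1
  have hK : ∀ m, 1 ≤ m → 𝒱.divPow m ω = 0 := fun m hm => by
    obtain ⟨m, rfl⟩ := Nat.exists_eq_add_of_le' hm
    rw [VertexAlgebra.divPow, LinearMap.smul_apply, pow_succ, Module.End.mul_apply,
      h.pos_eq_zero, map_zero, smul_zero]
  have hone : tauAt M a (ω ⊗ₜ[ℂ] (1 : RatFunc ℂ)) = M.L.neg := by
    rw [tauAt_tmul, map_one, ← HahnSeries.single_zero_one, tauW_single, one_smul, hM.neg_eq]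
  have hX : tauAt M a (ω ⊗ₜ[ℂ] (RatFunc.X : RatFunc ℂ)) = M.L.zero + a • M.L.neg := by
    rw [← mul_one RatFunc.X, tauAt_tensorOp_X, hone, map_one, ← HahnSeries.single_zero_one,
      mulT_single, tauW_single, one_smul, hM.zero_eq, zero_add]
  have hX2 : tauAt M a (ω ⊗ₜ[ℂ] (RatFunc.X ^ 2 : RatFunc ℂ)) =
      M.L.pos + (2 * a) • M.L.zero + a ^ 2 • M.L.neg := by
    rw [sq, tauAt_tensorOp_X, hX, expansion_X, map_add, mulT_single, TensorProduct.tmul_add,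
      map_add, tauW_single, one_smul, ← mul_one (HahnSeries.C a), HahnSeries.C_mul_eq_smul,
      ← HahnSeries.single_zero_one, map_smul, mulT_single, TensorProduct.tmul_smul, map_smul,
      tauW_single, one_smul, hM.pos_eq, hM.zero_eq]
    norm_num
    module
  refine ⟨?_, ?_, ?_⟩
  · rw [oppMode_zpow M a h0 hK, ← hX2]
    simp [𝒱.divPow_zero]
  · rw [oppMode_zpow M a h0 hK, ← hX]
    simp [𝒱.divPow_zero]
  · rw [oppMode_zpow M a h0 hK, ← hone]
    simp [𝒱.divPow_zero]

theorem LPConformal_eq_LP {M₁ : GeneralizedModule 𝒱 W₁} {M₂ : GeneralizedModule 𝒱 W₂}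
    (h : 𝒱.IsConformal ω c) (h₁ : M₁.IsConformal ω c) (h₂ : M₂.IsConformal ω c) (z : ℂ) :
    LPConformal M₁ M₂ z ω = LP M₁ M₂ z := by
  have e₁ : YP M₁ M₂ z ω 0 = (LP M₁ M₂ z).neg := by
    rw [YP_apply, tauP_eq_dualSum, (oppMode_conformal h h₁ z).1, (oppMode_conformal h h₂ 0).1,
      LP_neg]
  have e₂ : YP M₁ M₂ z ω 1 = (LP M₁ M₂ z).zero := by
    rw [YP_apply, tauP_eq_dualSum, (oppMode_conformal h h₁ z).2.1, (oppMode_conformal h h₂ 0).2.1,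
      LP_zero]
  have e₃ : YP M₁ M₂ z ω 2 = (LP M₁ M₂ z).pos := by
    rw [YP_apply, tauP_eq_dualSum, (oppMode_conformal h h₁ z).2.2, (oppMode_conformal h h₂ 0).2.2,
      LP_pos]
  rw [LPConformal, e₁, e₂, e₃]

end Dual

end LogTensor

end

/-! ### The theorem for Möbius and for conformal vertex algebras. -/

open LogTensor in
theorem mainTheorem5 {G : Type*} [AddCommGroup G] {A : AddSubgroup G}
    {V : Type*} [AddCommGroup V] [Module ℂ V]
    {W₁ : Type*} [AddCommGroup W₁] [Module ℂ W₁] {W₂ : Type*} [AddCommGroup W₂] [Module ℂ W₂]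
    (𝒱 : VertexAlgebra A V) (M₁ : GeneralizedModule 𝒱 W₁) (M₂ : GeneralizedModule 𝒱 W₂)
    (z : ℂ) (hz : z ≠ 0) :
    (𝒱.IsMobius → M₁.IsMobius → M₂.IsMobius →
      IsWeakMobiusModuleOn 𝒱 (YP M₁ M₂ z) (LP M₁ M₂ z) (compP M₁ M₂ z) ∧
      IsWeakMobiusModuleOn 𝒱 (YP M₁ M₂ z) (LP M₁ M₂ z)
        (compP M₁ M₂ z ∩ lgrGen M₁ M₂ z (LP M₁ M₂ z)) ∧
      IsWeakMobiusModuleOn 𝒱 (YP M₁ M₂ z) (LP M₁ M₂ z)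
        (compP M₁ M₂ z ∩ lgrSemisimple M₁ M₂ z (LP M₁ M₂ z))) ∧
    (∀ (ω : V) (c : ℂ), 𝒱.IsConformal ω c → M₁.IsConformal ω c → M₂.IsConformal ω c →
      IsWeakModuleOn 𝒱 (YP M₁ M₂ z) (compP M₁ M₂ z) ∧
      IsWeakModuleOn 𝒱 (YP M₁ M₂ z)
        (compP M₁ M₂ z ∩ lgrGen M₁ M₂ z (LPConformal M₁ M₂ z ω)) ∧
      IsWeakModuleOn 𝒱 (YP M₁ M₂ z)
        (compP M₁ M₂ z ∩ lgrSemisimple M₁ M₂ z (LPConformal M₁ M₂ z ω))) := by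
  refine ⟨fun hV h₁ h₂ => ⟨isWeakMobiusModuleOn_compP hV h₁ h₂ hz,
    isWeakMobiusModuleOn_lgrGen hV h₁ h₂ hz, isWeakMobiusModuleOn_lgrSemisimple hV h₁ h₂ hz⟩,
    fun ω c h h₁ h₂ => ?_⟩
  have hV := h.isMobius
  have h₁' := h₁.isMobius h
  have h₂' := h₂.isMobius h
  rw [LPConformal_eq_LP h h₁ h₂]
  exact ⟨(isWeakMobiusModuleOn_compP hV h₁' h₂' hz).isWeakModuleOn,
    (isWeakMobiusModuleOn_lgrGen hV h₁' h₂' hz).isWeakModuleOn,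
    (isWeakMobiusModuleOn_lgrSemisimple hV h₁' h₂' hz).isWeakModuleOn⟩
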